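/- **Setting.** LE-$\mathcal{ALC}$ concepts are $C ::= D \mid C_1\wedge C_2 \mid C_1\vee C_2\mid \langle R_\Diamond\rangle C\mid [R_\Box]C$ with $D$ atomic; we write $\Diamond C$ and $\Box C$ for the last two. ABox terms are $b\,I\,y$, $b\,R_\Box\,y$, $y\,R_\Diamond\,b$ (relational terms), $b:C$ and $y::C$, with $b$ an object name and $y$ a feature name. An ABox $\mathcal A$ is a finite list of terms and negated terms. Its size $|\mathcal A|$ is its number of symbols, each name counting as one symbol. The concepts occurring in $\mathcal A$ are all subformulas of the concepts in its (possibly negated) terms $b:C$, $y::C$. An interpretation consists of a polarity $(A,X,I)$ with $I$-compatible relations $R_\Box\subseteq A\times X$, $R_\Diamond\subseteq X\times A$ (all sets $R_\Box^{(0)}[x]$, $R_\Box^{(1)}[a]$, $R_\Diamond^{(0)}[a]$, $R_\Diamond^{(1)}[x]$ are Galois-stable), together with an element of $A$ for each object name, an element of $X$ for each feature name and a formal concept for each atomic concept. Concepts are interpreted in the concept lattice: $\wedge,\vee$ as meet and join, $[R_\Box]c$ with extent $R_\Box^{(0)}[\mathrm{int}(c)]$, and $\langle R_\Diamond\rangle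 c$ with intent $R_\Diamond^{(0)}[\mathrm{ext}(c)]$. The term $b:C$ ($y::C$) says that $b$ is in the extent ($y$ is in the intent) of $C$, and $C_1\sqsubseteq C_2$ says that the concept $C_1$ is below $C_2$. $\mathcal A$ is consistent if it has a model, and $\mathcal A\models q$ means that $q$ holds in all models of $\mathcal A$. The queries over $\mathcal A$ use only names and concepts occurring in $\mathcal A$. They are: the Boolean relationship queries $b\,I\,y$, $b\,R_\Box\,y$, $y\,R_\Diamond\,b$; the Boolean membership queries $b:C$, $y::C$; the subsumption queries $C_1\sqsubseteq C_2$; and the naming queries, which replace one individual in a relationship or membership query by a variable $p$ and ask for all individuals $p$ occurring in $\mathcal A$ for which the resulting query is entailed by $\mathcal A$. **Tableaux algorithm.** Starting from $\mathcal A$, as long as the current list contains no clash (a relational term $\beta$ together with $\neg\beta$), pick any applicable rule (one with its premises in the current list and some conclusion missing from it) and add its conclusions. Stop when there is a clash or no rule is applicable. The rules are: * for each concept $C$ occurring in the current list: $a_C:C$ and $x_C::C$; * $b:C,\ y::C\Rightarrow b\,I\,y$; * $b:C_1\wedge C_2\Rightarrow b:C_1,\ b:C_2$, and $y::C_1\vee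 C_2\Rightarrow y::C_1,\ y::C_2$; * $b:\Box C,\ y::C\Rightarrow b\,R_\Box\,y$, and $y::\Diamond C,\ b:C\Rightarrow y\,R_\Diamond\,b$; * $b\,I\,\Box y\Rightarrow b\,R_\Box\,y$; $\;b\,I\,\blacksquare y\Rightarrow y\,R_\Diamond\,b$; $\;\Diamond b\,I\,y\Rightarrow y\,R_\Diamond\,b$; $\;\blacklozenge b\,I\,y\Rightarrow b\,R_\Box\,y$; * $b:C_1,\ b:C_2\Rightarrow b:C_1\wedge C_2$ if $C_1\wedge C_2$ occurs in the current list, and $y::C_1,\ y::C_2\Rightarrow y::C_1\vee C_2$ if $C_1\vee C_2$ occurs in it; * $b\,R_\Box\,y\Rightarrow\blacklozenge b\,I\,y,\ b\,I\,\Box y$, and $y\,R_\Diamond\,b\Rightarrow\Diamond b\,I\,y,\ b\,I\,\blacksquare y$; * $\neg(b:C)\Rightarrow\neg(b\,I\,x_C)$, and $\neg(y::C)\Rightarrow\neg(a_C\,I\,y)$; * $b\,I\,x_C\Rightarrow b:C$, and $a_C\,I\,y\Rightarrow y::C$. Here $a_C$, $x_C$, $\Diamond b$, $\blacklozenge b$,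 $\Box y$, $\blacksquare y$ are new, unique names, except that $\Diamond a_C=a_{\Diamond C}$ and $\Box x_C=x_{\Box C}$. If the algorithm stops without a clash in $\overline{\mathcal A}$, the model read off $\overline{\mathcal A}$ has as objects and features the names occurring in $\overline{\mathcal A}$, plus one object $a_\top$ and one feature $x_\bot$ that are related to nothing. Its relations are those stated in $\overline{\mathcal A}$, names denote themselves, and an occurring atomic concept $D$ denotes $(x_D^\downarrow,a_D^\uparrow)$. (Names that do not occur denote $a_\top$, $x_\bot$; atomic concepts that do not occur denote the concept with empty extent.) **Statement.** There is a polynomial $p$ such that, for every LE-$\mathcal{ALC}$ ABox $\mathcal A$: 1. Every run of the algorithm on $\mathcal A$ makes at most $p(|\mathcal A|)$ rule applications, and every list it reaches has size at most $p(|\mathcal A|)$. 2. A run that stops ends with a clash if and only if $\mathcal A$ is inconsistent. 3. If a run stops without a clash, the model read off its result is a model of $\mathcal A$ and is universal: for every Boolean query $q$ over $\mathcal A$, $\mathcal A\models q$ if and only if $q$ holds in that model. 4. A single execution of an explicit deterministic implementation of the algorithm on $\mathcal A$ halts within $p(|\mathcal A|)$ elementary steps, with the outcome of some run. From this one outcome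 every query over $\mathcal A$ can be answered correctly within $p(|\mathcal A|)$ further elementary steps. If a clash was found, every Boolean query is answered "yes". Otherwise relationship queries are looked up directly in the universal model, and $b:C$, $y::C$, $C_1\sqsubseteq C_2$ are looked up as $b\,I\,x_C$, $a_C\,I\,y$, $a_{C_1}\,I\,x_{C_2}$. Naming queries are answered by trying all names of $\mathcal A$ of the right sort. Elementary steps are calls of recursive functions on lists, concepts and names. Each call does, besides its recursive calls, a bounded number of constructor operations and comparisons of single symbols. -/

import Mathlib

universe u

namespace LEALC

/-! ## Syntax -/

/-- Concepts over a set `AT` of atomic concept names: `C ∧ D`, `C ∨ D`, `⟨R_◇⟩ C`, `[R_□] C`. -/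
inductive Con (AT : Type u) : Type u
  | atom (D : AT)
  | and (C D : Con AT)
  | or (C D : Con AT)
  | dia (C : Con AT)
  | box (C : Con AT)
  deriving DecidableEq

/-- The unnegated ABox terms over object names `O`, feature names `X`, atomic concepts `AT`:
`a I x`, `a R_□ x`, `x R_◇ a`, `a : C` and `x :: C`. -/
inductive Term (O X AT : Type u) : Type u
  | inc (a : O) (x : X)
  | boxR (a : O) (x : X)
  | diaR (x : X) (a : O)
  | objMem (a : O) (C : Con AT)
  | featMem (x : X) (C : Con AT)
  deriving DecidableEq

/-- ABox assertions: terms and negated terms. -/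
inductive Assertion (O X AT : Type u) : Type u
  | pos (t : Term O X AT)
  | neg (t : Term O X AT)
  deriving DecidableEq

/-- Object names of the tableau: the names `a` of the language, the classifying objects `a_C`,
and the names `◇b`, `◆b`. -/
inductive ObjName (OBJ AT : Type u) : Type u
  | ind (a : OBJ)
  | cls (C : Con AT)
  | dia (b : ObjName OBJ AT)
  | bdia (b : ObjName OBJ AT)
  deriving DecidableEq

/-- Feature names of the tableau: the names `x` of the language, the classifying features `x_C`,
and the names `□y`, `■y`. -/
inductive FeatName (FEAT AT : Type u) : Type u
  | ind (x : FEAT)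
  | cls (C : Con AT)
  | box (y : FeatName FEAT AT)
  | bbox (y : FeatName FEAT AT)
  deriving DecidableEq

/-- An ABox, given as a finite list of assertions. -/
abbrev ABox (OBJ FEAT AT : Type u) : Type u := List (Assertion OBJ FEAT AT)

/-- A tableau is an ABox over the extended sets of names. -/
abbrev Tableau (OBJ FEAT AT : Type u) : Type u :=
  List (Assertion (ObjName OBJ AT) (FeatName FEAT AT) AT)

/-- The name `◇b`, with the identification `◇a_C = a_{◇C}`. -/
def ObjName.mkDia {OBJ AT : Type u} : ObjName OBJ AT → ObjName OBJ AT
  | .cls C => .cls (.dia C)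
  | b => .dia b

/-- The name `□y`, with the identification `□x_C = x_{□C}`. -/
def FeatName.mkBox {FEAT AT : Type u} : FeatName FEAT AT → FeatName FEAT AT
  | .cls C => .cls (.box C)
  | y => .box y

section Occurrence

variable {O X AT : Type u}

/-- The list of subformulas of a concept. -/
def Con.subs : Con AT → List (Con AT)
  | .atom D => [.atom D]
  | .and C D => .and C D :: (C.subs ++ D.subs)
  | .or C D => .or C D :: (C.subs ++ D.subs)
  | .dia C => .dia C :: C.subs
  | .box C => .box C :: C.subs

def Term.objs : Term O X AT → List O
  | .inc a _ => [a]
  | .boxR a _ => [a]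
  | .diaR _ a => [a]
  | .objMem a _ => [a]
  | .featMem _ _ => []

def Term.feats : Term O X AT → List X
  | .inc _ x => [x]
  | .boxR _ x => [x]
  | .diaR x _ => [x]
  | .objMem _ _ => []
  | .featMem x _ => [x]

def Term.con? : Term O X AT → Option (Con AT)
  | .objMem _ C => some C
  | .featMem _ C => some C
  | _ => none

/-- Relational terms: `a I x`, `a R_□ x`, `x R_◇ a`. -/
def Term.isRel : Term O X AT → Bool
  | .inc _ _ => true
  | .boxR _ _ => true
  | .diaR _ _ => true
  | .objMem _ _ => false
  | .featMem _ _ => false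

def Assertion.term : Assertion O X AT → Term O X AT
  | .pos t => t
  | .neg t => t

/-- The object names, the feature names and the concepts (closed under subformulas) that occur in
a list of assertions. -/
def objsIn (B : List (Assertion O X AT)) : List O := B.flatMap fun s => s.term.objs

def featsIn (B : List (Assertion O X AT)) : List X := B.flatMap fun s => s.term.feats

def consIn (B : List (Assertion O X AT)) : List (Con AT) :=
  B.flatMap fun s => s.term.con?.toList.flatMap Con.subs

/-- Replacing the individual names in a term. -/
def Term.map {O' X' : Type u} (f : O → O') (g : X → X') : Term O X AT → Term O' X' AT
  | .inc a x => .inc (f a) (g x)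
  | .boxR a x => .boxR (f a) (g x)
  | .diaR x a => .diaR (g x) (f a)
  | .objMem a C => .objMem (f a) C
  | .featMem x C => .featMem (g x) C

def Assertion.map {O' X' : Type u} (f : O → O') (g : X → X') :
    Assertion O X AT → Assertion O' X' AT
  | .pos t => .pos (t.map f g)
  | .neg t => .neg (t.map f g)

end Occurrence

/-- An assertion of an ABox, seen as an assertion of a tableau. -/
def Assertion.embed {OBJ FEAT AT : Type u} :
    Assertion OBJ FEAT AT → Assertion (ObjName OBJ AT) (FeatName FEAT AT) AT :=
  Assertion.map .ind .ind

/-! ## Sizes: numbers of symbols -/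

def Con.size {AT : Type u} : Con AT → ℕ
  | .atom _ => 1
  | .and C D => C.size + D.size + 1
  | .or C D => C.size + D.size + 1
  | .dia C => C.size + 1
  | .box C => C.size + 1

def ObjName.size {OBJ AT : Type u} : ObjName OBJ AT → ℕ
  | .ind _ => 1
  | .cls C => C.size + 1
  | .dia b => b.size + 1
  | .bdia b => b.size + 1

def FeatName.size {FEAT AT : Type u} : FeatName FEAT AT → ℕ
  | .ind _ => 1
  | .cls C => C.size + 1
  | .box y => y.size + 1
  | .bbox y => y.size + 1

/-- The size of a term, for given sizes of the individual names. -/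
def Term.size {O X AT : Type u} (f : O → ℕ) (g : X → ℕ) : Term O X AT → ℕ
  | .inc a x => f a + g x + 1
  | .boxR a x => f a + g x + 1
  | .diaR x a => f a + g x + 1
  | .objMem a C => f a + C.size + 1
  | .featMem x C => g x + C.size + 1

def Assertion.size {O X AT : Type u} (f : O → ℕ) (g : X → ℕ) : Assertion O X AT → ℕ
  | .pos t => t.size f g
  | .neg t => t.size f g + 1

/-- The size `|A|` of an ABox: its number of symbols, each individual name being one symbol. -/
def ABox.size {OBJ FEAT AT : Type u} (A : ABox OBJ FEAT AT) : ℕ :=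
  (A.map (Assertion.size (fun _ => 1) (fun _ => 1))).sum

def Tableau.size {OBJ FEAT AT : Type u} (B : Tableau OBJ FEAT AT) : ℕ :=
  (B.map (Assertion.size ObjName.size FeatName.size)).sum

/-! ## Semantics -/

/-- Interpretations: an enriched formal context `(A, X, I, R_□, R_◇)`, that is, a polarity with
`I`-compatible relations, with an interpretation of the individual names by objects and features
and of the atomic concepts by formal concepts. `lowerPolar R Y` is `R⁽⁰⁾[Y]` and `upperPolar R B`
is `R⁽¹⁾[B]`; a set of objects (features) is Galois-stable iff it is an extent (intent). -/
structure Interpretation (OBJ FEAT AT : Type u) where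
  Obj : Type u
  Feat : Type u
  I : Obj → Feat → Prop
  RBox : Obj → Feat → Prop
  RDia : Feat → Obj → Prop
  rBox_ext : ∀ x, Order.IsExtent I (lowerPolar RBox {x})
  rBox_int : ∀ a, Order.IsIntent I (upperPolar RBox {a})
  rDia_int : ∀ a, Order.IsIntent I (lowerPolar RDia {a})
  rDia_ext : ∀ x, Order.IsExtent I (upperPolar RDia {x})
  obj : OBJ → Obj
  feat : FEAT → Feat
  atom : AT → Concept Obj Feat I

namespace Interpretation

variable {OBJ FEAT AT : Type u} (M : Interpretation OBJ FEAT AT)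

theorem isExtent_box (Y : Set M.Feat) : Order.IsExtent M.I (lowerPolar M.RBox Y) := by
  have h : lowerPolar M.RBox Y = ⋂ (x) (_ : x ∈ Y), lowerPolar M.RBox {x} := by
    ext a
    simp [mem_lowerPolar_iff]
  rw [h]
  exact Order.IsExtent.iInter₂ _ fun x _ => M.rBox_ext x

theorem isIntent_dia (B : Set M.Obj) : Order.IsIntent M.I (lowerPolar M.RDia B) := by
  have h : lowerPolar M.RDia B = ⋂ (a) (_ : a ∈ B), lowerPolar M.RDia {a} := by
    ext x
    simp [mem_lowerPolar_iff]
  rw [h]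
  exact Order.IsIntent.iInter₂ _ fun a _ => M.rDia_int a

/-- `[R_□] c`, the concept with extent `R_□⁽⁰⁾[intent c]`. -/
def boxOp (c : Concept M.Obj M.Feat M.I) : Concept M.Obj M.Feat M.I :=
  Concept.ofIsExtent M.I (lowerPolar M.RBox c.intent) (M.isExtent_box _)

/-- `⟨R_◇⟩ c`, the concept with intent `R_◇⁽⁰⁾[extent c]`. -/
def diaOp (c : Concept M.Obj M.Feat M.I) : Concept M.Obj M.Feat M.I :=
  Concept.ofIsIntent M.I (lowerPolar M.RDia c.extent) (M.isIntent_dia _)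

/-- The interpretation of a concept in the concept lattice. -/
def con : Con AT → Concept M.Obj M.Feat M.I
  | .atom D => M.atom D
  | .and C D => con C ⊓ con D
  | .or C D => con C ⊔ con D
  | .dia C => M.diaOp (con C)
  | .box C => M.boxOp (con C)

def SatTerm : Term OBJ FEAT AT → Prop
  | .inc a x => M.I (M.obj a) (M.feat x)
  | .boxR a x => M.RBox (M.obj a) (M.feat x)
  | .diaR x a => M.RDia (M.feat x) (M.obj a)
  | .objMem a C => M.obj a ∈ (M.con C).extent
  | .featMem x C => M.feat x ∈ (M.con C).intent

def Sat : Assertion OBJ FEAT AT → Prop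
  | .pos t => M.SatTerm t
  | .neg t => ¬ M.SatTerm t

/-- `M` is a model of the ABox `A`. -/
def IsModel (A : ABox OBJ FEAT AT) : Prop := ∀ s ∈ A, M.Sat s

end Interpretation

def Consistent {OBJ FEAT AT : Type u} (A : ABox OBJ FEAT AT) : Prop :=
  ∃ M : Interpretation OBJ FEAT AT, M.IsModel A

/-! ## Queries -/

/-- Boolean queries: the relationship queries `b I y`, `b R_□ y`, `y R_◇ b` and the membership
queries `b : C`, `y :: C` (together: the unnegated terms), and the subsumption queries `C ⊑ D`. -/
inductive Query (OBJ FEAT AT : Type u) : Type u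
  | term (t : Term OBJ FEAT AT)
  | sub (C D : Con AT)

/-- Queries asking for all objects `p` with `p I y`, `p R_□ y`, `y R_◇ p` or `p : C`. -/
inductive ObjQuery (FEAT AT : Type u) : Type u
  | inc (y : FEAT)
  | boxR (y : FEAT)
  | diaR (y : FEAT)
  | mem (C : Con AT)

/-- Queries asking for all features `p` with `b I p`, `b R_□ p`, `p R_◇ b` or `p :: C`. -/
inductive FeatQuery (OBJ AT : Type u) : Type u
  | inc (b : OBJ)
  | boxR (b : OBJ)
  | diaR (b : OBJ)
  | mem (C : Con AT)

section Queries

variable {OBJ FEAT AT : Type u}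

/-- The Boolean query obtained by putting `p` for the free variable. -/
def ObjQuery.inst (p : OBJ) : ObjQuery FEAT AT → Query OBJ FEAT AT
  | .inc y => .term (.inc p y)
  | .boxR y => .term (.boxR p y)
  | .diaR y => .term (.diaR y p)
  | .mem C => .term (.objMem p C)

def FeatQuery.inst (p : FEAT) : FeatQuery OBJ AT → Query OBJ FEAT AT
  | .inc b => .term (.inc b p)
  | .boxR b => .term (.boxR b p)
  | .diaR b => .term (.diaR p b)
  | .mem C => .term (.featMem p C)

/-- The individual names and the concepts of the query occur in `A`. -/
def Query.Over (A : ABox OBJ FEAT AT) : Query OBJ FEAT AT → Prop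
  | .term t => (∀ b ∈ t.objs, b ∈ objsIn A) ∧ (∀ y ∈ t.feats, y ∈ featsIn A) ∧
      ∀ C ∈ t.con?, C ∈ consIn A
  | .sub C D => C ∈ consIn A ∧ D ∈ consIn A

def ObjQuery.Over (A : ABox OBJ FEAT AT) : ObjQuery FEAT AT → Prop
  | .inc y => y ∈ featsIn A
  | .boxR y => y ∈ featsIn A
  | .diaR y => y ∈ featsIn A
  | .mem C => C ∈ consIn A

def FeatQuery.Over (A : ABox OBJ FEAT AT) : FeatQuery OBJ AT → Prop
  | .inc b => b ∈ objsIn A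
  | .boxR b => b ∈ objsIn A
  | .diaR b => b ∈ objsIn A
  | .mem C => C ∈ consIn A

def Interpretation.Holds (M : Interpretation OBJ FEAT AT) : Query OBJ FEAT AT → Prop
  | .term t => M.SatTerm t
  | .sub C D => M.con C ≤ M.con D

/-- `A ⊨ q`: the query holds in all models of `A`. -/
def Entails (A : ABox OBJ FEAT AT) (q : Query OBJ FEAT AT) : Prop :=
  ∀ M : Interpretation OBJ FEAT AT, M.IsModel A → M.Holds q

end Queries

/-! ## The tableaux algorithm -/

section Algorithm

variable {OBJ FEAT AT : Type u}

/-- `Rule B l`: some expansion rule has its premises in `B` and the list of conclusions `l`. -/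
inductive Rule (B : Tableau OBJ FEAT AT) : Tableau OBJ FEAT AT → Prop
  | create {C} : C ∈ consIn B →
      Rule B [.pos (.objMem (.cls C) C), .pos (.featMem (.cls C) C)]
  | basic {b y C} : .pos (.objMem b C) ∈ B → .pos (.featMem y C) ∈ B →
      Rule B [.pos (.inc b y)]
  | and {b C D} : .pos (.objMem b (.and C D)) ∈ B →
      Rule B [.pos (.objMem b C), .pos (.objMem b D)]
  | or {y C D} : .pos (.featMem y (.or C D)) ∈ B →
      Rule B [.pos (.featMem y C), .pos (.featMem y D)]
  | box {b y C} : .pos (.objMem b (.box C)) ∈ B → .pos (.featMem y C) ∈ B →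
      Rule B [.pos (.boxR b y)]
  | dia {b y C} : .pos (.featMem y (.dia C)) ∈ B → .pos (.objMem b C) ∈ B →
      Rule B [.pos (.diaR y b)]
  | boxName {b y} : .pos (.inc b (.mkBox y)) ∈ B → Rule B [.pos (.boxR b y)]
  | bboxName {b y} : .pos (.inc b (.bbox y)) ∈ B → Rule B [.pos (.diaR y b)]
  | diaName {b y} : .pos (.inc (.mkDia b) y) ∈ B → Rule B [.pos (.diaR y b)]
  | bdiaName {b y} : .pos (.inc (.bdia b) y) ∈ B → Rule B [.pos (.boxR b y)]
  | andInv {b C D} : .pos (.objMem b C) ∈ B → .pos (.objMem b D) ∈ B → .and C D ∈ consIn B →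
      Rule B [.pos (.objMem b (.and C D))]
  | orInv {y C D} : .pos (.featMem y C) ∈ B → .pos (.featMem y D) ∈ B → .or C D ∈ consIn B →
      Rule B [.pos (.featMem y (.or C D))]
  | adjBox {b y} : .pos (.boxR b y) ∈ B →
      Rule B [.pos (.inc (.bdia b) y), .pos (.inc b (.mkBox y))]
  | adjDia {b y} : .pos (.diaR y b) ∈ B →
      Rule B [.pos (.inc (.mkDia b) y), .pos (.inc b (.bbox y))]
  | negObj {b C} : .neg (.objMem b C) ∈ B → Rule B [.neg (.inc b (.cls C))]
  | negFeat {y C} : .neg (.featMem y C) ∈ B → Rule B [.neg (.inc (.cls C) y)]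
  | appFeat {b C} : .pos (.inc b (.cls C)) ∈ B → Rule B [.pos (.objMem b C)]
  | appObj {y C} : .pos (.inc (.cls C) y) ∈ B → Rule B [.pos (.featMem y C)]

/-- A clash: `β` and `¬β` for some relational term `β`. -/
def HasClash (B : Tableau OBJ FEAT AT) : Prop :=
  ∃ t, t.isRel = true ∧ .pos t ∈ B ∧ .neg t ∈ B

/-- No expansion rule is applicable: all conclusions are present already. -/
def Saturated (B : Tableau OBJ FEAT AT) : Prop := ∀ l, Rule B l → ∀ s ∈ l, s ∈ B

/-- `Run A n B`: the tableaux algorithm on input `A` can reach `B` by `n` rule applications. At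
each moment, if there is no clash, any applicable rule may be picked. -/
inductive Run [DecidableEq OBJ] [DecidableEq FEAT] [DecidableEq AT] (A : ABox OBJ FEAT AT) :
    ℕ → Tableau OBJ FEAT AT → Prop
  | start : Run A 0 (A.map Assertion.embed)
  | step {n B l} : Run A n B → ¬ HasClash B → Rule B l → (∃ s ∈ l, s ∉ B) → Run A (n + 1) (l ∪ B)

end Algorithm

/-! ## The model read off a saturated tableau -/

section UniversalModel

variable {OBJ FEAT AT : Type u} (B : Tableau OBJ FEAT AT)

/-- The objects of the model: the object names occurring in `B`, and one further object `none`
(written `a_⊤`) that has no feature. -/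
abbrev ModelObj : Type u := Option {b : ObjName OBJ AT // b ∈ objsIn B}

/-- The features of the model: the feature names occurring in `B`, and one further feature `none`
(written `x_⊥`) that no object has. -/
abbrev ModelFeat : Type u := Option {y : FeatName FEAT AT // y ∈ featsIn B}

def modelI : ModelObj B → ModelFeat B → Prop
  | some b, some y => .pos (.inc b.1 y.1) ∈ B
  | _, _ => False

def modelBox : ModelObj B → ModelFeat B → Prop
  | some b, some y => .pos (.boxR b.1 y.1) ∈ B
  | _, _ => False

def modelDia : ModelFeat B → ModelObj B → Prop
  | some y, some b => .pos (.diaR y.1 b.1) ∈ B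
  | _, _ => False

variable {B}

theorem mem_objsIn {t : Term (ObjName OBJ AT) (FeatName FEAT AT) AT} (h : .pos t ∈ B)
    {b : ObjName OBJ AT} (hb : b ∈ t.objs) : b ∈ objsIn B :=
  List.mem_flatMap.2 ⟨_, h, hb⟩

theorem mem_featsIn {t : Term (ObjName OBJ AT) (FeatName FEAT AT) AT} (h : .pos t ∈ B)
    {y : FeatName FEAT AT} (hy : y ∈ t.feats) : y ∈ featsIn B :=
  List.mem_flatMap.2 ⟨_, h, hy⟩

/-- A set of objects that is empty or the set of all objects with a given feature is stable. -/
theorem isExtent_of {S : Set (ModelObj B)}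
    (h : S.Nonempty → ∃ y, ∀ a, a ∈ S ↔ modelI B a y) : Order.IsExtent (modelI B) S := by
  rcases S.eq_empty_or_nonempty with rfl | hS
  · refine ⟨Set.univ, Set.eq_empty_of_forall_notMem fun a ha => ?_⟩
    have := ha (Set.mem_univ none)
    cases a <;> exact this
  · obtain ⟨y, hy⟩ := h hS
    exact ⟨{y}, by ext a; simp [hy]⟩

theorem isIntent_of {S : Set (ModelFeat B)}
    (h : S.Nonempty → ∃ a, ∀ y, y ∈ S ↔ modelI B a y) : Order.IsIntent (modelI B) S := by
  rcases S.eq_empty_or_nonempty with rfl | hS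
  · refine ⟨Set.univ, Set.eq_empty_of_forall_notMem fun y hy => ?_⟩
    have := hy (Set.mem_univ none)
    cases y <;> exact this
  · obtain ⟨a, ha⟩ := h hS
    exact ⟨{a}, by ext y; simp [ha]⟩

theorem model_rBox_ext (h : Saturated B) (x : ModelFeat B) :
    Order.IsExtent (modelI B) (lowerPolar (modelBox B) {x}) := by
  refine isExtent_of ?_
  rintro ⟨a, ha⟩
  simp only [mem_lowerPolar_singleton] at ha ⊢
  rcases a with _ | a
  · exact ha.elim
  rcases x with _ | y
  · exact ha.elim
  have hy := h _ (.adjBox ha) (.pos (.inc a.1 (.mkBox y.1))) (by simp)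
  refine ⟨some ⟨.mkBox y.1, mem_featsIn hy (by simp [Term.feats])⟩, ?_⟩
  rintro (_ | c)
  · exact Iff.rfl
  · exact ⟨fun hc => h _ (.adjBox hc) (.pos (.inc c.1 (.mkBox y.1))) (by simp),
      fun hc => h _ (.boxName hc) _ (by simp)⟩

theorem model_rBox_int (h : Saturated B) (a : ModelObj B) :
    Order.IsIntent (modelI B) (upperPolar (modelBox B) {a}) := by
  refine isIntent_of ?_
  rintro ⟨y, hy⟩
  simp only [mem_upperPolar_singleton] at hy ⊢
  rcases a with _ | b
  · exact hy.elim
  rcases y with _ | y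
  · exact hy.elim
  have hb := h _ (.adjBox hy) (.pos (.inc (.bdia b.1) y.1)) (by simp)
  refine ⟨some ⟨.bdia b.1, mem_objsIn hb (by simp [Term.objs])⟩, ?_⟩
  rintro (_ | z)
  · exact Iff.rfl
  · exact ⟨fun hz => h _ (.adjBox hz) (.pos (.inc (.bdia b.1) z.1)) (by simp),
      fun hz => h _ (.bdiaName hz) _ (by simp)⟩

theorem model_rDia_int (h : Saturated B) (a : ModelObj B) :
    Order.IsIntent (modelI B) (lowerPolar (modelDia B) {a}) := by
  refine isIntent_of ?_
  rintro ⟨y, hy⟩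
  simp only [mem_lowerPolar_singleton] at hy ⊢
  rcases y with _ | y
  · exact hy.elim
  rcases a with _ | b
  · exact hy.elim
  have hb := h _ (.adjDia hy) (.pos (.inc (.mkDia b.1) y.1)) (by simp)
  refine ⟨some ⟨.mkDia b.1, mem_objsIn hb (by simp [Term.objs])⟩, ?_⟩
  rintro (_ | z)
  · exact Iff.rfl
  · exact ⟨fun hz => h _ (.adjDia hz) (.pos (.inc (.mkDia b.1) z.1)) (by simp),
      fun hz => h _ (.diaName hz) _ (by simp)⟩

theorem model_rDia_ext (h : Saturated B) (x : ModelFeat B) :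
    Order.IsExtent (modelI B) (upperPolar (modelDia B) {x}) := by
  refine isExtent_of ?_
  rintro ⟨a, ha⟩
  simp only [mem_upperPolar_singleton] at ha ⊢
  rcases x with _ | y
  · exact ha.elim
  rcases a with _ | a
  · exact ha.elim
  have hy := h _ (.adjDia ha) (.pos (.inc a.1 (.bbox y.1))) (by simp)
  refine ⟨some ⟨.bbox y.1, mem_featsIn hy (by simp [Term.feats])⟩, ?_⟩
  rintro (_ | c)
  · exact Iff.rfl
  · exact ⟨fun hc => h _ (.adjDia hc) (.pos (.inc c.1 (.bbox y.1))) (by simp),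
      fun hc => h _ (.bboxName hc) _ (by simp)⟩

/-- The extent of an atomic concept `D` in the model: the objects `b` with `b I x_D`. -/
def modelAtom (B : Tableau OBJ FEAT AT) (D : AT) : Set (ModelObj B) :=
  {a | ∃ b, a = some b ∧ .pos (.inc b.1 (.cls (.atom D))) ∈ B}

theorem isExtent_modelAtom (D : AT) : Order.IsExtent (modelI B) (modelAtom B D) := by
  refine isExtent_of ?_
  rintro ⟨_, b, rfl, hb⟩
  refine ⟨some ⟨.cls (.atom D), mem_featsIn hb (by simp [Term.feats])⟩, fun a => ⟨?_, ?_⟩⟩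
  · rintro ⟨c, rfl, hc⟩
    exact hc
  · rcases a with _ | c
    · exact fun h => h.elim
    · exact fun h => ⟨c, rfl, h⟩

/-- The model read off a saturated tableau. Names are interpreted by themselves if they occur in
the tableau; the names and atomic concepts that do not occur get a default interpretation. The
intent of an atomic concept `D` that occurs is `{y | a_D I y}`. -/
def universalModel [DecidableEq OBJ] [DecidableEq FEAT] [DecidableEq AT]
    (B : Tableau OBJ FEAT AT) (h : Saturated B) : Interpretation OBJ FEAT AT where
  Obj := ModelObj B
  Feat := ModelFeat B
  I := modelI B
  RBox := modelBox B
  RDia := modelDia B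
  rBox_ext := model_rBox_ext h
  rBox_int := model_rBox_int h
  rDia_int := model_rDia_int h
  rDia_ext := model_rDia_ext h
  obj a := if ha : .ind a ∈ objsIn B then some ⟨.ind a, ha⟩ else none
  feat x := if hx : .ind x ∈ featsIn B then some ⟨.ind x, hx⟩ else none
  atom D := Concept.ofIsExtent _ (modelAtom B D) (isExtent_modelAtom D)

end UniversalModel

/-! ## A step-counting implementation

Programs are written in the monad `Timed`, which counts elementary steps. Every call of a recursive
function is one step (`tick`); the work done besides in one call is a bounded number of constructor
applications, pattern matches on constructors, and comparisons of two primitive symbols. -/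

/-- A value together with the number of elementary steps of its computation. -/
structure Timed (α : Type u) : Type u where
  val : α
  cost : ℕ

instance : Monad Timed.{u} where
  pure a := ⟨a, 0⟩
  bind x f := ⟨(f x.val).val, x.cost + (f x.val).cost⟩

/-- One elementary step followed by `x`. -/
def tick {α : Type u} (x : Timed α) : Timed α := ⟨x.val, x.cost + 1⟩

/-- Conditional on a computed Boolean. -/
def ifT {α : Type u} (c : Timed Bool) (x y : Timed α) : Timed α :=
  ⟨(bif c.val then x else y).val, c.cost + (bif c.val then x else y).cost⟩

def andT (c d : Timed Bool) : Timed Bool := ifT c d (pure false)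

section ListPrograms

variable {α β : Type u}

def appendT : List α → List α → Timed (List α)
  | [], m => tick (pure m)
  | a :: l, m => tick do
      let r ← appendT l m
      pure (a :: r)

def flatMapT (f : α → Timed (List β)) : List α → Timed (List β)
  | [] => tick (pure [])
  | a :: l => tick do
      let r ← f a
      let s ← flatMapT f l
      appendT r s

def anyT (f : α → Timed Bool) : List α → Timed Bool
  | [] => tick (pure false)
  | a :: l => tick (ifT (f a) (pure true) (anyT f l))

def allT (f : α → Timed Bool) : List α → Timed Bool
  | [] => tick (pure true)
  | a :: l => tick (ifT (f a) (allT f l) (pure false))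

/-- The first element of the list that fails the test. -/
def findFailT (f : α → Timed Bool) : List α → Timed (Option α)
  | [] => tick (pure none)
  | a :: l => tick (ifT (f a) (findFailT f l) (pure (some a)))

def filterT (f : α → Timed Bool) : List α → Timed (List α)
  | [] => tick (pure [])
  | a :: l => tick do
      let r ← filterT f l
      ifT (f a) (pure (a :: r)) (pure r)

end ListPrograms

section Implementation

variable {OBJ FEAT AT : Type u}

def Con.subsT : Con AT → Timed (List (Con AT))
  | .atom D => tick (pure [.atom D])
  | .and C D => tick do
      let r ← C.subsT
      let s ← D.subsT
      let l ← appendT r s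
      pure (.and C D :: l)
  | .or C D => tick do
      let r ← C.subsT
      let s ← D.subsT
      let l ← appendT r s
      pure (.or C D :: l)
  | .dia C => tick do
      let r ← C.subsT
      pure (.dia C :: r)
  | .box C => tick do
      let r ← C.subsT
      pure (.box C :: r)

/-- The concepts occurring in a tableau. -/
def consInT (B : Tableau OBJ FEAT AT) : Timed (List (Con AT)) :=
  flatMapT (fun s => match s.term.con? with
    | some C => C.subsT
    | none => tick (pure [])) B

/-- The name `y` with `z = □y`, if there is one. -/
def FeatName.unbox? : FeatName FEAT AT → Option (FeatName FEAT AT)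
  | .cls (.box C) => some (.cls C)
  | .box (.cls _) => none
  | .box y => some y
  | _ => none

def FeatName.unbbox? : FeatName FEAT AT → Option (FeatName FEAT AT)
  | .bbox y => some y
  | _ => none

def FeatName.con? : FeatName FEAT AT → Option (Con AT)
  | .cls C => some C
  | _ => none

/-- The name `b` with `c = ◇b`, if there is one. -/
def ObjName.undia? : ObjName OBJ AT → Option (ObjName OBJ AT)
  | .cls (.dia C) => some (.cls C)
  | .dia (.cls _) => none
  | .dia b => some b
  | _ => none

def ObjName.unbdia? : ObjName OBJ AT → Option (ObjName OBJ AT)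
  | .bdia b => some b
  | _ => none

def ObjName.con? : ObjName OBJ AT → Option (Con AT)
  | .cls C => some C
  | _ => none

/-- The conclusions of the rules with the single premise `s` (at most six rule instances). -/
def oneRules : Assertion (ObjName OBJ AT) (FeatName FEAT AT) AT → List (Tableau OBJ FEAT AT)
  | .pos (.inc b y) =>
      (y.unbox?.map fun z => [.pos (.boxR b z)]).toList ++
      ((y.unbbox?.map fun z => [.pos (.diaR z b)]).toList ++
      ((b.undia?.map fun c => [.pos (.diaR y c)]).toList ++
      ((b.unbdia?.map fun c => [.pos (.boxR c y)]).toList ++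
      ((y.con?.map fun C => [.pos (.objMem b C)]).toList ++
      (b.con?.map fun C => [.pos (.featMem y C)]).toList))))
  | .pos (.boxR b y) => [[.pos (.inc (.bdia b) y), .pos (.inc b y.mkBox)]]
  | .pos (.diaR y b) => [[.pos (.inc b.mkDia y), .pos (.inc b (.bbox y))]]
  | .pos (.objMem b (.and C D)) => [[.pos (.objMem b C), .pos (.objMem b D)]]
  | .pos (.featMem y (.or C D)) => [[.pos (.featMem y C), .pos (.featMem y D)]]
  | .neg (.objMem b C) => [[.neg (.inc b (.cls C))]]
  | .neg (.featMem y C) => [[.neg (.inc (.cls C) y)]]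
  | _ => []

variable [DecidableEq OBJ] [DecidableEq FEAT] [DecidableEq AT]

/-! Equality tests, symbol by symbol. -/

def Con.eqT : Con AT → Con AT → Timed Bool
  | .atom D, .atom E => tick (pure (decide (D = E)))
  | .and C D, .and E F => tick (andT (C.eqT E) (D.eqT F))
  | .or C D, .or E F => tick (andT (C.eqT E) (D.eqT F))
  | .dia C, .dia E => tick (C.eqT E)
  | .box C, .box E => tick (C.eqT E)
  | _, _ => tick (pure false)

def ObjName.eqT : ObjName OBJ AT → ObjName OBJ AT → Timed Bool
  | .ind a, .ind b => tick (pure (decide (a = b)))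
  | .cls C, .cls D => tick (C.eqT D)
  | .dia a, .dia b => tick (a.eqT b)
  | .bdia a, .bdia b => tick (a.eqT b)
  | _, _ => tick (pure false)

def FeatName.eqT : FeatName FEAT AT → FeatName FEAT AT → Timed Bool
  | .ind x, .ind y => tick (pure (decide (x = y)))
  | .cls C, .cls D => tick (C.eqT D)
  | .box x, .box y => tick (x.eqT y)
  | .bbox x, .bbox y => tick (x.eqT y)
  | _, _ => tick (pure false)

def Term.eqT : Term (ObjName OBJ AT) (FeatName FEAT AT) AT →
    Term (ObjName OBJ AT) (FeatName FEAT AT) AT → Timed Bool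
  | .inc a x, .inc b y => tick (andT (a.eqT b) (x.eqT y))
  | .boxR a x, .boxR b y => tick (andT (a.eqT b) (x.eqT y))
  | .diaR x a, .diaR y b => tick (andT (x.eqT y) (a.eqT b))
  | .objMem a C, .objMem b D => tick (andT (a.eqT b) (C.eqT D))
  | .featMem x C, .featMem y D => tick (andT (x.eqT y) (C.eqT D))
  | _, _ => tick (pure false)

def Assertion.eqT : Assertion (ObjName OBJ AT) (FeatName FEAT AT) AT →
    Assertion (ObjName OBJ AT) (FeatName FEAT AT) AT → Timed Bool
  | .pos s, .pos t => tick (s.eqT t)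
  | .neg s, .neg t => tick (s.eqT t)
  | _, _ => tick (pure false)

def memT (s : Assertion (ObjName OBJ AT) (FeatName FEAT AT) AT) (B : Tableau OBJ FEAT AT) :
    Timed Bool := anyT (fun t => s.eqT t) B

/-- The conclusions of the rules with the premises `s` and `t`, in this order. -/
def twoRulesT : Assertion (ObjName OBJ AT) (FeatName FEAT AT) AT →
    Assertion (ObjName OBJ AT) (FeatName FEAT AT) AT → Timed (List (Tableau OBJ FEAT AT))
  | .pos (.objMem b C), .pos (.featMem y D) => tick do
      let r ← ifT (C.eqT D) (pure [[.pos (.inc b y)]]) (pure [])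
      let s ← match C with
        | .box E => ifT (E.eqT D) (pure [[.pos (.boxR b y)]]) (pure [])
        | _ => pure []
      let t ← match D with
        | .dia E => ifT (E.eqT C) (pure [[.pos (.diaR y b)]]) (pure [])
        | _ => pure []
      let l ← appendT s t
      appendT r l
  | _, _ => tick (pure [])

/-- The conclusions of the inverse rules with premises `s` and `t`, in this order, and the side
condition that `E` occurs. -/
def invRulesT : Con AT → Assertion (ObjName OBJ AT) (FeatName FEAT AT) AT →
    Assertion (ObjName OBJ AT) (FeatName FEAT AT) AT → Timed (List (Tableau OBJ FEAT AT))
  | .and C D, .pos (.objMem b E), .pos (.objMem c F) =>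
      tick (ifT (andT (b.eqT c) (andT (C.eqT E) (D.eqT F)))
        (pure [[.pos (.objMem b (.and C D))]]) (pure []))
  | .or C D, .pos (.featMem y E), .pos (.featMem z F) =>
      tick (ifT (andT (y.eqT z) (andT (C.eqT E) (D.eqT F)))
        (pure [[.pos (.featMem y (.or C D))]]) (pure []))
  | _, _, _ => tick (pure [])

/-- The conclusions of all rule instances with premises in `B`. -/
def rulesT (B : Tableau OBJ FEAT AT) : Timed (List (Tableau OBJ FEAT AT)) := do
  let cs ← consInT B
  let r ← flatMapT (fun C =>
    tick (pure [[.pos (.objMem (.cls C) C), .pos (.featMem (.cls C) C)]])) cs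
  let s ← flatMapT (fun s => tick (pure (oneRules s))) B
  let t ← flatMapT (fun s => flatMapT (fun t => twoRulesT s t) B) B
  let w ← flatMapT (fun E => flatMapT (fun s => flatMapT (fun t => invRulesT E s t) B) B) cs
  let l ← appendT t w
  let l ← appendT s l
  appendT r l

def clashT (B : Tableau OBJ FEAT AT) : Timed Bool :=
  anyT (fun s => match s with
    | .neg t => bif t.isRel then memT (.pos t) B else tick (pure false)
    | .pos _ => tick (pure false)) B

def unionT : Tableau OBJ FEAT AT → Tableau OBJ FEAT AT → Timed (Tableau OBJ FEAT AT)
  | [], B => tick (pure B)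
  | s :: l, B => tick do
      let r ← unionT l B
      ifT (memT s r) (pure r) (pure (s :: r))

/-- The outcome of the tableaux algorithm: a clash was found, or the completion is returned. -/
inductive Outcome (OBJ FEAT AT : Type u) : Type u
  | inconsistent
  | completion (B : Tableau OBJ FEAT AT)

/-- One iteration: look for a clash, look for an applicable rule, apply it. The result is either
the outcome or the new tableau. -/
def iterT (B : Tableau OBJ FEAT AT) : Timed (Outcome OBJ FEAT AT ⊕ Tableau OBJ FEAT AT) :=
  tick (ifT (clashT B) (pure (.inl .inconsistent)) do
    let rs ← rulesT B
    let r ← findFailT (fun l => allT (fun s => memT s B) l) rs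
    match r with
    | none => pure (.inl (.completion B))
    | some l => do
        let B' ← unionT l B
        pure (.inr B'))

/-- `Loop B out k`: iterating from `B` halts with outcome `out` after `k` elementary steps. -/
inductive Loop : Tableau OBJ FEAT AT → Outcome OBJ FEAT AT → ℕ → Prop
  | done {B out} : (iterT B).val = .inl out → Loop B out (iterT B).cost
  | next {B B' out k} : (iterT B).val = .inr B' → Loop B' out k → Loop B out ((iterT B).cost + k)

def initT (A : ABox OBJ FEAT AT) : Timed (Tableau OBJ FEAT AT) :=
  flatMapT (fun s => tick (pure [s.embed])) A

/-- The implementation on input `A` halts with outcome `out` after `k` elementary steps. -/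
def Executes (A : ABox OBJ FEAT AT) (out : Outcome OBJ FEAT AT) (k : ℕ) : Prop :=
  ∃ m, Loop (initT A).val out m ∧ k = (initT A).cost + m

/-- The relational fact to be looked up in the universal model in order to answer a query:
`b : C`, `y :: C` and `C ⊑ D` are read off as `b I x_C`, `a_C I y` and `a_C I x_D`. -/
def Query.lookup : Query OBJ FEAT AT → Term (ObjName OBJ AT) (FeatName FEAT AT) AT
  | .term (.inc b y) => .inc (.ind b) (.ind y)
  | .term (.boxR b y) => .boxR (.ind b) (.ind y)
  | .term (.diaR y b) => .diaR (.ind y) (.ind b)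
  | .term (.objMem b C) => .inc (.ind b) (.cls C)
  | .term (.featMem y C) => .inc (.cls C) (.ind y)
  | .sub C D => .inc (.cls C) (.cls D)

/-- Answering a Boolean query from the outcome of the tableaux algorithm. -/
def answerT (out : Outcome OBJ FEAT AT) (q : Query OBJ FEAT AT) : Timed Bool :=
  match out with
  | .inconsistent => tick (pure true)
  | .completion B => tick (memT (.pos q.lookup) B)

/-- Answering a naming query: all object names (feature names) of `A` are tried. -/
def answerObjT (A : ABox OBJ FEAT AT) (out : Outcome OBJ FEAT AT) (q : ObjQuery FEAT AT) :
    Timed (List OBJ) := do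
  let names ← flatMapT (fun s => tick (pure s.term.objs)) A
  filterT (fun p => answerT out (q.inst p)) names

def answerFeatT (A : ABox OBJ FEAT AT) (out : Outcome OBJ FEAT AT) (q : FeatQuery OBJ AT) :
    Timed (List FEAT) := do
  let names ← flatMapT (fun s => tick (pure s.term.feats)) A
  filterT (fun p => answerT out (q.inst p)) names

end Implementation

end LEALC

open LEALC

/-! The expansion rules are sound in a setting wider than polarities. Take any lattice with adjoint
pairs ◆ ⊣ □ and ◇ ⊣ ■, let objects and features alike denote lattice elements, and read `b I y` as b
≤ y, `b R_□ y` as b ≤ □y, `y R_◇ b` as ◇b ≤ y. If the positive terms of a tableau are true in this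
sense, so are the positive conclusions of every rule (`Valuation.satTerm_of_rule`). This one fact
serves both soundness and termination.

Soundness: the concept lattice of a model is such a lattice, and the algebraic reading of a term
agrees with the relational one (`Interpretation.valuation_satTerm`). Hence a tableau reached from
the ABox states only true things about each model; a clash refutes consistency, and every stated
lookup term is entailed.

Completeness: in a saturated tableau the names □y, ■y, ◇b, ◆b witness the I-compatibility of the
relations, and the classifying names a_C and x_C force the extent and intent of each occurring
concept to consist exactly of the names stated to belong to it (`universalModel_con`). Truth of a
query in the model is therefore a lookup (`universalModel_holds_iff`), and together with soundness
this is universality.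

Termination: the rules for R_□ and R_◇ produce new names, and through a_{◇C} and x_{□C} also new
concepts, with no evident end. Soundness is applied to three artificial valuations that make all
positive terms of the ABox true. In two of them the values are sets of words over {◇, □}. A stated
`y R_◇ a_C` puts the words of ◇C below the value of y, and the words starting with ◇ in the value of
a generated feature all come from the ABox (`GenFeat.mem_wordSet`); dually for □. So each generated
concept is an occurring concept prefixed by a word of the ABox (`GenCon.exists_prefixed`). In the
third valuation generated names have integer values between -K and K. On object names ◇ and ◆ raise
the value by at least one, ◆ is applied only to negative values, and ◇ yields positive ones. Hence
object names have the shape ◇^j ◆^i c with i + j ≤ 2K (`GenObj.exists_iterate`), and dually for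
features. Thus only polynomially many assertions of polynomial size can ever occur, and each rule
application adds a new one.

The implementation enumerates all rule instances at each iteration (`mem_rulesT_iff`). One iteration
costs a polynomial in the size of the tableau (`iterT_spec`), and the number of iterations is
bounded by the number of possible assertions (`exists_loop`). -/

namespace LEALC

/-! ## Algebraic valuations and soundness of the expansion rules -/

/-- A lattice with a pair of adjoint operations for each modality, and an assignment of the
individual names and the atomic concepts to its elements. -/
structure Valuation (OBJ FEAT AT : Type u) (L : Type*) [Lattice L] where
  box : L → L
  dia : L → L
  bbox : L → L
  bdia : L → L
  gc_box : GaloisConnection bdia box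
  gc_dia : GaloisConnection dia bbox
  obj : OBJ → L
  feat : FEAT → L
  atom : AT → L

namespace Valuation

variable {OBJ FEAT AT : Type u} {L : Type*} [Lattice L] (V : Valuation OBJ FEAT AT L)

def con : Con AT → L
  | .atom D => V.atom D
  | .and C D => con C ⊓ con D
  | .or C D => con C ⊔ con D
  | .dia C => V.dia (con C)
  | .box C => V.box (con C)

/-- Since a_C and x_C both denote the value of C, the identifications ◇a_C = a_{◇C} and □x_C =
x_{□C} are respected by definition. -/
def objName : ObjName OBJ AT → L
  | .ind a => V.obj a
  | .cls C => V.con C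
  | .dia b => V.dia (objName b)
  | .bdia b => V.bdia (objName b)

def featName : FeatName FEAT AT → L
  | .ind x => V.feat x
  | .cls C => V.con C
  | .box y => V.box (featName y)
  | .bbox y => V.bbox (featName y)

/-- Objects and features are both interpreted by lattice elements, and incidence is the order. -/
def SatTerm : Term (ObjName OBJ AT) (FeatName FEAT AT) AT → Prop
  | .inc a x => V.objName a ≤ V.featName x
  | .boxR a x => V.objName a ≤ V.box (V.featName x)
  | .diaR x a => V.dia (V.objName a) ≤ V.featName x
  | .objMem a C => V.objName a ≤ V.con C
  | .featMem x C => V.con C ≤ V.featName x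

theorem objName_mkDia (b : ObjName OBJ AT) : V.objName b.mkDia = V.dia (V.objName b) := by
  cases b <;> rfl

theorem featName_mkBox (y : FeatName FEAT AT) : V.featName y.mkBox = V.box (V.featName y) := by
  cases y <;> rfl

/-- Positive conclusions rest on positive premises only, so a valuation need not falsify the negated
terms; the valuations used for termination depend on this. The modal rules are monotonicity and the
two adjunctions, the creation rule is reflexivity, and the rules reading membership off x_C or a_C
hold by definition. -/
theorem satTerm_of_rule {B l : Tableau OBJ FEAT AT} (h : Rule B l)
    (hB : ∀ t, .pos t ∈ B → V.SatTerm t) : ∀ t, .pos t ∈ l → V.SatTerm t := by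
  have hb := V.gc_box
  have hd := V.gc_dia
  cases h with
  | create h =>
    intro t ht
    simp only [List.mem_cons, Assertion.pos.injEq, List.not_mem_nil, or_false] at ht
    rcases ht with rfl | rfl <;> exact le_rfl
  | basic h1 h2 =>
    intro t ht
    simp only [List.mem_cons, Assertion.pos.injEq, List.not_mem_nil, or_false] at ht
    subst ht
    exact le_trans (hB _ h1) (hB _ h2)
  | and h =>
    intro t ht
    simp only [List.mem_cons, Assertion.pos.injEq, List.not_mem_nil, or_false] at ht
    have := hB _ h
    rcases ht with rfl | rfl
    · exact le_trans this inf_le_left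
    · exact le_trans this inf_le_right
  | or h =>
    intro t ht
    simp only [List.mem_cons, Assertion.pos.injEq, List.not_mem_nil, or_false] at ht
    have := hB _ h
    rcases ht with rfl | rfl
    · exact le_trans le_sup_left this
    · exact le_trans le_sup_right this
  | box h1 h2 =>
    intro t ht
    simp only [List.mem_cons, Assertion.pos.injEq, List.not_mem_nil, or_false] at ht
    subst ht
    exact le_trans (hB _ h1) (hb.monotone_u (hB _ h2))
  | dia h1 h2 =>
    intro t ht
    simp only [List.mem_cons, Assertion.pos.injEq, List.not_mem_nil, or_false] at ht
    subst ht
    exact le_trans (hd.monotone_l (hB _ h2)) (hB _ h1)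
  | boxName h =>
    intro t ht
    simp only [List.mem_cons, Assertion.pos.injEq, List.not_mem_nil, or_false] at ht
    subst ht
    have := hB _ h
    simpa only [SatTerm, featName_mkBox] using this
  | bboxName h =>
    intro t ht
    simp only [List.mem_cons, Assertion.pos.injEq, List.not_mem_nil, or_false] at ht
    subst ht
    exact (hd _ _).2 (hB _ h)
  | diaName h =>
    intro t ht
    simp only [List.mem_cons, Assertion.pos.injEq, List.not_mem_nil, or_false] at ht
    subst ht
    have := hB _ h
    simpa only [SatTerm, objName_mkDia] using this
  | bdiaName h =>
    intro t ht
    simp only [List.mem_cons, Assertion.pos.injEq, List.not_mem_nil, or_false] at ht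
    subst ht
    exact (hb _ _).1 (hB _ h)
  | andInv h1 h2 _ =>
    intro t ht
    simp only [List.mem_cons, Assertion.pos.injEq, List.not_mem_nil, or_false] at ht
    subst ht
    exact le_inf (hB _ h1) (hB _ h2)
  | orInv h1 h2 _ =>
    intro t ht
    simp only [List.mem_cons, Assertion.pos.injEq, List.not_mem_nil, or_false] at ht
    subst ht
    exact sup_le (hB _ h1) (hB _ h2)
  | adjBox h =>
    intro t ht
    simp only [List.mem_cons, Assertion.pos.injEq, List.not_mem_nil, or_false] at ht
    have := hB _ h
    rcases ht with rfl | rfl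
    · exact (hb _ _).2 this
    · simpa only [SatTerm, featName_mkBox] using this
  | adjDia h =>
    intro t ht
    simp only [List.mem_cons, Assertion.pos.injEq, List.not_mem_nil, or_false] at ht
    have := hB _ h
    rcases ht with rfl | rfl
    · simpa only [SatTerm, objName_mkDia] using this
    · exact (hd _ _).1 this
  | negObj h => simp
  | negFeat h => simp
  | appFeat h =>
    intro t ht
    simp only [List.mem_cons, Assertion.pos.injEq, List.not_mem_nil, or_false] at ht
    subst ht
    have := hB _ h
    exact this
  | appObj h =>
    intro t ht
    simp only [List.mem_cons, Assertion.pos.injEq, List.not_mem_nil, or_false] at ht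
    subst ht
    have := hB _ h
    exact this

/-- Only the two rules for negated membership have negative conclusions, and there premise and
conclusion denote the same inequality. -/
theorem not_satTerm_of_rule {B l : Tableau OBJ FEAT AT} (h : Rule B l)
    (hB : ∀ t, .neg t ∈ B → ¬ V.SatTerm t) : ∀ t, .neg t ∈ l → ¬ V.SatTerm t := by
  cases h with
  | negObj h =>
    intro t ht
    simp only [List.mem_cons, Assertion.neg.injEq, List.not_mem_nil, or_false] at ht
    subst ht
    have := hB _ h
    exact this
  | negFeat h =>
    intro t ht
    simp only [List.mem_cons, Assertion.neg.injEq, List.not_mem_nil, or_false] at ht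
    subst ht
    have := hB _ h
    exact this
  | _ => simp

theorem satTerm_of_run [DecidableEq OBJ] [DecidableEq FEAT] [DecidableEq AT]
    {A : ABox OBJ FEAT AT} {n : ℕ} {B : Tableau OBJ FEAT AT} (h : Run A n B)
    (hA : ∀ t, .pos t ∈ A → V.SatTerm (t.map .ind .ind)) :
    ∀ t, .pos t ∈ B → V.SatTerm t := by
  induction h with
  | start =>
    intro t ht
    obtain ⟨s, hs, hst⟩ := List.mem_map.1 ht
    cases s with
    | pos s =>
      simp only [Assertion.embed, Assertion.map, Assertion.pos.injEq] at hst
      exact hst ▸ hA s hs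
    | neg s => simp [Assertion.embed, Assertion.map] at hst
  | step _ _ hr _ ih =>
    intro t ht
    rcases List.mem_union_iff.1 ht with ht | ht
    · exact V.satTerm_of_rule hr ih t ht
    · exact ih t ht

theorem not_satTerm_of_run [DecidableEq OBJ] [DecidableEq FEAT] [DecidableEq AT]
    {A : ABox OBJ FEAT AT} {n : ℕ} {B : Tableau OBJ FEAT AT} (h : Run A n B)
    (hA : ∀ t, .neg t ∈ A → ¬ V.SatTerm (t.map .ind .ind)) :
    ∀ t, .neg t ∈ B → ¬ V.SatTerm t := by
  induction h with
  | start =>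
    intro t ht
    obtain ⟨s, hs, hst⟩ := List.mem_map.1 ht
    cases s with
    | neg s =>
      simp only [Assertion.embed, Assertion.map, Assertion.neg.injEq] at hst
      exact hst ▸ hA s hs
    | pos s => simp [Assertion.embed, Assertion.map] at hst
  | step _ _ hr _ ih =>
    intro t ht
    rcases List.mem_union_iff.1 ht with ht | ht
    · exact V.not_satTerm_of_rule hr ih t ht
    · exact ih t ht

end Valuation

/-! ### The concept lattice of an interpretation as a valuation -/

namespace Interpretation

variable {OBJ FEAT AT : Type u} (M : Interpretation OBJ FEAT AT)

/-- Here and in `isExtent_bbox` enter the two compatibility conditions that the interpretation of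
concepts does not need; they supply the adjoints ◆ and ■. -/
theorem isIntent_bdia (S : Set M.Obj) : Order.IsIntent M.I (upperPolar M.RBox S) := by
  have h : upperPolar M.RBox S = ⋂ (a) (_ : a ∈ S), upperPolar M.RBox {a} := by
    ext x
    simp [mem_upperPolar_iff]
  rw [h]
  exact Order.IsIntent.iInter₂ _ fun a _ => M.rBox_int a

theorem isExtent_bbox (Y : Set M.Feat) : Order.IsExtent M.I (upperPolar M.RDia Y) := by
  have h : upperPolar M.RDia Y = ⋂ (x) (_ : x ∈ Y), upperPolar M.RDia {x} := by
    ext a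
    simp [mem_upperPolar_iff]
  rw [h]
  exact Order.IsExtent.iInter₂ _ fun x _ => M.rDia_ext x

/-- The valuation of the names and concepts in the concept lattice of an interpretation. -/
def valuation : Valuation OBJ FEAT AT (Concept M.Obj M.Feat M.I) where
  box := M.boxOp
  dia := M.diaOp
  bdia c := Concept.ofIsIntent M.I (upperPolar M.RBox c.extent) (M.isIntent_bdia _)
  bbox c := Concept.ofIsExtent M.I (upperPolar M.RDia c.intent) (M.isExtent_bbox _)
  gc_box c d := by
    rw [← Concept.intent_subset_intent_iff, ← Concept.extent_subset_extent_iff]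
    exact subset_upperPolar_iff_subset_lowerPolar
  gc_dia c d := by
    rw [← Concept.intent_subset_intent_iff, ← Concept.extent_subset_extent_iff]
    exact subset_upperPolar_iff_subset_lowerPolar.symm
  obj a := Concept.ofObject M.I (M.obj a)
  feat x := Concept.ofAttribute M.I (M.feat x)
  atom := M.atom

theorem valuation_con (C : Con AT) : M.valuation.con C = M.con C := by
  induction C with
  | atom D => rfl
  | and C D hC hD => simp [Valuation.con, con, hC, hD]
  | or C D hC hD => simp [Valuation.con, con, hC, hD]
  | dia C hC => simp only [Valuation.con, con, hC]; rfl
  | box C hC => simp only [Valuation.con, con, hC]; rfl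

/-- The left side involves the closure of {x}. The adjunction turns it into an inequality between
the concept with intent R_□⁽¹⁾[a], which exists by compatibility, and the concept generated by x,
and that inequality tests x alone. -/
theorem ofObject_le_boxOp_iff (a : M.Obj) (x : M.Feat) :
    Concept.ofObject M.I a ≤ M.boxOp (Concept.ofAttribute M.I x) ↔ M.RBox a x := by
  have h1 : Concept.ofObject M.I a ≤ M.boxOp (Concept.ofAttribute M.I x) ↔
      Concept.ofIsIntent M.I _ (M.rBox_int a) ≤ Concept.ofAttribute M.I x := by
    rw [Concept.ofObjects_le_iff, ← Concept.intent_subset_intent_iff]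
    exact subset_upperPolar_iff_subset_lowerPolar.symm
  rw [h1, Concept.le_ofAttributes_iff]
  simp

theorem diaOp_le_ofAttribute_iff (a : M.Obj) (x : M.Feat) :
    M.diaOp (Concept.ofObject M.I a) ≤ Concept.ofAttribute M.I x ↔ M.RDia x a := by
  have h1 : M.diaOp (Concept.ofObject M.I a) ≤ Concept.ofAttribute M.I x ↔
      Concept.ofObject M.I a ≤ Concept.ofIsExtent M.I _ (M.rDia_ext x) := by
    rw [Concept.le_ofAttributes_iff, ← Concept.extent_subset_extent_iff]
    exact subset_upperPolar_iff_subset_lowerPolar.symm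
  rw [h1, Concept.ofObjects_le_iff]
  simp

theorem valuation_satTerm (t : Term OBJ FEAT AT) :
    M.valuation.SatTerm (t.map .ind .ind) ↔ M.SatTerm t := by
  cases t with
  | inc a x => exact Concept.ofObject_le_ofAttribute_iff
  | boxR a x => exact M.ofObject_le_boxOp_iff _ _
  | diaR x a => exact M.diaOp_le_ofAttribute_iff _ _
  | objMem a C =>
    simp only [Term.map, Valuation.SatTerm, valuation_con, SatTerm]
    exact Concept.ofObjects_le_iff.trans Set.singleton_subset_iff
  | featMem x C =>
    simp only [Term.map, Valuation.SatTerm, valuation_con, SatTerm]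
    exact Concept.le_ofAttributes_iff.trans Set.singleton_subset_iff

/-- Because a_C and x_C denote the concept itself, a query and its lookup term have the same truth
value in every interpretation. A stated lookup term is thus entailed even before saturation. -/
theorem valuation_lookup (q : Query OBJ FEAT AT) :
    M.valuation.SatTerm q.lookup ↔ M.Holds q := by
  cases q with
  | term t =>
    rw [Holds, ← valuation_satTerm]
    cases t <;> exact Iff.rfl
  | sub C D => simp only [Query.lookup, Valuation.SatTerm, Valuation.objName,
      Valuation.featName, valuation_con, Holds]

variable [DecidableEq OBJ] [DecidableEq FEAT] [DecidableEq AT] {M}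
  {A : ABox OBJ FEAT AT} {n : ℕ} {B : Tableau OBJ FEAT AT}

theorem IsModel.satTerm_of_run (hM : M.IsModel A) (h : Run A n B) :
    ∀ t, .pos t ∈ B → M.valuation.SatTerm t :=
  M.valuation.satTerm_of_run h fun t ht => (M.valuation_satTerm t).2 (hM _ ht)

theorem IsModel.not_satTerm_of_run (hM : M.IsModel A) (h : Run A n B) :
    ∀ t, .neg t ∈ B → ¬ M.valuation.SatTerm t :=
  M.valuation.not_satTerm_of_run h fun t ht => (M.valuation_satTerm t).not.2 (hM _ ht)

theorem IsModel.not_hasClash_of_run (hM : M.IsModel A) (h : Run A n B) : ¬ HasClash B := by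
  rintro ⟨t, -, h1, h2⟩
  exact hM.not_satTerm_of_run h t h2 (hM.satTerm_of_run h t h1)

end Interpretation

theorem entails_of_lookup_mem {OBJ FEAT AT : Type u} [DecidableEq OBJ] [DecidableEq FEAT]
    [DecidableEq AT] {A : ABox OBJ FEAT AT} {n : ℕ} {B : Tableau OBJ FEAT AT} (h : Run A n B)
    {q : Query OBJ FEAT AT} (hq : .pos q.lookup ∈ B) : Entails A q :=
  fun M hM => (M.valuation_lookup q).1 (hM.satTerm_of_run h _ hq)

theorem not_consistent_of_hasClash {OBJ FEAT AT : Type u} [DecidableEq OBJ] [DecidableEq FEAT]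
    [DecidableEq AT] {A : ABox OBJ FEAT AT} {n : ℕ} {B : Tableau OBJ FEAT AT} (h : Run A n B)
    (hc : HasClash B) : ¬ Consistent A :=
  fun ⟨_, hM⟩ => hM.not_hasClash_of_run h hc

/-! ## Occurring concepts -/

theorem Con.mem_subs_self {AT : Type u} (C : Con AT) : C ∈ C.subs := by
  cases C <;> simp [Con.subs]

theorem Con.subs_trans {AT : Type u} {C D E : Con AT} (h1 : C ∈ D.subs) (h2 : D ∈ E.subs) :
    C ∈ E.subs := by
  induction E with
  | atom F =>
    simp only [Con.subs, List.mem_singleton] at h2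
    exact h2 ▸ h1
  | and F G hF hG =>
    simp only [Con.subs, List.mem_cons, List.mem_append] at h2 ⊢
    rcases h2 with rfl | h2 | h2
    · simpa only [Con.subs, List.mem_cons, List.mem_append] using h1
    · exact .inr (.inl (hF h2))
    · exact .inr (.inr (hG h2))
  | or F G hF hG =>
    simp only [Con.subs, List.mem_cons, List.mem_append] at h2 ⊢
    rcases h2 with rfl | h2 | h2
    · simpa only [Con.subs, List.mem_cons, List.mem_append] using h1
    · exact .inr (.inl (hF h2))
    · exact .inr (.inr (hG h2))
  | dia F hF =>
    simp only [Con.subs, List.mem_cons] at h2 ⊢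
    rcases h2 with rfl | h2
    · simpa only [Con.subs, List.mem_cons] using h1
    · exact .inr (hF h2)
  | box F hF =>
    simp only [Con.subs, List.mem_cons] at h2 ⊢
    rcases h2 with rfl | h2
    · simpa only [Con.subs, List.mem_cons] using h1
    · exact .inr (hF h2)

section Occurrence

variable {O X AT : Type u} {B : List (Assertion O X AT)} {C D : Con AT}

theorem mem_consIn_iff :
    C ∈ consIn B ↔ ∃ s ∈ B, ∃ D, s.term.con? = some D ∧ C ∈ D.subs := by
  simp [consIn, List.mem_flatMap, Option.mem_toList]

theorem mem_consIn_of_mem_subs (h1 : C ∈ D.subs) (h2 : D ∈ consIn B) : C ∈ consIn B := by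
  obtain ⟨s, hs, E, hE, hD⟩ := mem_consIn_iff.1 h2
  exact mem_consIn_iff.2 ⟨s, hs, E, hE, Con.subs_trans h1 hD⟩

theorem mem_consIn_of_con? {s : Assertion O X AT} (hs : s ∈ B) (h : s.term.con? = some C) :
    C ∈ consIn B :=
  mem_consIn_iff.2 ⟨s, hs, C, h, C.mem_subs_self⟩

theorem consIn_mono {B' : List (Assertion O X AT)} (h : B ⊆ B') (hC : C ∈ consIn B) :
    C ∈ consIn B' := by
  obtain ⟨s, hs, E, hE, hD⟩ := mem_consIn_iff.1 hC
  exact mem_consIn_iff.2 ⟨s, h hs, E, hE, hD⟩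

end Occurrence

/-! ### Names and concepts of the initial tableau -/

section Embed

variable {OBJ FEAT AT : Type u} {A : ABox OBJ FEAT AT}

theorem Assertion.term_embed (s : Assertion OBJ FEAT AT) :
    s.embed.term = s.term.map .ind .ind := by
  cases s <;> rfl

theorem Term.con?_map {O X O' X' : Type u} (f : O → O') (g : X → X') (t : Term O X AT) :
    (t.map f g).con? = t.con? := by
  cases t <;> rfl

theorem consIn_map_embed : consIn (A.map Assertion.embed) = consIn A := by
  simp [consIn, List.flatMap_map, Assertion.term_embed, Term.con?_map]

theorem mem_objsIn_map_embed {b : ObjName OBJ AT} :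
    b ∈ objsIn (A.map Assertion.embed) ↔ ∃ a ∈ objsIn A, b = .ind a := by
  simp only [objsIn, List.mem_flatMap, List.mem_map]
  constructor
  · rintro ⟨_, ⟨s, hs, rfl⟩, hb⟩
    rw [Assertion.term_embed] at hb
    refine match h : s.term, hb with
      | .inc a x, hb => ⟨a, ⟨s, hs, by simp [h, Term.objs]⟩,
          by simpa [Term.map, Term.objs] using hb⟩
      | .boxR a x, hb => ⟨a, ⟨s, hs, by simp [h, Term.objs]⟩,
          by simpa [Term.map, Term.objs] using hb⟩
      | .diaR x a, hb => ⟨a, ⟨s, hs, by simp [h, Term.objs]⟩,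
          by simpa [Term.map, Term.objs] using hb⟩
      | .objMem a C, hb => ⟨a, ⟨s, hs, by simp [h, Term.objs]⟩,
          by simpa [Term.map, Term.objs] using hb⟩
      | .featMem x C, hb => by simp [Term.map, Term.objs] at hb
  · rintro ⟨a, ⟨s, hs, ha⟩, rfl⟩
    refine ⟨_, ⟨s, hs, rfl⟩, ?_⟩
    rw [Assertion.term_embed]
    cases h : s.term <;> simp_all [Term.map, Term.objs]

theorem mem_featsIn_map_embed {y : FeatName FEAT AT} :
    y ∈ featsIn (A.map Assertion.embed) ↔ ∃ x ∈ featsIn A, y = .ind x := by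
  simp only [featsIn, List.mem_flatMap, List.mem_map]
  constructor
  · rintro ⟨_, ⟨s, hs, rfl⟩, hb⟩
    rw [Assertion.term_embed] at hb
    refine match h : s.term, hb with
      | .inc a x, hb => ⟨x, ⟨s, hs, by simp [h, Term.feats]⟩,
          by simpa [Term.map, Term.feats] using hb⟩
      | .boxR a x, hb => ⟨x, ⟨s, hs, by simp [h, Term.feats]⟩,
          by simpa [Term.map, Term.feats] using hb⟩
      | .diaR x a, hb => ⟨x, ⟨s, hs, by simp [h, Term.feats]⟩,
          by simpa [Term.map, Term.feats] using hb⟩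
      | .featMem x C, hb => ⟨x, ⟨s, hs, by simp [h, Term.feats]⟩,
          by simpa [Term.map, Term.feats] using hb⟩
      | .objMem x C, hb => by simp [Term.map, Term.feats] at hb
  · rintro ⟨a, ⟨s, hs, ha⟩, rfl⟩
    refine ⟨_, ⟨s, hs, rfl⟩, ?_⟩
    rw [Assertion.term_embed]
    cases h : s.term <;> simp_all [Term.map, Term.feats]

theorem objsIn_mono {O X AT : Type u} {B B' : List (Assertion O X AT)} (h : B ⊆ B') :
    objsIn B ⊆ objsIn B' := by
  intro b hb
  obtain ⟨s, hs, hb⟩ := List.mem_flatMap.1 hb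
  exact List.mem_flatMap.2 ⟨s, h hs, hb⟩

theorem featsIn_mono {O X AT : Type u} {B B' : List (Assertion O X AT)} (h : B ⊆ B') :
    featsIn B ⊆ featsIn B' := by
  intro b hb
  obtain ⟨s, hs, hb⟩ := List.mem_flatMap.1 hb
  exact List.mem_flatMap.2 ⟨s, h hs, hb⟩

theorem Run.subset [DecidableEq OBJ] [DecidableEq FEAT] [DecidableEq AT] {n : ℕ}
    {B : Tableau OBJ FEAT AT} (h : Run A n B) : A.map Assertion.embed ⊆ B := by
  induction h with
  | start => exact List.Subset.refl _
  | step _ _ _ _ ih => exact fun s hs => List.mem_union_iff.2 (.inr (ih hs))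

end Embed

/-! ## Truth in the model read off a saturated tableau -/

namespace Saturated

variable {OBJ FEAT AT : Type u} {B : Tableau OBJ FEAT AT}
  {b : ObjName OBJ AT} {y : FeatName FEAT AT} {C D : Con AT}

theorem objMem_cls (h : Saturated B) (hC : C ∈ consIn B) : .pos (.objMem (.cls C) C) ∈ B :=
  h _ (.create hC) _ (by simp)

theorem featMem_cls (h : Saturated B) (hC : C ∈ consIn B) : .pos (.featMem (.cls C) C) ∈ B :=
  h _ (.create hC) _ (by simp)

theorem inc_cls_iff (h : Saturated B) (hC : C ∈ consIn B) :
    .pos (.inc b (.cls C)) ∈ B ↔ .pos (.objMem b C) ∈ B :=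
  ⟨fun hb => h _ (.appFeat hb) _ (by simp),
    fun hb => h _ (.basic hb (h.featMem_cls hC)) _ (by simp)⟩

theorem cls_inc_iff (h : Saturated B) (hC : C ∈ consIn B) :
    .pos (.inc (.cls C) y) ∈ B ↔ .pos (.featMem y C) ∈ B :=
  ⟨fun hb => h _ (.appObj hb) _ (by simp),
    fun hb => h _ (.basic (h.objMem_cls hC) hb) _ (by simp)⟩

theorem objMem_and_iff (h : Saturated B) (hC : .and C D ∈ consIn B) :
    .pos (.objMem b (.and C D)) ∈ B ↔ .pos (.objMem b C) ∈ B ∧ .pos (.objMem b D) ∈ B :=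
  ⟨fun hb => ⟨h _ (.and hb) _ (by simp), h _ (.and hb) _ (by simp)⟩,
    fun hb => h _ (.andInv hb.1 hb.2 hC) _ (by simp)⟩

theorem featMem_or_iff (h : Saturated B) (hC : .or C D ∈ consIn B) :
    .pos (.featMem y (.or C D)) ∈ B ↔ .pos (.featMem y C) ∈ B ∧ .pos (.featMem y D) ∈ B :=
  ⟨fun hb => ⟨h _ (.or hb) _ (by simp), h _ (.or hb) _ (by simp)⟩,
    fun hb => h _ (.orInv hb.1 hb.2 hC) _ (by simp)⟩

/-- It suffices to test the universal condition on x_C: it gives b R_□ x_C, hence b I □x_C, and □x_C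
is the name x_{□C}. The statement for ◇ is dual, tested on a_C. -/
theorem objMem_box_iff (h : Saturated B) (hC : C ∈ consIn B) (hbox : .box C ∈ consIn B) :
    .pos (.objMem b (.box C)) ∈ B ↔ ∀ y, .pos (.featMem y C) ∈ B → .pos (.boxR b y) ∈ B := by
  refine ⟨fun hb y hy => h _ (.box hb hy) _ (by simp), fun hb => ?_⟩
  exact (h.inc_cls_iff hbox).1
    (h _ (.adjBox (hb _ (h.featMem_cls hC))) (.pos (.inc b (.mkBox (.cls C)))) (by simp))

theorem featMem_dia_iff (h : Saturated B) (hC : C ∈ consIn B) (hdia : .dia C ∈ consIn B) :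
    .pos (.featMem y (.dia C)) ∈ B ↔ ∀ b, .pos (.objMem b C) ∈ B → .pos (.diaR y b) ∈ B := by
  refine ⟨fun hy b hb => h _ (.dia hy hb) _ (by simp), fun hy => ?_⟩
  exact (h.cls_inc_iff hdia).1
    (h _ (.adjDia (hy _ (h.objMem_cls hC))) (.pos (.inc (.mkDia (.cls C)) y)) (by simp))

end Saturated

/-! ### Extents and intents in the model, and its universality -/

section UniversalModel

variable {OBJ FEAT AT : Type u}

/-- The objects of the model that the tableau states to be in a concept. -/
def statedExtent (B : Tableau OBJ FEAT AT) (C : Con AT) : Set (ModelObj B) :=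
  {a | ∃ b, a = some b ∧ .pos (.objMem b.1 C) ∈ B}

/-- The features of the model that the tableau states to be in a concept. -/
def statedIntent (B : Tableau OBJ FEAT AT) (C : Con AT) : Set (ModelFeat B) :=
  {x | ∃ y, x = some y ∧ .pos (.featMem y.1 C) ∈ B}

variable {B : Tableau OBJ FEAT AT} {C : Con AT}

theorem some_mem_statedExtent {b} : some b ∈ statedExtent B C ↔ .pos (.objMem b.1 C) ∈ B :=
  ⟨by rintro ⟨_, ⟨⟩, h⟩; exact h, fun h => ⟨b, rfl, h⟩⟩

theorem some_mem_statedIntent {y} : some y ∈ statedIntent B C ↔ .pos (.featMem y.1 C) ∈ B :=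
  ⟨by rintro ⟨_, ⟨⟩, h⟩; exact h, fun h => ⟨y, rfl, h⟩⟩

theorem none_notMem_statedExtent : none ∉ statedExtent B C := by
  rintro ⟨_, ⟨⟩, _⟩

theorem none_notMem_statedIntent : none ∉ statedIntent B C := by
  rintro ⟨_, ⟨⟩, _⟩

/-- The classifying object a_C lies in the stated extent, so a feature in the polar is incident with
a_C, and saturation then states its membership. The same object excludes x_⊥, whatever names of the
ABox belong to C. -/
theorem upperPolar_statedExtent (h : Saturated B) (hC : C ∈ consIn B) :
    upperPolar (modelI B) (statedExtent B C) = statedIntent B C := by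
  have hc := h.objMem_cls hC
  have hc' : some ⟨.cls C, mem_objsIn hc (by simp [Term.objs])⟩ ∈ statedExtent B C :=
    some_mem_statedExtent.2 hc
  ext x
  constructor
  · intro hx
    have := hx hc'
    cases x with
    | none => exact this.elim
    | some y => exact some_mem_statedIntent.2 ((h.cls_inc_iff hC).1 this)
  · rintro ⟨y, rfl, hy⟩ _ ⟨b, rfl, hb⟩
    exact h _ (.basic hb hy) _ (by simp)

theorem lowerPolar_statedIntent (h : Saturated B) (hC : C ∈ consIn B) :
    lowerPolar (modelI B) (statedIntent B C) = statedExtent B C := by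
  have hc := h.featMem_cls hC
  have hc' : some ⟨.cls C, mem_featsIn hc (by simp [Term.feats])⟩ ∈ statedIntent B C :=
    some_mem_statedIntent.2 hc
  ext a
  constructor
  · intro ha
    have := ha hc'
    cases a with
    | none => exact this.elim
    | some b => exact some_mem_statedExtent.2 ((h.inc_cls_iff hC).1 this)
  · rintro ⟨b, rfl, hb⟩ _ ⟨y, rfl, hy⟩
    exact h _ (.basic hb hy) _ (by simp)

variable [DecidableEq OBJ] [DecidableEq FEAT] [DecidableEq AT]

/-- Induction on C, working on the side where the connective is computed directly: extents for
atoms, meets and boxes, intents for joins and diamonds. The polars of the stated sets supply the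
other side, and closure of the occurring concepts under subformulas makes the induction hypotheses
available. -/
theorem universalModel_con (h : Saturated B) (hC : C ∈ consIn B) :
    ((universalModel B h).con C).extent = statedExtent B C ∧
      ((universalModel B h).con C).intent = statedIntent B C := by
  have of_ext {C : Con AT} (hC : C ∈ consIn B)
      (he : ((universalModel B h).con C).extent = statedExtent B C) :
      ((universalModel B h).con C).extent = statedExtent B C ∧
        ((universalModel B h).con C).intent = statedIntent B C :=
    ⟨he, by rw [← Concept.upperPolar_extent, he]; exact upperPolar_statedExtent h hC⟩
  have of_int {C : Con AT} (hC : C ∈ consIn B)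
      (he : ((universalModel B h).con C).intent = statedIntent B C) :
      ((universalModel B h).con C).extent = statedExtent B C ∧
        ((universalModel B h).con C).intent = statedIntent B C :=
    ⟨by rw [← Concept.lowerPolar_intent, he]; exact lowerPolar_statedIntent h hC, he⟩
  induction C with
  | atom D =>
    refine of_ext hC ?_
    ext a
    exact exists_congr fun b => and_congr_right fun _ => h.inc_cls_iff hC
  | and C D ihC ihD =>
    refine of_ext hC ?_
    have hC' := mem_consIn_of_mem_subs
      (show C ∈ (Con.and C D).subs by simp [Con.subs, Con.mem_subs_self]) hC
    have hD' := mem_consIn_of_mem_subs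
      (show D ∈ (Con.and C D).subs by simp [Con.subs, Con.mem_subs_self]) hC
    have : ((universalModel B h).con (.and C D)).extent =
      statedExtent B C ∩ statedExtent B D := by
      rw [← (ihC hC').1, ← (ihD hD').1]; rfl
    rw [this]
    ext (_ | b)
    · simp [none_notMem_statedExtent]
    · rw [Set.mem_inter_iff, some_mem_statedExtent, some_mem_statedExtent, some_mem_statedExtent,
        h.objMem_and_iff hC]
  | or C D ihC ihD =>
    refine of_int hC ?_
    have hC' := mem_consIn_of_mem_subs
      (show C ∈ (Con.or C D).subs by simp [Con.subs, Con.mem_subs_self]) hC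
    have hD' := mem_consIn_of_mem_subs
      (show D ∈ (Con.or C D).subs by simp [Con.subs, Con.mem_subs_self]) hC
    have : ((universalModel B h).con (.or C D)).intent =
      statedIntent B C ∩ statedIntent B D := by
      rw [← (ihC hC').2, ← (ihD hD').2]; rfl
    rw [this]
    ext (_ | b)
    · simp [none_notMem_statedIntent]
    · rw [Set.mem_inter_iff, some_mem_statedIntent, some_mem_statedIntent, some_mem_statedIntent,
        h.featMem_or_iff hC]
  | dia C ihC =>
    refine of_int hC ?_
    have hC' := mem_consIn_of_mem_subs
      (show C ∈ (Con.dia C).subs by simp [Con.subs, Con.mem_subs_self]) hC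
    have : ((universalModel B h).con (.dia C)).intent =
      lowerPolar (modelDia B) (statedExtent B C) := by
      rw [← (ihC hC').1]; rfl
    rw [this]
    have hc := h.objMem_cls hC'
    ext (_ | y)
    -- x_⊥ is R_◇-related to nothing, while the stated extent contains a_C, so x_⊥ fails the
    -- condition defining the intent.
    · simp only [none_notMem_statedIntent, iff_false]
      exact fun hn => hn
        (some_mem_statedExtent (b := ⟨_, mem_objsIn hc (by simp [Term.objs])⟩).2 hc)
    · rw [some_mem_statedIntent, h.featMem_dia_iff hC' hC]
      constructor
      · exact fun hy b hb =>
          hy (some_mem_statedExtent (b := ⟨_, mem_objsIn hb (by simp [Term.objs])⟩).2 hb)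
      · rintro hy _ ⟨b, rfl, hb⟩
        exact hy _ hb
  | box C ihC =>
    refine of_ext hC ?_
    have hC' := mem_consIn_of_mem_subs
      (show C ∈ (Con.box C).subs by simp [Con.subs, Con.mem_subs_self]) hC
    have : ((universalModel B h).con (.box C)).extent =
      lowerPolar (modelBox B) (statedIntent B C) := by
      rw [← (ihC hC').2]; rfl
    rw [this]
    have hc := h.featMem_cls hC'
    ext (_ | y)
    · simp only [none_notMem_statedExtent, iff_false]
      exact fun hn => hn
        (some_mem_statedIntent (y := ⟨_, mem_featsIn hc (by simp [Term.feats])⟩).2 hc)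
    · rw [some_mem_statedExtent, h.objMem_box_iff hC' hC]
      constructor
      · exact fun hy b hb =>
          hy (some_mem_statedIntent (y := ⟨_, mem_featsIn hb (by simp [Term.feats])⟩).2 hb)
      · rintro hy _ ⟨b, rfl, hb⟩
        exact hy _ hb

theorem universalModel_obj (h : Saturated B) {a : OBJ} (ha : .ind a ∈ objsIn B) :
    (universalModel B h).obj a = some ⟨.ind a, ha⟩ := dif_pos ha

theorem universalModel_feat (h : Saturated B) {x : FEAT} (hx : .ind x ∈ featsIn B) :
    (universalModel B h).feat x = some ⟨.ind x, hx⟩ := dif_pos hx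

/-- Queries over a saturated tableau hold in the model iff their lookup term is stated. -/
theorem universalModel_holds_iff {A : ABox OBJ FEAT AT} (h : Saturated B)
    (hAB : A.map Assertion.embed ⊆ B) {q : Query OBJ FEAT AT} (hq : q.Over A) :
    (universalModel B h).Holds q ↔ .pos q.lookup ∈ B := by
  have hobj {a : OBJ} (ha : a ∈ objsIn A) : (.ind a : ObjName OBJ AT) ∈ objsIn B :=
    objsIn_mono hAB (mem_objsIn_map_embed.2 ⟨a, ha, rfl⟩)
  have hfeat {a : FEAT} (ha : a ∈ featsIn A) : (.ind a : FeatName FEAT AT) ∈ featsIn B :=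
    featsIn_mono hAB (mem_featsIn_map_embed.2 ⟨a, ha, rfl⟩)
  have hcon {C : Con AT} (hC : C ∈ consIn A) : C ∈ consIn B :=
    consIn_mono hAB (consIn_map_embed.symm ▸ hC)
  cases q with
  | term t =>
    obtain ⟨h1, h2, h3⟩ := hq
    cases t with
    | inc a x =>
      have ha := hobj (h1 a (by simp [Term.objs]))
      have hx := hfeat (h2 x (by simp [Term.feats]))
      simp only [Interpretation.Holds, Interpretation.SatTerm, universalModel_obj h ha,
        universalModel_feat h hx]
      exact Iff.rfl
    | boxR a x =>
      have ha := hobj (h1 a (by simp [Term.objs]))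
      have hx := hfeat (h2 x (by simp [Term.feats]))
      simp only [Interpretation.Holds, Interpretation.SatTerm, universalModel_obj h ha,
        universalModel_feat h hx]
      exact Iff.rfl
    | diaR x a =>
      have ha := hobj (h1 a (by simp [Term.objs]))
      have hx := hfeat (h2 x (by simp [Term.feats]))
      simp only [Interpretation.Holds, Interpretation.SatTerm, universalModel_obj h ha,
        universalModel_feat h hx]
      exact Iff.rfl
    | objMem a C =>
      have ha := hobj (h1 a (by simp [Term.objs]))
      have hC := hcon (h3 C rfl)
      simp only [Interpretation.Holds, Interpretation.SatTerm, universalModel_obj h ha,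
        (universalModel_con h hC).1, Query.lookup]
      exact some_mem_statedExtent.trans (h.inc_cls_iff hC).symm
    | featMem x C =>
      have hx := hfeat (h2 x (by simp [Term.feats]))
      have hC := hcon (h3 C rfl)
      simp only [Interpretation.Holds, Interpretation.SatTerm, universalModel_feat h hx,
        (universalModel_con h hC).2, Query.lookup]
      exact some_mem_statedIntent.trans (h.cls_inc_iff hC).symm
  | sub C D =>
    have hC := hcon hq.1
    have hD := hcon hq.2
    simp only [Interpretation.Holds, Query.lookup]
    rw [← Concept.extent_subset_extent_iff, (universalModel_con h hC).1,
      (universalModel_con h hD).1, h.inc_cls_iff hD]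
    have hc := h.objMem_cls hC
    constructor
    · exact fun hs => some_mem_statedExtent.1
        (hs (some_mem_statedExtent (b := ⟨_, mem_objsIn hc (by simp [Term.objs])⟩).2 hc))
    -- From a_C I x_D follows x_D :: C; with b : C this gives b I x_D, that is, b : D.
    · rintro hs _ ⟨b, rfl, hb⟩
      exact some_mem_statedExtent.2 ((h.inc_cls_iff hD).1
        (h _ (.basic hb ((h.cls_inc_iff hC).1 ((h.inc_cls_iff hD).2 hs))) _ (by simp)))

/-- The term of each assertion is itself a query over the ABox, so its truth is a lookup. For a
negated membership, saturation states the negation of the looked-up incidence, and the absence of a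
clash excludes the incidence itself. -/
theorem universalModel_isModel {A : ABox OBJ FEAT AT} (h : Saturated B)
    (hAB : A.map Assertion.embed ⊆ B) (hc : ¬ HasClash B) : (universalModel B h).IsModel A := by
  have hover {s : Assertion OBJ FEAT AT} (hs : s ∈ A) : (Query.term s.term).Over A :=
    ⟨fun b hb => List.mem_flatMap.2 ⟨s, hs, hb⟩, fun y hy => List.mem_flatMap.2 ⟨s, hs, hy⟩,
      fun C hC => mem_consIn_of_con? hs hC⟩
  have hrel (t : Term (ObjName OBJ AT) (FeatName FEAT AT) AT) (ht : t.isRel = true)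
      (hneg : .neg t ∈ B) : .pos t ∉ B := fun hpos => hc ⟨t, ht, hpos, hneg⟩
  intro s hs
  have hB : s.embed ∈ B := hAB (List.mem_map_of_mem hs)
  cases s with
  | pos t =>
    refine (universalModel_holds_iff h hAB (hover hs)).2 ?_
    cases t with
    | objMem a C =>
      exact (h.inc_cls_iff (mem_consIn_of_con? hB rfl)).2 hB
    | featMem x C =>
      exact (h.cls_inc_iff (mem_consIn_of_con? hB rfl)).2 hB
    | _ => exact hB
  | neg t =>
    refine (universalModel_holds_iff h hAB (hover hs)).not.2 ?_
    cases t with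
    | objMem a C => exact hrel _ rfl (h _ (.negObj hB) _ (List.mem_singleton.2 rfl))
    | featMem x C => exact hrel _ rfl (h _ (.negFeat hB) _ (List.mem_singleton.2 rfl))
    | _ => exact hrel _ rfl hB

theorem entails_iff_lookup_mem {A : ABox OBJ FEAT AT} {n : ℕ} (hr : Run A n B) (h : Saturated B)
    (hc : ¬ HasClash B) {q : Query OBJ FEAT AT} (hq : q.Over A) :
    Entails A q ↔ .pos q.lookup ∈ B :=
  ⟨fun he => (universalModel_holds_iff h hr.subset hq).1
    (he _ (universalModel_isModel h hr.subset hc)), entails_of_lookup_mem hr⟩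

end UniversalModel

/-! ## Modal words

Words over `{◇, □}` are lists of Booleans, `true` standing for `◇`. -/

section Words

variable {AT : Type u}

/-- The modal words met on the paths from the root of a concept to its subformulas. -/
def Con.words : Con AT → List (List Bool)
  | .atom _ => [[]]
  | .and C D => C.words ++ D.words
  | .or C D => C.words ++ D.words
  | .dia C => [] :: C.words.map (true :: ·)
  | .box C => [] :: C.words.map (false :: ·)

/-- A concept prefixed by a modal word. -/
def Con.prefixed (C : Con AT) : List Bool → Con AT
  | [] => C
  | true :: m => .dia (C.prefixed m)
  | false :: m => .box (C.prefixed m)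

theorem Con.nil_mem_words (C : Con AT) : [] ∈ C.words := by
  induction C <;> simp_all [Con.words]

theorem Con.length_words_le (C : Con AT) : C.words.length ≤ C.size := by
  induction C <;> simp_all [Con.words, Con.size] <;> omega

theorem Con.length_lt_size_of_mem_words {C : Con AT} {m : List Bool} (hm : m ∈ C.words) :
    m.length < C.size := by
  induction C generalizing m with
  | atom D => simp_all [Con.words, Con.size]
  | and C D hC hD =>
    simp only [Con.words, List.mem_append, Con.size] at hm ⊢
    rcases hm with hm | hm
    · have := hC hm; omega
    · have := hD hm; omega
  | or C D hC hD =>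
    simp only [Con.words, List.mem_append, Con.size] at hm ⊢
    rcases hm with hm | hm
    · have := hC hm; omega
    · have := hD hm; omega
  | dia C hC =>
    simp only [Con.words, List.mem_cons, List.mem_map, Con.size] at hm ⊢
    rcases hm with rfl | ⟨m, hm, rfl⟩
    · simp
    · have := hC hm
      simp only [List.length_cons]; omega
  | box C hC =>
    simp only [Con.words, List.mem_cons, List.mem_map, Con.size] at hm ⊢
    rcases hm with rfl | ⟨m, hm, rfl⟩
    · simp
    · have := hC hm
      simp only [List.length_cons]; omega

/-- Deleting the first letter amounts to passing below the outermost modality on the path. This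
makes the words of an ABox closed under suffixes. -/
theorem Con.exists_subs_of_cons_mem_words {C : Con AT} {p : Bool} {m : List Bool}
    (hm : p :: m ∈ C.words) : ∃ D ∈ C.subs, m ∈ D.words := by
  induction C with
  | atom D => simp [Con.words] at hm
  | and C D hC hD =>
    rcases List.mem_append.1 hm with hm | hm
    · obtain ⟨E, h1, h2⟩ := hC hm
      exact ⟨E, by simp [Con.subs, h1], h2⟩
    · obtain ⟨E, h1, h2⟩ := hD hm
      exact ⟨E, by simp [Con.subs, h1], h2⟩
  | or C D hC hD =>
    rcases List.mem_append.1 hm with hm | hm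
    · obtain ⟨E, h1, h2⟩ := hC hm
      exact ⟨E, by simp [Con.subs, h1], h2⟩
    · obtain ⟨E, h1, h2⟩ := hD hm
      exact ⟨E, by simp [Con.subs, h1], h2⟩
  | dia C hC =>
    have : m ∈ C.words := by simp_all [Con.words]
    exact ⟨C, by simp [Con.subs, Con.mem_subs_self], this⟩
  | box C hC =>
    have : m ∈ C.words := by simp_all [Con.words]
    exact ⟨C, by simp [Con.subs, Con.mem_subs_self], this⟩

theorem Con.size_prefixed (C : Con AT) (m : List Bool) :
    (C.prefixed m).size = m.length + C.size := by
  induction m with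
  | nil => simp [Con.prefixed]
  | cons p m ih => cases p <;> simp [Con.prefixed, Con.size, ih] <;> omega

end Words

/-! ## Operations on sets of words -/

section WordOperations

variable (p : Bool) (U Z : Set (List Bool))

/-- The join-preserving prefixing of all words by a letter. -/
def strongPre : Set (List Bool) := {s | (s = [] ∧ U.Nonempty) ∨ ∃ t ∈ U, s = p :: t}

/-- The right adjoint of `strongPre`. -/
def strongDel : Set (List Bool) := {t | [] ∈ U ∧ p :: t ∈ U}

/-- The meet-preserving prefixing of all words by a letter. -/
def weakPre : Set (List Bool) := {s | s = [] ∨ (∃ t ∈ U, s = p :: t) ∨ U = Set.univ}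

/-- The left adjoint of `weakPre`. -/
def weakDel : Set (List Bool) := {t | p :: t ∈ U ∨ ∃ s ∈ U, s ≠ [] ∧ ∀ r, s ≠ p :: r}

theorem gc_strongPre : GaloisConnection (strongPre p) (strongDel p) := by
  intro U Z
  constructor
  · exact fun h t ht => ⟨h (.inl ⟨rfl, t, ht⟩), h (.inr ⟨t, ht, rfl⟩)⟩
  · rintro h s (⟨rfl, t, ht⟩ | ⟨t, ht, rfl⟩)
    · exact (h ht).1
    · exact (h ht).2

/-- The exceptional clauses are forced: a right adjoint preserves the full set, and a nonempty word
not starting with p lies in `weakPre p Z` only when Z is full, so a set containing such a word must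
be sent by `weakDel` to the full set. -/
theorem gc_weakPre : GaloisConnection (weakDel p) (weakPre p) := by
  intro U Z
  constructor
  · intro h s hs
    by_cases h1 : s = []
    · exact .inl h1
    by_cases h2 : ∃ r, s = p :: r
    · obtain ⟨r, rfl⟩ := h2
      exact .inr (.inl ⟨r, h (.inl hs), rfl⟩)
    · exact .inr (.inr (Set.eq_univ_of_forall fun t =>
        h (.inr ⟨s, hs, h1, fun r hr => h2 ⟨r, hr⟩⟩)))
  · rintro h t (ht | ⟨s, hs, h1, h2⟩)
    · rcases h ht with h3 | ⟨r, hr, h3⟩ | h3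
      · simp at h3
      · simp only [List.cons.injEq, true_and] at h3
        exact h3 ▸ hr
      · exact h3 ▸ Set.mem_univ _
    · rcases h hs with h3 | ⟨r, hr, h3⟩ | h3
      · exact (h1 h3).elim
      · exact (h2 r h3).elim
      · exact h3 ▸ Set.mem_univ _

variable {p U}

/-- Rules out the exceptional clause of `weakPre` on all values that arise from concepts and
generated names. -/
theorem ne_univ_of_finite_words (h : U.Finite) : U ≠ Set.univ :=
  fun h' => Set.infinite_univ (h' ▸ h)

theorem weakPre_finite (h : U.Finite) : (weakPre p U).Finite := by
  refine ((Set.finite_singleton []).union (h.image (p :: ·))).subset ?_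
  rintro s (rfl | ⟨t, ht, rfl⟩ | hU)
  · exact .inl rfl
  · exact .inr ⟨t, ht, rfl⟩
  · exact (ne_univ_of_finite_words h hU).elim

theorem strongDel_finite (h : U.Finite) : (strongDel p U).Finite :=
  (h.preimage (fun _ _ _ _ hst => (List.cons.inj hst).2)).subset fun _ ht => ht.2

end WordOperations

/-! ## Valuations by sets of words -/

section WordValuations

variable {OBJ FEAT AT : Type u} (W : Set (List Bool))

/-- In this valuation, an upper bound of `◇C` contains the words of `◇C`. -/
def wordValuation : Valuation OBJ FEAT AT (Set (List Bool)) where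
  box := weakPre false
  dia := strongPre true
  bbox := strongDel true
  bdia := weakDel false
  gc_box := gc_weakPre false
  gc_dia := gc_strongPre true
  obj _ := ∅
  feat _ := W
  atom _ := {[]}

/-- In this valuation, a lower bound of `□C` contains the words of `□C`. -/
def dualWordValuation : Valuation OBJ FEAT AT (Set (List Bool))ᵒᵈ where
  box U := .toDual (strongPre false U.ofDual)
  dia U := .toDual (weakPre true U.ofDual)
  bbox U := .toDual (weakDel true U.ofDual)
  bdia U := .toDual (strongDel false U.ofDual)
  gc_box := (gc_strongPre false).dual
  gc_dia := (gc_weakPre true).dual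
  obj _ := .toDual W
  feat _ := .toDual ∅
  atom _ := .toDual {[]}

end WordValuations

/-! ### Values of concepts and names in the word valuations -/

section WordValuationFacts

variable {OBJ FEAT AT : Type u} {W : Set (List Bool)}

/-- Only an inclusion can be expected, since a conjunction denotes an intersection and may lose
words. In the box case the finiteness of `C.words` excludes the full set. -/
theorem wordValuation_con_subset (C : Con AT) {m : List Bool}
    (hm : m ∈ (wordValuation W : Valuation OBJ FEAT AT _).con C) :
    m ∈ C.words := by
  induction C generalizing m with
  | atom D =>
    have : m = [] := hm
    simp [this, Con.words]
  | and C D hC hD => exact List.mem_append.2 (.inl (hC hm.1))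
  | or C D hC hD => exact List.mem_append.2 (hm.imp (fun h => hC h) (fun h => hD h))
  | dia C hC =>
    rcases hm with ⟨rfl, -⟩ | ⟨t, ht, rfl⟩
    · exact Con.nil_mem_words _
    · simp [Con.words, hC ht]
  | box C hC =>
    rcases hm with rfl | ⟨t, ht, rfl⟩ | h
    · exact Con.nil_mem_words _
    · simp [Con.words, hC ht]
    · exact (ne_univ_of_finite_words
        ((C.words.finite_toSet).subset fun t ht => hC ht) h).elim

theorem dualWordValuation_con_subset (C : Con AT) {m : List Bool}
    (hm : m ∈ ((dualWordValuation W : Valuation OBJ FEAT AT _).con C).ofDual) : m ∈ C.words := by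
  induction C generalizing m with
  | atom D =>
    have : m = [] := hm
    simp [this, Con.words]
  | and C D hC hD => exact List.mem_append.2 (Or.imp (fun h => hC h) (fun h => hD h) hm)
  | or C D hC hD => exact List.mem_append.2 (.inl (hC hm.1))
  | box C hC =>
    rcases hm with ⟨rfl, -⟩ | ⟨t, ht, rfl⟩
    · exact Con.nil_mem_words _
    · simp [Con.words, hC ht]
  | dia C hC =>
    rcases hm with rfl | ⟨t, ht, rfl⟩ | h
    · exact Con.nil_mem_words _
    · simp [Con.words, hC ht]
    · exact (ne_univ_of_finite_words
        ((C.words.finite_toSet).subset fun t ht => hC ht) h).elim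

/-- The empty word survives even the intersections. Therefore the value of `F.prefixed m` contains
m, and the prefix can be recovered from the value. -/
theorem nil_mem_wordValuation_con (C : Con AT) :
    [] ∈ (wordValuation W : Valuation OBJ FEAT AT _).con C := by
  induction C with
  | atom D => exact rfl
  | and C D hC hD => exact ⟨hC, hD⟩
  | or C D hC hD => exact .inl hC
  | dia C hC => exact .inl ⟨rfl, _, hC⟩
  | box C hC => exact .inl rfl

theorem nil_mem_dualWordValuation_con (C : Con AT) :
    [] ∈ ((dualWordValuation W : Valuation OBJ FEAT AT _).con C).ofDual := by
  induction C with
  | atom D => exact rfl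
  | and C D hC hD => exact .inl hC
  | or C D hC hD => exact ⟨hC, hD⟩
  | dia C hC => exact .inl rfl
  | box C hC => exact .inl ⟨rfl, _, hC⟩

theorem mem_wordValuation_con_prefixed (C : Con AT) (m : List Bool) :
    m ∈ (wordValuation W : Valuation OBJ FEAT AT _).con (C.prefixed m) := by
  induction m with
  | nil => exact nil_mem_wordValuation_con C
  | cons p m ih =>
    cases p
    · exact .inr (.inl ⟨m, ih, rfl⟩)
    · exact .inr ⟨m, ih, rfl⟩

theorem mem_dualWordValuation_con_prefixed (C : Con AT) (m : List Bool) :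
    m ∈ ((dualWordValuation W : Valuation OBJ FEAT AT _).con (C.prefixed m)).ofDual := by
  induction m with
  | nil => exact nil_mem_dualWordValuation_con C
  | cons p m ih =>
    cases p
    · exact .inr ⟨m, ih, rfl⟩
    · exact .inr (.inl ⟨m, ih, rfl⟩)

theorem wordValuation_con_finite (C : Con AT) :
    ((wordValuation W : Valuation OBJ FEAT AT _).con C).Finite :=
  (C.words.finite_toSet).subset fun _ ht => wordValuation_con_subset C ht

theorem dualWordValuation_con_finite (C : Con AT) :
    ((dualWordValuation W : Valuation OBJ FEAT AT _).con C).ofDual.Finite :=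
  (C.words.finite_toSet).subset fun _ ht => dualWordValuation_con_subset C ht

theorem wordValuation_featName_finite (hW : W.Finite) (y : FeatName FEAT AT) :
    ((wordValuation W : Valuation OBJ FEAT AT _).featName y).Finite := by
  induction y with
  | ind x => exact hW
  | cls C => exact wordValuation_con_finite C
  | box y ih => exact weakPre_finite ih
  | bbox y ih => exact strongDel_finite ih

theorem dualWordValuation_objName_finite (hW : W.Finite) (b : ObjName OBJ AT) :
    ((dualWordValuation W : Valuation OBJ FEAT AT _).objName b).ofDual.Finite := by
  induction b with
  | ind x => exact hW
  | cls C => exact dualWordValuation_con_finite C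
  | dia y ih => exact weakPre_finite ih
  | bdia y ih => exact strongDel_finite ih

end WordValuationFacts

/-! ## An integer valuation measuring modal depth -/

section IntValuation

variable {OBJ FEAT AT : Type u}

/-- The integers between `-K` and `K` play the role of finite depths. -/
def intValuation (OBJ FEAT AT : Type u) (K : ℤ) (hK : 0 ≤ K) : Valuation OBJ FEAT AT ℤ where
  -- Up to K, □ yields a negative value. It cannot do so everywhere, for then nonnegative integers
  -- would have no image under its left adjoint; so the integers above K are left fixed. Dually, ◇
  -- fixes the integers below -K.
  box z := if K < z then z else min z 0 - 1
  bdia z := if z ≤ -1 then z + 1 else max z (K + 1)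
  dia z := if z < -K then z else max z 0 + 1
  bbox z := if 1 ≤ z then z - 1 else min z (-K - 1)
  gc_box x z := by dsimp only; split_ifs <;> omega
  gc_dia x z := by dsimp only; split_ifs <;> omega
  obj _ := -K
  feat _ := K
  atom _ := 0

variable {K : ℤ} {hK : 0 ≤ K}

/-- A modality adds at most one to the bound on the absolute value, and the size hypothesis keeps
both modalities in their ordinary branch. -/
theorem intValuation_con_bounds (C : Con AT) (hC : (C.size : ℤ) ≤ K) :
    -(C.size : ℤ) ≤ (intValuation OBJ FEAT AT K hK).con C ∧
      (intValuation OBJ FEAT AT K hK).con C ≤ C.size := by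
  induction C with
  | atom D => simp [Valuation.con, intValuation, Con.size]
  | and C D hC' hD' =>
    simp only [Con.size, Nat.cast_add, Nat.cast_one] at hC
    have h1 := hC' (by omega)
    have h2 := hD' (by omega)
    simp only [Con.size, Nat.cast_add, Nat.cast_one, Valuation.con]
    omega
  | or C D hC' hD' =>
    simp only [Con.size, Nat.cast_add, Nat.cast_one] at hC
    have h1 := hC' (by omega)
    have h2 := hD' (by omega)
    simp only [Con.size, Nat.cast_add, Nat.cast_one, Valuation.con]
    omega
  | dia C hC' =>
    simp only [Con.size, Nat.cast_add, Nat.cast_one] at hC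
    have h1 := hC' (by omega)
    have h2 : (intValuation OBJ FEAT AT K hK).con (.dia C) =
      if (intValuation OBJ FEAT AT K hK).con C < -K then (intValuation OBJ FEAT AT K hK).con C
        else max ((intValuation OBJ FEAT AT K hK).con C) 0 + 1 := rfl
    rw [h2]
    simp only [Con.size, Nat.cast_add, Nat.cast_one]
    split_ifs <;> omega
  | box C hC' =>
    simp only [Con.size, Nat.cast_add, Nat.cast_one] at hC
    have h1 := hC' (by omega)
    have h2 : (intValuation OBJ FEAT AT K hK).con (.box C) =
      if K < (intValuation OBJ FEAT AT K hK).con C then (intValuation OBJ FEAT AT K hK).con C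
        else min ((intValuation OBJ FEAT AT K hK).con C) 0 - 1 := rfl
    rw [h2]
    simp only [Con.size, Nat.cast_add, Nat.cast_one]
    split_ifs <;> omega

end IntValuation

/-! ## Sizes of the parts of an ABox -/

section Sizes

variable {OBJ FEAT AT : Type u} {A : ABox OBJ FEAT AT}

theorem Con.size_le_of_mem_subs {C D : Con AT} (h : C ∈ D.subs) : C.size ≤ D.size := by
  induction D with
  | atom E => simp_all [Con.subs]
  | and E F hE hF =>
    simp only [Con.subs, List.mem_cons, List.mem_append] at h
    rcases h with rfl | h | h
    · exact le_rfl
    · have := hE h; simp only [Con.size]; omega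
    · have := hF h; simp only [Con.size]; omega
  | or E F hE hF =>
    simp only [Con.subs, List.mem_cons, List.mem_append] at h
    rcases h with rfl | h | h
    · exact le_rfl
    · have := hE h; simp only [Con.size]; omega
    · have := hF h; simp only [Con.size]; omega
  | dia E hE =>
    simp only [Con.subs, List.mem_cons] at h
    rcases h with rfl | h
    · exact le_rfl
    · have := hE h; simp only [Con.size]; omega
  | box E hE =>
    simp only [Con.subs, List.mem_cons] at h
    rcases h with rfl | h
    · exact le_rfl
    · have := hE h; simp only [Con.size]; omega

theorem Con.length_subs (C : Con AT) : C.subs.length = C.size := by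
  induction C <;> simp_all [Con.subs, Con.size]

theorem ABox.size_cons (s : Assertion OBJ FEAT AT) (A : ABox OBJ FEAT AT) :
    ABox.size (s :: A) = s.size (fun _ => 1) (fun _ => 1) + ABox.size A := by
  simp [ABox.size]

theorem size_le_of_mem_consIn {C : Con AT} (h : C ∈ consIn A) : C.size + 1 ≤ A.size := by
  obtain ⟨s, hs, D, hD, hC⟩ := mem_consIn_iff.1 h
  have h1 := Con.size_le_of_mem_subs hC
  have h2 : s.size (fun _ => 1) (fun _ => 1) ≤ A.size :=
    List.le_sum_of_mem (List.mem_map_of_mem hs)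
  have h3 : D.size + 1 ≤ s.size (fun _ => 1) (fun _ => 1) := by
    rcases s with t | t <;> cases t <;>
      simp_all [Assertion.size, Term.size, Assertion.term, Term.con?] <;> omega
  omega

theorem length_le_size : A.length ≤ A.size := by
  induction A with
  | nil => simp
  | cons s A ih =>
    have : 1 ≤ s.size (fun _ => 1) (fun _ => 1) := by
      rcases s with t | t <;> cases t <;> simp [Assertion.size, Term.size]
    rw [ABox.size_cons, List.length_cons]
    omega

theorem length_consIn_le : (consIn A).length ≤ A.size := by
  induction A with
  | nil => simp [consIn]
  | cons s A ih =>
    have : (s.term.con?.toList.flatMap Con.subs).length ≤ s.size (fun _ => 1) (fun _ => 1) := by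
      rcases s with t | t <;> cases t <;>
        simp [Assertion.size, Term.size, Assertion.term, Term.con?, Con.length_subs] <;> omega
    rw [ABox.size_cons]
    simp only [consIn, List.flatMap_cons, List.length_append] at ih ⊢
    omega

theorem length_objsIn_le : (objsIn A).length ≤ A.size := by
  induction A with
  | nil => simp [objsIn]
  | cons s A ih =>
    have : s.term.objs.length ≤ s.size (fun _ => 1) (fun _ => 1) := by
      rcases s with t | t <;> cases t <;>
        simp [Assertion.size, Term.size, Assertion.term, Term.objs]
    rw [ABox.size_cons]
    simp only [objsIn, List.flatMap_cons, List.length_append] at ih ⊢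
    omega

theorem length_featsIn_le : (featsIn A).length ≤ A.size := by
  induction A with
  | nil => simp [featsIn]
  | cons s A ih =>
    have : s.term.feats.length ≤ s.size (fun _ => 1) (fun _ => 1) := by
      rcases s with t | t <;> cases t <;>
        simp [Assertion.size, Term.size, Assertion.term, Term.feats]
    rw [ABox.size_cons]
    simp only [featsIn, List.flatMap_cons, List.length_append] at ih ⊢
    omega

end Sizes

/-! ## The names and concepts that the algorithm can generate -/

section Generated

variable {OBJ FEAT AT : Type u} (A : ABox OBJ FEAT AT)

/-- The modal words of the concepts occurring in an ABox. -/
def wordList : List (List Bool) := [] :: (consIn A).flatMap Con.words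

/-- The modal words of the concepts occurring in an ABox, as a set. -/
def wordSet : Set (List Bool) := {m | m ∈ wordList A}

/-- A bound for the modal depth of the generated names. -/
def depthBound : ℕ := 2 * A.size + 1

abbrev upperVal : Valuation OBJ FEAT AT (Set (List Bool)) := wordValuation (wordSet A)

abbrev lowerVal : Valuation OBJ FEAT AT (Set (List Bool))ᵒᵈ := dualWordValuation (wordSet A)

abbrev depthVal : Valuation OBJ FEAT AT ℤ :=
  intValuation OBJ FEAT AT (depthBound A) (Int.natCast_nonneg _)

/-- The occurring concepts and their prefixings by `◇` and `□` with all words in the ABox. -/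
inductive GenCon : Con AT → Prop
  | occ {C} : C ∈ consIn A → GenCon C
  | dia {C} : GenCon C → (upperVal A).con (.dia C) ⊆ wordSet A → GenCon (.dia C)
  | box {C} : GenCon C → ((lowerVal A).con (.box C)).ofDual ⊆ wordSet A → GenCon (.box C)

/-- The numerical conditions are those guaranteed by the truth in `depthVal` of the term that
creates the name: y R_◇ b puts ◇b below y, hence at most K, and b R_□ y puts b below a value of □,
hence below 0. `GenFeat` is dual. -/
def GenObj : ObjName OBJ AT → Prop
  | .ind a => a ∈ objsIn A
  | .cls C => GenCon A C
  | .dia b => GenObj b ∧ (depthVal A).dia ((depthVal A).objName b) ≤ depthBound A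
  | .bdia b => GenObj b ∧ (depthVal A).objName b ≤ -1

def GenFeat : FeatName FEAT AT → Prop
  | .ind x => x ∈ featsIn A
  | .cls C => GenCon A C
  | .box y => GenFeat y ∧ -(depthBound A : ℤ) ≤ (depthVal A).box ((depthVal A).featName y)
  | .bbox y => GenFeat y ∧ 1 ≤ (depthVal A).featName y

/-- All names and concepts of a term are generated. -/
def GenTerm (t : Term (ObjName OBJ AT) (FeatName FEAT AT) AT) : Prop :=
  (∀ b ∈ t.objs, GenObj A b) ∧ (∀ y ∈ t.feats, GenFeat A y) ∧ ∀ C, t.con? = some C → GenCon A C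

variable {A}

theorem wordSet_finite : (wordSet A).Finite := List.finite_toSet _

theorem words_subset_wordSet {C : Con AT} (hC : C ∈ consIn A) {m : List Bool}
    (hm : m ∈ C.words) : m ∈ wordSet A :=
  List.mem_cons_of_mem _ (List.mem_flatMap.2 ⟨C, hC, hm⟩)

theorem mem_wordSet_of_cons_mem {p : Bool} {m : List Bool} (h : p :: m ∈ wordSet A) :
    m ∈ wordSet A := by
  have h' : p :: m ∈ (consIn A).flatMap Con.words := by
    simpa [wordSet, wordList] using h
  obtain ⟨C, hC, hm⟩ := List.mem_flatMap.1 h'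
  obtain ⟨D, hD, hm⟩ := Con.exists_subs_of_cons_mem_words hm
  exact words_subset_wordSet (mem_consIn_of_mem_subs hD hC) hm

theorem length_le_of_mem_wordSet {m : List Bool} (h : m ∈ wordSet A) : m.length ≤ A.size := by
  rcases List.mem_cons.1 h with rfl | h
  · simp
  · obtain ⟨C, hC, hm⟩ := List.mem_flatMap.1 h
    have := Con.length_lt_size_of_mem_words hm
    have := size_le_of_mem_consIn hC
    omega

theorem GenCon.of_dia {C : Con AT} (h : GenCon A (.dia C)) : GenCon A C := by
  cases h with
  | occ h => exact .occ (mem_consIn_of_mem_subs (by simp [Con.subs, Con.mem_subs_self]) h)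
  | dia h _ => exact h

theorem GenCon.of_box {C : Con AT} (h : GenCon A (.box C)) : GenCon A C := by
  cases h with
  | occ h => exact .occ (mem_consIn_of_mem_subs (by simp [Con.subs, Con.mem_subs_self]) h)
  | box h _ => exact h

theorem GenCon.of_mem_subs {C D : Con AT} (h : GenCon A C) (hD : D ∈ C.subs) : GenCon A D := by
  induction h with
  | occ h => exact .occ (mem_consIn_of_mem_subs hD h)
  | dia h1 h2 ih =>
    rcases List.mem_cons.1 hD with rfl | hD
    · exact .dia h1 h2
    · exact ih hD
  | box h1 h2 ih =>
    rcases List.mem_cons.1 hD with rfl | hD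
    · exact .box h1 h2
    · exact ih hD

/-- The side conditions of `GenCon` speak of the semantic value of the prefixed concept. That
suffices here, because this value contains the whole prefix as a word. -/
theorem GenCon.exists_prefixed {C : Con AT} (h : GenCon A C) :
    ∃ m ∈ wordSet A, ∃ F ∈ consIn A, C = F.prefixed m := by
  induction h with
  | occ h => exact ⟨[], List.mem_cons_self, _, h, rfl⟩
  | dia h1 h2 ih =>
    obtain ⟨m, -, F, hF, rfl⟩ := ih
    exact ⟨true :: m, h2 (mem_wordValuation_con_prefixed F (true :: m)), F, hF, rfl⟩
  | box h1 h2 ih =>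
    obtain ⟨m, -, F, hF, rfl⟩ := ih
    exact ⟨false :: m, h2 (mem_dualWordValuation_con_prefixed F (false :: m)), F, hF, rfl⟩

theorem GenCon.size_le {C : Con AT} (h : GenCon A C) : C.size ≤ 2 * A.size := by
  obtain ⟨m, hm, F, hF, rfl⟩ := h.exists_prefixed
  have := length_le_of_mem_wordSet hm
  have := size_le_of_mem_consIn hF
  rw [Con.size_prefixed]
  omega

theorem GenCon.bounds {C : Con AT} (h : GenCon A C) :
    -(depthBound A : ℤ) ≤ (depthVal A).con C ∧ (depthVal A).con C ≤ depthBound A := by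
  have h1 := h.size_le
  have h2 : C.size ≤ depthBound A := by unfold depthBound; omega
  have h3 : -(C.size : ℤ) ≤ (depthVal A).con C ∧ (depthVal A).con C ≤ C.size :=
    intValuation_con_bounds C (Int.ofNat_le.2 h2)
  omega

theorem depthVal_dia (z : ℤ) :
    (depthVal A).dia z = if z < -(depthBound A : ℤ) then z else max z 0 + 1 := rfl

theorem depthVal_bdia (z : ℤ) :
    (depthVal A).bdia z = if z ≤ -1 then z + 1 else max z (depthBound A + 1) := rfl

theorem depthVal_box (z : ℤ) :
    (depthVal A).box z = if (depthBound A : ℤ) < z then z else min z 0 - 1 := rfl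

theorem depthVal_bbox (z : ℤ) :
    (depthVal A).bbox z = if 1 ≤ z then z - 1 else min z (-(depthBound A : ℤ) - 1) := rfl

theorem depthVal_objName_dia (b : ObjName OBJ AT) :
    (depthVal A).objName (.dia b) = (depthVal A).dia ((depthVal A).objName b) := rfl

theorem depthVal_objName_bdia (b : ObjName OBJ AT) :
    (depthVal A).objName (.bdia b) = (depthVal A).bdia ((depthVal A).objName b) := rfl

theorem depthVal_featName_box (y : FeatName FEAT AT) :
    (depthVal A).featName (.box y) = (depthVal A).box ((depthVal A).featName y) := rfl

theorem depthVal_featName_bbox (y : FeatName FEAT AT) :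
    (depthVal A).featName (.bbox y) = (depthVal A).bbox ((depthVal A).featName y) := rfl

/-- Neither ◇ nor ◆ lowers the value here. The upper bound is part of the condition on ◇, and ◆ is
applied only to negative values and so yields at most 0. -/
theorem GenObj.bounds {b : ObjName OBJ AT} (h : GenObj A b) :
    -(depthBound A : ℤ) ≤ (depthVal A).objName b ∧ (depthVal A).objName b ≤ depthBound A := by
  induction b with
  | ind a =>
    have : (depthVal A).objName (.ind a) = -(depthBound A : ℤ) := rfl
    omega
  | cls C => exact GenCon.bounds h
  | dia b ih =>
    have h1 := ih h.1
    have h2 := h.2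
    rw [depthVal_objName_dia, depthVal_dia] at *
    split_ifs at *
    all_goals omega
  | bdia b ih =>
    have h1 := ih h.1
    have h2 := h.2
    rw [depthVal_objName_bdia, depthVal_bdia]
    split_ifs
    all_goals omega

theorem GenFeat.bounds {y : FeatName FEAT AT} (h : GenFeat A y) :
    -(depthBound A : ℤ) ≤ (depthVal A).featName y ∧ (depthVal A).featName y ≤ depthBound A := by
  induction y with
  | ind a =>
    have : (depthVal A).featName (.ind a) = (depthBound A : ℤ) := rfl
    omega
  | cls C => exact GenCon.bounds h
  | box b ih =>
    have h1 := ih h.1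
    have h2 := h.2
    rw [depthVal_featName_box, depthVal_box] at *
    split_ifs at *
    all_goals omega
  | bbox b ih =>
    have h1 := ih h.1
    have h2 := h.2
    rw [depthVal_featName_bbox, depthVal_bbox]
    split_ifs
    all_goals omega

theorem GenObj.of_mkDia {b : ObjName OBJ AT} (h : GenObj A b.mkDia) : GenObj A b := by
  cases b with
  | cls C => exact GenCon.of_dia h
  | _ => exact h.1

theorem GenFeat.of_mkBox {y : FeatName FEAT AT} (h : GenFeat A y.mkBox) : GenFeat A y := by
  cases y with
  | cls C => exact GenCon.of_box h
  | _ => exact h.1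

/-- No operation on features brings in foreign words that start with ◇. Individual features denote
the words of the ABox; □ on a finite set yields only the empty word and words starting with □; ■
deletes a leading ◇, which stays inside a suffix-closed set; and a newly formed ◇C satisfies the
condition recorded in `GenCon`. -/
theorem GenFeat.mem_wordSet {y : FeatName FEAT AT} (h : GenFeat A y) {m : List Bool}
    (hm : true :: m ∈ (upperVal A).featName y) : true :: m ∈ wordSet A := by
  induction y generalizing m with
  | ind x => exact hm
  | cls C =>
    cases h with
    | occ hC => exact words_subset_wordSet hC (wordValuation_con_subset C hm)
    | dia h1 h2 => exact h2 hm
    | box h1 h2 =>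
      rcases hm with hm | ⟨t, ht, hm⟩ | hm
      · simp at hm
      · simp at hm
      · exact (ne_univ_of_finite_words (wordValuation_con_finite _) hm).elim
  | box y ih =>
    rcases hm with hm | ⟨t, ht, hm⟩ | hm
    · simp at hm
    · simp at hm
    · exact (ne_univ_of_finite_words (wordValuation_featName_finite wordSet_finite _) hm).elim
  | bbox y ih => exact mem_wordSet_of_cons_mem (ih h.1 hm.2)

theorem GenObj.mem_wordSet {b : ObjName OBJ AT} (h : GenObj A b) {m : List Bool}
    (hm : false :: m ∈ ((lowerVal A).objName b).ofDual) : false :: m ∈ wordSet A := by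
  induction b generalizing m with
  | ind x => exact hm
  | cls C =>
    cases h with
    | occ hC => exact words_subset_wordSet hC (dualWordValuation_con_subset C hm)
    | box h1 h2 => exact h2 hm
    | dia h1 h2 =>
      rcases hm with hm | ⟨t, ht, hm⟩ | hm
      · simp at hm
      · simp at hm
      · exact (ne_univ_of_finite_words (dualWordValuation_con_finite _) hm).elim
  | dia y ih =>
    rcases hm with hm | ⟨t, ht, hm⟩ | hm
    · simp at hm
    · simp at hm
    · exact (ne_univ_of_finite_words (dualWordValuation_objName_finite wordSet_finite _) hm).elim
  | bdia y ih => exact mem_wordSet_of_cons_mem (ih h.1 hm.2)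

/-- A new concept arises only when b is some a_C; then truth in the word valuation puts the words of
◇C into the value of y, and so among those of the ABox. For all other b the integer valuation
controls the new name. -/
theorem GenObj.mkDia {b : ObjName OBJ AT} {y : FeatName FEAT AT} (hb : GenObj A b)
    (hy : GenFeat A y) (h1 : (upperVal A).SatTerm (.diaR y b))
    (h3 : (depthVal A).SatTerm (.diaR y b)) : GenObj A b.mkDia := by
  have h4 := le_trans h3 hy.bounds.2
  cases b with
  | cls C =>
    refine GenCon.dia hb fun m hm => ?_
    -- The `id` keeps `hm` in the context; it is used again once the shape of the word is known.
    rcases id hm with ⟨rfl, -⟩ | ⟨t, -, rfl⟩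
    · exact List.mem_cons_self
    · exact hy.mem_wordSet (h1 hm)
  | _ => exact ⟨hb, h4⟩

theorem GenFeat.mkBox {b : ObjName OBJ AT} {y : FeatName FEAT AT} (hb : GenObj A b)
    (hy : GenFeat A y) (h2 : (lowerVal A).SatTerm (.boxR b y))
    (h3 : (depthVal A).SatTerm (.boxR b y)) : GenFeat A y.mkBox := by
  have h4 := le_trans hb.bounds.1 h3
  cases y with
  | cls C =>
    refine GenCon.box hy fun m hm => ?_
    rcases id hm with ⟨rfl, -⟩ | ⟨t, -, rfl⟩
    · exact List.mem_cons_self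
    · exact hb.mem_wordSet (h2 hm)
  | _ => exact ⟨hy, h4⟩

theorem GenObj.bdia {b : ObjName OBJ AT} {y : FeatName FEAT AT} (hb : GenObj A b)
    (hy : GenFeat A y) (h3 : (depthVal A).SatTerm (.boxR b y)) : GenObj A (.bdia b) := by
  refine ⟨hb, ?_⟩
  have h4 := hy.bounds.2
  simp only [Valuation.SatTerm, depthVal_box] at h3
  split_ifs at h3 <;> omega

theorem GenFeat.bbox {b : ObjName OBJ AT} {y : FeatName FEAT AT} (hb : GenObj A b)
    (hy : GenFeat A y) (h3 : (depthVal A).SatTerm (.diaR y b)) : GenFeat A (.bbox y) := by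
  refine ⟨hy, ?_⟩
  have h4 := hb.bounds.1
  simp only [Valuation.SatTerm, depthVal_dia] at h3
  split_ifs at h3 <;> omega

theorem genTerm_inc {b : ObjName OBJ AT} {y : FeatName FEAT AT} :
    GenTerm A (.inc b y) ↔ GenObj A b ∧ GenFeat A y := by
  simp [GenTerm, Term.objs, Term.feats, Term.con?]

theorem genTerm_boxR {b : ObjName OBJ AT} {y : FeatName FEAT AT} :
    GenTerm A (.boxR b y) ↔ GenObj A b ∧ GenFeat A y := by
  simp [GenTerm, Term.objs, Term.feats, Term.con?]

theorem genTerm_diaR {b : ObjName OBJ AT} {y : FeatName FEAT AT} :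
    GenTerm A (.diaR y b) ↔ GenObj A b ∧ GenFeat A y := by
  simp [GenTerm, Term.objs, Term.feats, Term.con?]

theorem genTerm_objMem {b : ObjName OBJ AT} {C : Con AT} :
    GenTerm (FEAT := FEAT) A (.objMem b C) ↔ GenObj A b ∧ GenCon A C := by
  simp [GenTerm, Term.objs, Term.feats, Term.con?]

theorem genTerm_featMem {y : FeatName FEAT AT} {C : Con AT} :
    GenTerm (OBJ := OBJ) A (.featMem y C) ↔ GenFeat A y ∧ GenCon A C := by
  simp [GenTerm, Term.objs, Term.feats, Term.con?]

/-- The truth hypotheses are needed only for the two rules that create names ◇b, ◆b, □y, ■y. The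
rules that read a concept off a name cause no growth, since a classifying name counts as generated
only if its concept does. -/
theorem genTerm_of_rule {B l : Tableau OBJ FEAT AT} (h : Rule B l)
    (h1 : ∀ t, .pos t ∈ B → (upperVal A).SatTerm t)
    (h2 : ∀ t, .pos t ∈ B → (lowerVal A).SatTerm t)
    (h3 : ∀ t, .pos t ∈ B → (depthVal A).SatTerm t)
    (hB : ∀ s ∈ B, GenTerm A s.term) : ∀ s ∈ l, GenTerm A s.term := by
  have hcon {C : Con AT} (hC : C ∈ consIn B) : GenCon A C := by
    obtain ⟨s, hs, D, hD, hCD⟩ := mem_consIn_iff.1 hC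
    exact ((hB s hs).2.2 D hD).of_mem_subs hCD
  cases h with
  | create h =>
    have hC := hcon h
    simp only [List.forall_mem_cons, Assertion.term, genTerm_objMem, genTerm_featMem]
    exact ⟨⟨hC, hC⟩, ⟨hC, hC⟩, by simp⟩
  | basic ha hb =>
    have ha := genTerm_objMem.1 (hB _ ha)
    have hb := genTerm_featMem.1 (hB _ hb)
    simp only [List.forall_mem_cons, Assertion.term, genTerm_inc]
    exact ⟨⟨ha.1, hb.1⟩, by simp⟩
  | and h =>
    have h := genTerm_objMem.1 (hB _ h)
    simp only [List.forall_mem_cons, Assertion.term, genTerm_objMem]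
    exact ⟨⟨h.1, h.2.of_mem_subs (by simp [Con.subs, Con.mem_subs_self])⟩,
      ⟨h.1, h.2.of_mem_subs (by simp [Con.subs, Con.mem_subs_self])⟩, by simp⟩
  | or h =>
    have h := genTerm_featMem.1 (hB _ h)
    simp only [List.forall_mem_cons, Assertion.term, genTerm_featMem]
    exact ⟨⟨h.1, h.2.of_mem_subs (by simp [Con.subs, Con.mem_subs_self])⟩,
      ⟨h.1, h.2.of_mem_subs (by simp [Con.subs, Con.mem_subs_self])⟩, by simp⟩
  | box ha hb =>
    have ha := genTerm_objMem.1 (hB _ ha)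
    have hb := genTerm_featMem.1 (hB _ hb)
    simp only [List.forall_mem_cons, Assertion.term, genTerm_boxR]
    exact ⟨⟨ha.1, hb.1⟩, by simp⟩
  | dia ha hb =>
    have ha := genTerm_featMem.1 (hB _ ha)
    have hb := genTerm_objMem.1 (hB _ hb)
    simp only [List.forall_mem_cons, Assertion.term, genTerm_diaR]
    exact ⟨⟨hb.1, ha.1⟩, by simp⟩
  | boxName h =>
    have h := genTerm_inc.1 (hB _ h)
    simp only [List.forall_mem_cons, Assertion.term, genTerm_boxR]
    exact ⟨⟨h.1, h.2.of_mkBox⟩, by simp⟩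
  | bboxName h =>
    have h := genTerm_inc.1 (hB _ h)
    simp only [List.forall_mem_cons, Assertion.term, genTerm_diaR]
    exact ⟨⟨h.1, h.2.1⟩, by simp⟩
  | diaName h =>
    have h := genTerm_inc.1 (hB _ h)
    simp only [List.forall_mem_cons, Assertion.term, genTerm_diaR]
    exact ⟨⟨h.1.of_mkDia, h.2⟩, by simp⟩
  | bdiaName h =>
    have h := genTerm_inc.1 (hB _ h)
    simp only [List.forall_mem_cons, Assertion.term, genTerm_boxR]
    exact ⟨⟨h.1.1, h.2⟩, by simp⟩
  | andInv ha _ hc =>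
    have ha := genTerm_objMem.1 (hB _ ha)
    simp only [List.forall_mem_cons, Assertion.term, genTerm_objMem]
    exact ⟨⟨ha.1, hcon hc⟩, by simp⟩
  | orInv ha _ hc =>
    have ha := genTerm_featMem.1 (hB _ ha)
    simp only [List.forall_mem_cons, Assertion.term, genTerm_featMem]
    exact ⟨⟨ha.1, hcon hc⟩, by simp⟩
  | adjBox h =>
    have hg := genTerm_boxR.1 (hB _ h)
    simp only [List.forall_mem_cons, Assertion.term, genTerm_inc]
    exact ⟨⟨hg.1.bdia hg.2 (h3 _ h), hg.2⟩, ⟨hg.1, hg.2.mkBox hg.1 (h2 _ h) (h3 _ h)⟩, by simp⟩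
  | adjDia h =>
    have hg := genTerm_diaR.1 (hB _ h)
    simp only [List.forall_mem_cons, Assertion.term, genTerm_inc]
    exact ⟨⟨hg.1.mkDia hg.2 (h1 _ h) (h3 _ h), hg.2⟩, ⟨hg.1, hg.2.bbox hg.1 (h3 _ h)⟩, by simp⟩
  | negObj h =>
    have h := genTerm_objMem.1 (hB _ h)
    simp only [List.forall_mem_cons, Assertion.term, genTerm_inc]
    exact ⟨⟨h.1, h.2⟩, by simp⟩
  | negFeat h =>
    have h := genTerm_featMem.1 (hB _ h)
    simp only [List.forall_mem_cons, Assertion.term, genTerm_inc]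
    exact ⟨⟨h.2, h.1⟩, by simp⟩
  | appFeat h =>
    have h := genTerm_inc.1 (hB _ h)
    simp only [List.forall_mem_cons, Assertion.term, genTerm_objMem]
    exact ⟨⟨h.1, h.2⟩, by simp⟩
  | appObj h =>
    have h := genTerm_inc.1 (hB _ h)
    simp only [List.forall_mem_cons, Assertion.term, genTerm_featMem]
    exact ⟨⟨h.2, h.1⟩, by simp⟩

/-- Individual objects denote the empty set, which `strongPre` preserves, so only the terms y :: C
say anything; their words belong to the ABox by definition. -/
theorem upperVal_satTerm {t : Term OBJ FEAT AT} (ht : .pos t ∈ A) :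
    (upperVal A).SatTerm (t.map .ind .ind) := by
  cases t with
  | inc a x => exact Set.empty_subset _
  | boxR a x => exact Set.empty_subset _
  | diaR x a =>
    rintro s (⟨-, t, ht⟩ | ⟨t, ht, -⟩) <;> exact ht.elim
  | objMem a C => exact Set.empty_subset _
  | featMem x C =>
    exact fun m hm => words_subset_wordSet (mem_consIn_of_con? ht rfl)
      (wordValuation_con_subset C hm)

theorem lowerVal_satTerm {t : Term OBJ FEAT AT} (ht : .pos t ∈ A) :
    (lowerVal A).SatTerm (t.map .ind .ind) := by
  cases t with
  | inc a x => exact Set.empty_subset _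
  | diaR a x => exact Set.empty_subset _
  | boxR x a =>
    rintro s (⟨-, t, ht⟩ | ⟨t, ht, -⟩) <;> exact ht.elim
  | featMem a C => exact Set.empty_subset _
  | objMem x C =>
    exact fun m hm => words_subset_wordSet (mem_consIn_of_con? ht rfl)
      (dualWordValuation_con_subset C hm)

theorem depthVal_satTerm {t : Term OBJ FEAT AT} (ht : .pos t ∈ A) :
    (depthVal A).SatTerm (t.map .ind .ind) := by
  -- The value of ◇ at -K is 1 and that of □ at K is -1, so the relational terms of the ABox require
  -- K to be at least 1.
  have hpos : 1 ≤ depthBound A := by unfold depthBound; omega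
  have ho (a : OBJ) : (depthVal A).objName (.ind a) = -(depthBound A : ℤ) := rfl
  have hf (x : FEAT) : (depthVal A).featName (.ind x) = (depthBound A : ℤ) := rfl
  cases t with
  | inc a x =>
    simp only [Term.map, Valuation.SatTerm, ho, hf]
    omega
  | boxR a x =>
    simp only [Term.map, Valuation.SatTerm, ho, hf, depthVal_box]
    split_ifs <;> omega
  | diaR x a =>
    simp only [Term.map, Valuation.SatTerm, ho, hf, depthVal_dia]
    split_ifs <;> omega
  | objMem a C =>
    simp only [Term.map, Valuation.SatTerm, ho]
    exact (GenCon.bounds (.occ (mem_consIn_of_con? ht rfl))).1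
  | featMem x C =>
    simp only [Term.map, Valuation.SatTerm, hf]
    exact (GenCon.bounds (.occ (mem_consIn_of_con? ht rfl))).2

theorem genTerm_of_run [DecidableEq OBJ] [DecidableEq FEAT] [DecidableEq AT] {n : ℕ}
    {B : Tableau OBJ FEAT AT} (h : Run A n B) : ∀ s ∈ B, GenTerm A s.term := by
  induction h with
  | start =>
    intro s hs
    refine ⟨fun b hb => ?_, fun y hy => ?_, fun C hC => .occ ?_⟩
    · obtain ⟨a, ha, rfl⟩ := mem_objsIn_map_embed.1 (List.mem_flatMap.2 ⟨s, hs, hb⟩)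
      exact ha
    · obtain ⟨a, ha, rfl⟩ := mem_featsIn_map_embed.1 (List.mem_flatMap.2 ⟨s, hs, hy⟩)
      exact ha
    · rw [← consIn_map_embed]
      exact mem_consIn_of_con? hs hC
  | step hr _ hl _ ih =>
    intro s hs
    rcases List.mem_union_iff.1 hs with hs | hs
    · exact genTerm_of_rule hl
        ((upperVal A).satTerm_of_run hr fun t ht => upperVal_satTerm ht)
        ((lowerVal A).satTerm_of_run hr fun t ht => lowerVal_satTerm ht)
        ((depthVal A).satTerm_of_run hr fun t ht => depthVal_satTerm ht) ih s hs
    · exact ih s hs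

end Generated

/-! ## Counting the generated assertions -/

section Bounds

variable {R : Type*} [CommSemiring R]

/-- A bound for the number of generated concepts, in terms of the size of the ABox. -/
def conBound (n : R) : R := (n * n + 1) * n

/-- A bound for the number of generated object (feature) names. -/
def nameBound (n : R) : R := (8 * n + 5) * ((8 * n + 5) * (n + conBound n))

/-- A bound for the number of assertions over the generated names and concepts. -/
def assertionBound (n : R) : R :=
  2 * (3 * (nameBound n * nameBound n) + 2 * (nameBound n * conBound n))

/-- A bound for the size of the tableau. -/
def tableauBound (n : R) : R := (n + assertionBound n) * (40 * n + 20)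

end Bounds

section Counting

variable {OBJ FEAT AT : Type u} {A : ABox OBJ FEAT AT}

theorem length_flatMap_le {α β : Type*} (f : α → List β) (l : List α) (c : ℕ)
    (h : ∀ a ∈ l, (f a).length ≤ c) : (l.flatMap f).length ≤ l.length * c := by
  induction l with
  | nil => simp
  | cons a l ih =>
    have h1 := h a (by simp)
    have h2 := ih fun b hb => h b (by simp [hb])
    simp only [List.flatMap_cons, List.length_append, List.length_cons]
    linarith

theorem length_wordList_le : (wordList A).length ≤ A.size * A.size + 1 := by
  have h : ((consIn A).flatMap Con.words).length ≤ (consIn A).length * A.size :=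
    length_flatMap_le _ _ _ fun C hC => by
      have := C.length_words_le
      have := size_le_of_mem_consIn hC
      omega
  have := Nat.mul_le_mul_right A.size (length_consIn_le (A := A))
  simp only [wordList, List.length_cons]
  omega

/-- The value starts at -K or above and rises with each operation, so it bounds their number. After
a ◇ it is positive, which bars any further ◆; hence all ◆ are innermost. The induction carries both
facts, and the lemma for features is dual. -/
theorem GenObj.exists_iterate {b : ObjName OBJ AT} (h : GenObj A b) :
    ∃ (j i : ℕ) (c : ObjName OBJ AT), b = ObjName.dia^[j] (ObjName.bdia^[i] c) ∧
      ((∃ a ∈ objsIn A, c = .ind a) ∨ ∃ C, GenCon A C ∧ c = .cls C) ∧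
      -(depthBound A : ℤ) + i + j ≤ (depthVal A).objName b ∧
      (j ≠ 0 → 1 ≤ (depthVal A).objName b) := by
  induction b with
  | ind a =>
    exact ⟨0, 0, .ind a, rfl, .inl ⟨a, h, rfl⟩, by simpa using h.bounds.1, by simp⟩
  | cls C =>
    exact ⟨0, 0, .cls C, rfl, .inr ⟨C, h, rfl⟩, by simpa using GenObj.bounds (b := .cls C) h |>.1,
      by simp⟩
  | dia b ih =>
    obtain ⟨j, i, c, rfl, hc, h1, h2⟩ := ih h.1
    have h3 := h.1.bounds.1
    refine ⟨j + 1, i, c, (Function.iterate_succ_apply' _ _ _).symm, hc, ?_, fun _ => ?_⟩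
    · rw [depthVal_objName_dia, depthVal_dia]
      push_cast
      split_ifs <;> omega
    · rw [depthVal_objName_dia, depthVal_dia]
      split_ifs <;> omega
  | bdia b ih =>
    obtain ⟨j, i, c, rfl, hc, h1, h2⟩ := ih h.1
    have h3 := h.2
    have hj : j = 0 := by
      by_contra hj
      have := h2 hj
      omega
    subst hj
    refine ⟨0, i + 1, c, (Function.iterate_succ_apply' ObjName.bdia i c).symm, hc, ?_, by simp⟩
    rw [depthVal_objName_bdia, depthVal_bdia]
    push_cast at h1 ⊢
    split_ifs
    all_goals omega

theorem GenFeat.exists_iterate {y : FeatName FEAT AT} (h : GenFeat A y) :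
    ∃ (j i : ℕ) (c : FeatName FEAT AT), y = FeatName.box^[j] (FeatName.bbox^[i] c) ∧
      ((∃ a ∈ featsIn A, c = .ind a) ∨ ∃ C, GenCon A C ∧ c = .cls C) ∧
      (depthVal A).featName y ≤ (depthBound A : ℤ) - i - j ∧
      (j ≠ 0 → (depthVal A).featName y ≤ -1) := by
  induction y with
  | ind a =>
    exact ⟨0, 0, .ind a, rfl, .inl ⟨a, h, rfl⟩, by simpa using h.bounds.2, by simp⟩
  | cls C =>
    exact ⟨0, 0, .cls C, rfl, .inr ⟨C, h, rfl⟩, by simpa using GenFeat.bounds (y := .cls C) h |>.2,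
      by simp⟩
  | box b ih =>
    obtain ⟨j, i, c, rfl, hc, h1, h2⟩ := ih h.1
    have h3 := h.1.bounds.2
    refine ⟨j + 1, i, c, (Function.iterate_succ_apply' _ _ _).symm, hc, ?_, fun _ => ?_⟩
    · rw [depthVal_featName_box, depthVal_box]
      push_cast
      split_ifs <;> omega
    · rw [depthVal_featName_box, depthVal_box]
      split_ifs <;> omega
  | bbox b ih =>
    obtain ⟨j, i, c, rfl, hc, h1, h2⟩ := ih h.1
    have h3 := h.2
    have hj : j = 0 := by
      by_contra hj
      have := h2 hj
      omega
    subst hj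
    refine ⟨0, i + 1, c, (Function.iterate_succ_apply' FeatName.bbox i c).symm, hc, ?_, by simp⟩
    rw [depthVal_featName_bbox, depthVal_bbox]
    push_cast at h1 ⊢
    split_ifs
    all_goals omega

theorem ObjName.size_iterate (j i : ℕ) (c : ObjName OBJ AT) :
    (ObjName.dia^[j] (ObjName.bdia^[i] c)).size = j + i + c.size := by
  have h (i : ℕ) : (ObjName.bdia^[i] c).size = i + c.size := by
    induction i with
    | zero => simp
    | succ i ih => rw [Function.iterate_succ_apply', ObjName.size, ih]; omega
  induction j with
  | zero => simp [h]
  | succ j ih => rw [Function.iterate_succ_apply', ObjName.size, ih]; omega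

theorem FeatName.size_iterate (j i : ℕ) (c : FeatName FEAT AT) :
    (FeatName.box^[j] (FeatName.bbox^[i] c)).size = j + i + c.size := by
  have h (i : ℕ) : (FeatName.bbox^[i] c).size = i + c.size := by
    induction i with
    | zero => simp
    | succ i ih => rw [Function.iterate_succ_apply', FeatName.size, ih]; omega
  induction j with
  | zero => simp [h]
  | succ j ih => rw [Function.iterate_succ_apply', FeatName.size, ih]; omega

theorem GenObj.size_le {b : ObjName OBJ AT} (h : GenObj A b) : b.size ≤ 10 * A.size + 5 := by
  obtain ⟨j, i, c, rfl, hc, h1, -⟩ := h.exists_iterate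
  have h2 := h.bounds.2
  have h3 : c.size ≤ 2 * A.size + 1 := by
    rcases hc with ⟨a, -, rfl⟩ | ⟨C, hC, rfl⟩
    · simp [ObjName.size]
    · have := hC.size_le
      simp only [ObjName.size]; omega
  rw [ObjName.size_iterate]
  unfold depthBound at *
  omega

theorem GenFeat.size_le {y : FeatName FEAT AT} (h : GenFeat A y) : y.size ≤ 10 * A.size + 5 := by
  obtain ⟨j, i, c, rfl, hc, h1, -⟩ := h.exists_iterate
  have h2 := h.bounds.1
  have h3 : c.size ≤ 2 * A.size + 1 := by
    rcases hc with ⟨a, -, rfl⟩ | ⟨C, hC, rfl⟩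
    · simp [FeatName.size]
    · have := hC.size_le
      simp only [FeatName.size]; omega
  rw [FeatName.size_iterate]
  unfold depthBound at *
  omega

theorem GenTerm.size_le {s : Assertion (ObjName OBJ AT) (FeatName FEAT AT) AT}
    (h : GenTerm A s.term) : s.size ObjName.size FeatName.size ≤ 40 * A.size + 20 := by
  have key (t : Term (ObjName OBJ AT) (FeatName FEAT AT) AT) (h : GenTerm A t) :
      t.size ObjName.size FeatName.size ≤ 20 * A.size + 11 := by
    cases t with
    | inc a x =>
      have h := genTerm_inc.1 h
      have := h.1.size_le
      have := h.2.size_le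
      simp only [Term.size]; omega
    | boxR a x =>
      have h := genTerm_boxR.1 h
      have := h.1.size_le
      have := h.2.size_le
      simp only [Term.size]; omega
    | diaR a x =>
      have h := genTerm_diaR.1 h
      have := h.1.size_le
      have := h.2.size_le
      simp only [Term.size]; omega
    | objMem a x =>
      have h := genTerm_objMem.1 h
      have := h.1.size_le
      have := h.2.size_le
      simp only [Term.size]; omega
    | featMem a x =>
      have h := genTerm_featMem.1 h
      have := h.1.size_le
      have := h.2.size_le
      simp only [Term.size]; omega
  cases s with
  | pos t => have := key t h; simp only [Assertion.size]; omega
  | neg t => have := key t h; simp only [Assertion.size]; omega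

variable [DecidableEq AT]

variable (A) in
def conFinset : Finset (Con AT) :=
  ((wordList A).toFinset ×ˢ (consIn A).toFinset).image fun q => q.2.prefixed q.1

theorem mem_conFinset {C : Con AT} (h : GenCon A C) : C ∈ conFinset A := by
  obtain ⟨m, hm, F, hF, rfl⟩ := h.exists_prefixed
  exact Finset.mem_image.2 ⟨(m, F), Finset.mem_product.2
    ⟨List.mem_toFinset.2 hm, List.mem_toFinset.2 hF⟩, rfl⟩

theorem card_conFinset_le : (conFinset A).card ≤ conBound A.size := by
  refine Finset.card_image_le.trans ?_
  rw [Finset.card_product]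
  exact Nat.mul_le_mul ((List.toFinset_card_le _).trans length_wordList_le)
    ((List.toFinset_card_le _).trans length_consIn_le)

-- The exponents have sum at most twice `depthBound A`, that is 4|A| + 2, so the chosen range is
-- generous. The set may contain names that are never generated.
variable (A) in
def objFinset [DecidableEq OBJ] : Finset (ObjName OBJ AT) :=
  (Finset.range (8 * A.size + 5) ×ˢ Finset.range (8 * A.size + 5) ×ˢ
    ((objsIn A).toFinset.image .ind ∪ (conFinset A).image .cls)).image
      fun q => ObjName.dia^[q.1] (ObjName.bdia^[q.2.1] q.2.2)

variable (A) in
def featFinset [DecidableEq FEAT] : Finset (FeatName FEAT AT) :=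
  (Finset.range (8 * A.size + 5) ×ˢ Finset.range (8 * A.size + 5) ×ˢ
    ((featsIn A).toFinset.image .ind ∪ (conFinset A).image .cls)).image
      fun q => FeatName.box^[q.1] (FeatName.bbox^[q.2.1] q.2.2)

theorem mem_objFinset [DecidableEq OBJ] {b : ObjName OBJ AT} (h : GenObj A b) :
    b ∈ objFinset A := by
  obtain ⟨j, i, c, rfl, hc, h1, -⟩ := h.exists_iterate
  have h2 := h.bounds.2
  refine Finset.mem_image.2 ⟨(j, i, c), Finset.mem_product.2 ⟨Finset.mem_range.2 ?_,
    Finset.mem_product.2 ⟨Finset.mem_range.2 ?_, ?_⟩⟩, rfl⟩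
  · unfold depthBound at *; dsimp only; omega
  · unfold depthBound at *; dsimp only; omega
  · rcases hc with ⟨a, ha, rfl⟩ | ⟨C, hC, rfl⟩
    · exact Finset.mem_union_left _ (Finset.mem_image_of_mem _ (List.mem_toFinset.2 ha))
    · exact Finset.mem_union_right _ (Finset.mem_image_of_mem _ (mem_conFinset hC))

theorem mem_featFinset [DecidableEq FEAT] {y : FeatName FEAT AT} (h : GenFeat A y) :
    y ∈ featFinset A := by
  obtain ⟨j, i, c, rfl, hc, h1, -⟩ := h.exists_iterate
  have h2 := h.bounds.1
  refine Finset.mem_image.2 ⟨(j, i, c), Finset.mem_product.2 ⟨Finset.mem_range.2 ?_,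
    Finset.mem_product.2 ⟨Finset.mem_range.2 ?_, ?_⟩⟩, rfl⟩
  · unfold depthBound at *; dsimp only; omega
  · unfold depthBound at *; dsimp only; omega
  · rcases hc with ⟨a, ha, rfl⟩ | ⟨C, hC, rfl⟩
    · exact Finset.mem_union_left _ (Finset.mem_image_of_mem _ (List.mem_toFinset.2 ha))
    · exact Finset.mem_union_right _ (Finset.mem_image_of_mem _ (mem_conFinset hC))

theorem card_objFinset_le [DecidableEq OBJ] : (objFinset A).card ≤ nameBound A.size := by
  refine Finset.card_image_le.trans ?_
  rw [Finset.card_product, Finset.card_product, Finset.card_range]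
  refine Nat.mul_le_mul le_rfl (Nat.mul_le_mul le_rfl ((Finset.card_union_le _ _).trans ?_))
  exact Nat.add_le_add
    (Finset.card_image_le.trans ((List.toFinset_card_le _).trans length_objsIn_le))
    (Finset.card_image_le.trans card_conFinset_le)

theorem card_featFinset_le [DecidableEq FEAT] : (featFinset A).card ≤ nameBound A.size := by
  refine Finset.card_image_le.trans ?_
  rw [Finset.card_product, Finset.card_product, Finset.card_range]
  refine Nat.mul_le_mul le_rfl (Nat.mul_le_mul le_rfl ((Finset.card_union_le _ _).trans ?_))
  exact Nat.add_le_add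
    (Finset.card_image_le.trans ((List.toFinset_card_le _).trans length_featsIn_le))
    (Finset.card_image_le.trans card_conFinset_le)

variable [DecidableEq OBJ] [DecidableEq FEAT]

variable (A) in
def termFinset : Finset (Term (ObjName OBJ AT) (FeatName FEAT AT) AT) :=
  ((objFinset A ×ˢ featFinset A).image fun q => .inc q.1 q.2) ∪
  (((objFinset A ×ˢ featFinset A).image fun q => .boxR q.1 q.2) ∪
  (((objFinset A ×ˢ featFinset A).image fun q => .diaR q.2 q.1) ∪
  (((objFinset A ×ˢ conFinset A).image fun q => .objMem q.1 q.2) ∪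
  ((featFinset A ×ˢ conFinset A).image fun q => .featMem q.1 q.2))))

variable (A) in
def assertionFinset : Finset (Assertion (ObjName OBJ AT) (FeatName FEAT AT) AT) :=
  (termFinset A).image .pos ∪ (termFinset A).image .neg

theorem mem_termFinset {t : Term (ObjName OBJ AT) (FeatName FEAT AT) AT} (h : GenTerm A t) :
    t ∈ termFinset A := by
  simp only [termFinset, Finset.mem_union, Finset.mem_image, Finset.mem_product, Prod.exists]
  cases t with
  | inc a x =>
    have h := genTerm_inc.1 h
    exact .inl ⟨a, x, ⟨mem_objFinset h.1, mem_featFinset h.2⟩, rfl⟩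
  | boxR a x =>
    have h := genTerm_boxR.1 h
    exact .inr (.inl ⟨a, x, ⟨mem_objFinset h.1, mem_featFinset h.2⟩, rfl⟩)
  | diaR x a =>
    have h := genTerm_diaR.1 h
    exact .inr (.inr (.inl ⟨a, x, ⟨mem_objFinset h.1, mem_featFinset h.2⟩, rfl⟩))
  | objMem a C =>
    have h := genTerm_objMem.1 h
    exact .inr (.inr (.inr (.inl ⟨a, C, ⟨mem_objFinset h.1, mem_conFinset h.2⟩, rfl⟩)))
  | featMem x C =>
    have h := genTerm_featMem.1 h
    exact .inr (.inr (.inr (.inr ⟨x, C, ⟨mem_featFinset h.1, mem_conFinset h.2⟩, rfl⟩)))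

theorem mem_assertionFinset {s : Assertion (ObjName OBJ AT) (FeatName FEAT AT) AT}
    (h : GenTerm A s.term) : s ∈ assertionFinset A := by
  cases s with
  | pos t => exact Finset.mem_union_left _ (Finset.mem_image_of_mem _ (mem_termFinset h))
  | neg t => exact Finset.mem_union_right _ (Finset.mem_image_of_mem _ (mem_termFinset h))

theorem card_assertionFinset_le : (assertionFinset A).card ≤ assertionBound A.size := by
  have h1 := Nat.mul_le_mul (card_objFinset_le (A := A)) (card_featFinset_le (A := A))
  have h2 := Nat.mul_le_mul (card_objFinset_le (A := A)) (card_conFinset_le (A := A))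
  have h3 := Nat.mul_le_mul (card_featFinset_le (A := A)) (card_conFinset_le (A := A))
  rw [← Finset.card_product] at h1 h2 h3
  have h4 : (termFinset A).card ≤ 3 * (nameBound A.size * nameBound A.size) +
      2 * (nameBound A.size * conBound A.size) := by
    refine (Finset.card_union_le _ _).trans ((Nat.add_le_add (Finset.card_image_le.trans h1)
      ((Finset.card_union_le _ _).trans (Nat.add_le_add (Finset.card_image_le.trans h1)
      ((Finset.card_union_le _ _).trans (Nat.add_le_add (Finset.card_image_le.trans h1)
      ((Finset.card_union_le _ _).trans (Nat.add_le_add (Finset.card_image_le.trans h2)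
      (Finset.card_image_le.trans h3)))))))).trans ?_)
    omega
  refine (Finset.card_union_le _ _).trans ((Nat.add_le_add (Finset.card_image_le.trans h4)
    (Finset.card_image_le.trans h4)).trans ?_)
  unfold assertionBound
  omega

/-- An applied rule has a conclusion not yet present, so the set of stated assertions grows strictly
at each step. -/
theorem Run.le_card {n : ℕ} {B : Tableau OBJ FEAT AT} (h : Run A n B) : n ≤ B.toFinset.card := by
  induction h with
  | start => exact Nat.zero_le _
  | @step n B l hr _ _ hs ih =>
    obtain ⟨s, hs, hsB⟩ := hs
    refine Nat.succ_le_of_lt (ih.trans_lt (Finset.card_lt_card ?_))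
    refine Finset.ssubset_iff_subset_ne.2 ⟨fun t ht => ?_, fun he => hsB ?_⟩
    · rw [List.mem_toFinset] at ht ⊢
      exact List.mem_union_iff.2 (.inr ht)
    · rw [← List.mem_toFinset, he, List.mem_toFinset]
      exact List.mem_union_iff.2 (.inl hs)

/-- List union inserts only new elements, so length and number of distinct elements grow equally.
Repetitions in a tableau can thus come only from the input. -/
theorem length_union_add_card {α : Type*} [DecidableEq α] (l B : List α) :
    (l ∪ B).length + B.toFinset.card = B.length + (l ∪ B).toFinset.card := by
  induction l with
  | nil => simp
  | cons a l ih =>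
    rw [List.cons_union]
    by_cases ha : a ∈ l ∪ B
    · rw [List.insert_of_mem ha, ih]
    · rw [List.insert_of_not_mem ha, List.length_cons, List.toFinset_cons,
        Finset.card_insert_of_notMem (by rwa [List.mem_toFinset])]
      omega

theorem Run.length_le {n : ℕ} {B : Tableau OBJ FEAT AT} (h : Run A n B) :
    B.length ≤ A.length + B.toFinset.card := by
  induction h with
  | start => simp
  | @step n B l hr _ _ hs ih =>
    have := length_union_add_card l B
    omega

theorem Run.card_le {n : ℕ} {B : Tableau OBJ FEAT AT} (h : Run A n B) :
    B.toFinset.card ≤ assertionBound A.size :=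
  (Finset.card_le_card fun s hs => mem_assertionFinset
    (genTerm_of_run h s (List.mem_toFinset.1 hs))).trans card_assertionFinset_le

theorem Run.steps_le {n : ℕ} {B : Tableau OBJ FEAT AT} (h : Run A n B) :
    n ≤ assertionBound A.size := h.le_card.trans h.card_le

theorem Run.size_le {n : ℕ} {B : Tableau OBJ FEAT AT} (h : Run A n B) :
    Tableau.size B ≤ tableauBound A.size := by
  have h1 : Tableau.size B ≤ B.length * (40 * A.size + 20) := by
    have := List.sum_le_card_nsmul (B.map (Assertion.size ObjName.size FeatName.size))
      (40 * A.size + 20) (by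
        intro k hk
        obtain ⟨s, hs, rfl⟩ := List.mem_map.1 hk
        exact (genTerm_of_run h s hs).size_le)
    simpa [Tableau.size] using this
  refine h1.trans (Nat.mul_le_mul ?_ le_rfl)
  have := h.length_le
  have := h.card_le
  have := length_le_size (A := A)
  omega

end Counting

/-! ## Values computed by the programs -/

section TimedValues

variable {α β : Type u}

@[simp] theorem Timed.pure_val (a : α) : (pure a : Timed α).val = a := rfl

@[simp] theorem Timed.pure_cost (a : α) : (pure a : Timed α).cost = 0 := rfl

@[simp] theorem Timed.bind_val (x : Timed α) (f : α → Timed β) :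
    (x >>= f).val = (f x.val).val := rfl

@[simp] theorem Timed.bind_cost (x : Timed α) (f : α → Timed β) :
    (x >>= f).cost = x.cost + (f x.val).cost := rfl

@[simp] theorem tick_val (x : Timed α) : (tick x).val = x.val := rfl

@[simp] theorem tick_cost (x : Timed α) : (tick x).cost = x.cost + 1 := rfl

@[simp] theorem ifT_val (c : Timed Bool) (x y : Timed α) :
    (ifT c x y).val = if c.val then x.val else y.val := by
  unfold ifT
  cases c.val <;> rfl

theorem ifT_cost (c : Timed Bool) (x y : Timed α) :
    (ifT c x y).cost = c.cost + if c.val then x.cost else y.cost := by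
  unfold ifT
  cases c.val <;> rfl

@[simp] theorem andT_val (c d : Timed Bool) : (andT c d).val = (c.val && d.val) := by
  unfold andT
  rw [ifT_val]
  cases c.val <;> rfl

theorem andT_cost_le (c d : Timed Bool) : (andT c d).cost ≤ c.cost + d.cost := by
  unfold andT
  rw [ifT_cost]
  split_ifs <;> simp

@[simp] theorem appendT_val (l m : List α) : (appendT l m).val = l ++ m := by
  induction l <;> simp_all [appendT]

@[simp] theorem appendT_cost (l m : List α) : (appendT l m).cost = l.length + 1 := by
  induction l <;> simp_all [appendT]

@[simp] theorem flatMapT_val (f : α → Timed (List β)) (l : List α) :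
    (flatMapT f l).val = l.flatMap fun a => (f a).val := by
  induction l <;> simp_all [flatMapT]

@[simp] theorem anyT_val (f : α → Timed Bool) (l : List α) :
    (anyT f l).val = l.any fun a => (f a).val := by
  induction l with
  | nil => rfl
  | cons a l ih => cases h : (f a).val <;> simp [anyT, h, ih]

@[simp] theorem allT_val (f : α → Timed Bool) (l : List α) :
    (allT f l).val = l.all fun a => (f a).val := by
  induction l with
  | nil => rfl
  | cons a l ih => cases h : (f a).val <;> simp [allT, h, ih]

@[simp] theorem findFailT_val (f : α → Timed Bool) (l : List α) :
    (findFailT f l).val = l.find? fun a => !(f a).val := by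
  induction l with
  | nil => rfl
  | cons a l ih => cases h : (f a).val <;> simp [findFailT, h, ih]

@[simp] theorem filterT_val (f : α → Timed Bool) (l : List α) :
    (filterT f l).val = l.filter fun a => (f a).val := by
  induction l with
  | nil => rfl
  | cons a l ih => cases h : (f a).val <;> simp [filterT, h, ih]

/-- Each element pays c for the inner call, d + 1 for appending its result, and 1 for the recursive
call. -/
theorem flatMapT_cost_le (f : α → Timed (List β)) (l : List α) {c d n : ℕ}
    (hc : ∀ a ∈ l, (f a).cost ≤ c) (hd : ∀ a ∈ l, (f a).val.length ≤ d) (hn : l.length ≤ n) :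
    (flatMapT f l).cost ≤ n * (c + d + 2) + 1 := by
  refine le_trans ?_ (Nat.add_le_add_right (Nat.mul_le_mul_right _ hn) 1)
  clear hn
  induction l with
  | nil => simp [flatMapT]
  | cons a l ih =>
    have h1 := hc a (by simp)
    have h2 := hd a (by simp)
    have h3 := ih (fun b hb => hc b (by simp [hb])) fun b hb => hd b (by simp [hb])
    simp only [flatMapT, tick_cost, Timed.bind_cost, appendT_cost, List.length_cons]
    linarith

theorem flatMapT_length_le (f : α → Timed (List β)) (l : List α) {d n : ℕ}
    (hd : ∀ a ∈ l, (f a).val.length ≤ d) (hn : l.length ≤ n) :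
    (flatMapT f l).val.length ≤ n * d := by
  rw [flatMapT_val]
  exact (length_flatMap_le _ _ _ hd).trans (Nat.mul_le_mul_right _ hn)

theorem anyT_cost_le (f : α → Timed Bool) (l : List α) {c n : ℕ}
    (hc : ∀ a ∈ l, (f a).cost ≤ c) (hn : l.length ≤ n) :
    (anyT f l).cost ≤ n * (c + 1) + 1 := by
  refine le_trans ?_ (Nat.add_le_add_right (Nat.mul_le_mul_right _ hn) 1)
  clear hn
  induction l with
  | nil => simp [anyT]
  | cons a l ih =>
    have h1 := hc a (by simp)
    have h3 := ih fun b hb => hc b (by simp [hb])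
    simp only [anyT, tick_cost, ifT_cost, List.length_cons]
    split_ifs
    · simp only [Timed.pure_cost]; linarith [Nat.zero_le (l.length * (c + 1))]
    · linarith

theorem allT_cost_le (f : α → Timed Bool) (l : List α) {c n : ℕ}
    (hc : ∀ a ∈ l, (f a).cost ≤ c) (hn : l.length ≤ n) :
    (allT f l).cost ≤ n * (c + 1) + 1 := by
  refine le_trans ?_ (Nat.add_le_add_right (Nat.mul_le_mul_right _ hn) 1)
  clear hn
  induction l with
  | nil => simp [allT]
  | cons a l ih =>
    have h1 := hc a (by simp)
    have h3 := ih fun b hb => hc b (by simp [hb])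
    simp only [allT, tick_cost, ifT_cost, List.length_cons]
    split_ifs
    · linarith
    · simp only [Timed.pure_cost]; linarith [Nat.zero_le (l.length * (c + 1))]

theorem findFailT_cost_le (f : α → Timed Bool) (l : List α) {c n : ℕ}
    (hc : ∀ a ∈ l, (f a).cost ≤ c) (hn : l.length ≤ n) :
    (findFailT f l).cost ≤ n * (c + 1) + 1 := by
  refine le_trans ?_ (Nat.add_le_add_right (Nat.mul_le_mul_right _ hn) 1)
  clear hn
  induction l with
  | nil => simp [findFailT]
  | cons a l ih =>
    have h1 := hc a (by simp)
    have h3 := ih fun b hb => hc b (by simp [hb])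
    simp only [findFailT, tick_cost, ifT_cost, List.length_cons]
    split_ifs
    · linarith
    · simp only [Timed.pure_cost]; linarith [Nat.zero_le (l.length * (c + 1))]

theorem filterT_cost_le (f : α → Timed Bool) (l : List α) {c n : ℕ}
    (hc : ∀ a ∈ l, (f a).cost ≤ c) (hn : l.length ≤ n) :
    (filterT f l).cost ≤ n * (c + 1) + 1 := by
  refine le_trans ?_ (Nat.add_le_add_right (Nat.mul_le_mul_right _ hn) 1)
  clear hn
  induction l with
  | nil => simp [filterT]
  | cons a l ih =>
    have h1 := hc a (by simp)
    have h3 := ih fun b hb => hc b (by simp [hb])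
    simp only [filterT, tick_cost, Timed.bind_cost, ifT_cost, List.length_cons, Timed.pure_cost,
      ite_self]
    linarith

end TimedValues

/-! ### Correctness of the rule enumeration and the equality tests -/

section ProgramValues

variable {OBJ FEAT AT : Type u}

@[simp] theorem Con.subsT_val (C : Con AT) : C.subsT.val = C.subs := by
  induction C <;> simp_all [Con.subsT, Con.subs]

theorem Con.subsT_cost_le (C : Con AT) : C.subsT.cost ≤ C.size * C.size + C.size := by
  induction C with
  | atom D => simp [Con.subsT, Con.size]
  | and C D hC hD =>
    simp only [Con.subsT, tick_cost, Timed.bind_cost, appendT_cost, Timed.pure_cost, Con.subsT_val,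
      Con.length_subs, Con.size]
    nlinarith [Nat.zero_le (C.size * D.size)]
  | or C D hC hD =>
    simp only [Con.subsT, tick_cost, Timed.bind_cost, appendT_cost, Timed.pure_cost, Con.subsT_val,
      Con.length_subs, Con.size]
    nlinarith [Nat.zero_le (C.size * D.size)]
  | dia C hC =>
    simp only [Con.subsT, tick_cost, Timed.bind_cost, Timed.pure_cost, Con.size]
    linarith
  | box C hC =>
    simp only [Con.subsT, tick_cost, Timed.bind_cost, Timed.pure_cost, Con.size]
    linarith

@[simp] theorem consInT_val (B : Tableau OBJ FEAT AT) : (consInT B).val = consIn B := by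
  simp only [consInT, flatMapT_val, consIn]
  congr 1
  ext s : 1
  cases s.term.con? <;> simp

/-- The equivalence depends on `unbox?` rejecting the raw name `.box (.cls C)`, which `mkBox` never
produces. -/
theorem FeatName.unbox?_eq_some {y z : FeatName FEAT AT} : y.unbox? = some z ↔ y = z.mkBox := by
  constructor
  · intro h
    unfold FeatName.unbox? at h
    split at h
    · cases h; rfl
    · cases h
    · rename_i hy
      cases h
      cases z with
      | cls C => exact (hy C rfl).elim
      | _ => rfl
    · cases h
  · rintro rfl
    cases z <;> rfl

theorem FeatName.unbbox?_eq_some {y z : FeatName FEAT AT} :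
    y.unbbox? = some z ↔ y = z.bbox := by
  cases y <;> simp [FeatName.unbbox?]

theorem FeatName.con?_eq_some {y : FeatName FEAT AT} {C : Con AT} :
    y.con? = some C ↔ y = .cls C := by
  cases y <;> simp [FeatName.con?]

theorem ObjName.undia?_eq_some {b c : ObjName OBJ AT} : b.undia? = some c ↔ b = c.mkDia := by
  constructor
  · intro h
    unfold ObjName.undia? at h
    split at h
    · cases h; rfl
    · cases h
    · rename_i hy
      cases h
      cases c with
      | cls C => exact (hy C rfl).elim
      | _ => rfl
    · cases h
  · rintro rfl
    cases c <;> rfl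

theorem ObjName.unbdia?_eq_some {b c : ObjName OBJ AT} : b.unbdia? = some c ↔ b = c.bdia := by
  cases b <;> simp [ObjName.unbdia?]

theorem ObjName.con?_eq_some {b : ObjName OBJ AT} {C : Con AT} : b.con? = some C ↔ b = .cls C := by
  cases b <;> simp [ObjName.con?]

theorem mem_oneRules_inc {b : ObjName OBJ AT} {y : FeatName FEAT AT} {l : Tableau OBJ FEAT AT} :
    l ∈ oneRules (.pos (.inc b y)) ↔
      (∃ z, y = z.mkBox ∧ l = [.pos (.boxR b z)]) ∨ (∃ z, y = .bbox z ∧ l = [.pos (.diaR z b)]) ∨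
      (∃ c, b = c.mkDia ∧ l = [.pos (.diaR y c)]) ∨ (∃ c, b = .bdia c ∧ l = [.pos (.boxR c y)]) ∨
      (∃ C, y = .cls C ∧ l = [.pos (.objMem b C)]) ∨
      (∃ C, b = .cls C ∧ l = [.pos (.featMem y C)]) := by
  simp only [oneRules, List.mem_append, Option.mem_toList, Option.map_eq_some_iff,
    FeatName.unbox?_eq_some, FeatName.unbbox?_eq_some, FeatName.con?_eq_some,
    ObjName.undia?_eq_some, ObjName.unbdia?_eq_some, ObjName.con?_eq_some, eq_comm (a := l)]

theorem length_oneRules_le (s : Assertion (ObjName OBJ AT) (FeatName FEAT AT) AT) :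
    (oneRules s).length ≤ 6 := by
  have h {γ δ : Type u} (o : Option γ) (f : γ → δ) : (o.map f).toList.length ≤ 1 := by
    cases o <;> simp
  unfold oneRules
  split
  · rename_i b y
    simp only [List.length_append]
    have h1 := h y.unbox? fun z => ([.pos (.boxR b z)] : Tableau OBJ FEAT AT)
    have h2 := h y.unbbox? fun z => ([.pos (.diaR z b)] : Tableau OBJ FEAT AT)
    have h3 := h b.undia? fun c => ([.pos (.diaR y c)] : Tableau OBJ FEAT AT)
    have h4 := h b.unbdia? fun c => ([.pos (.boxR c y)] : Tableau OBJ FEAT AT)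
    have h5 := h y.con? fun C => ([.pos (.objMem b C)] : Tableau OBJ FEAT AT)
    have h6 := h b.con? fun C => ([.pos (.featMem y C)] : Tableau OBJ FEAT AT)
    omega
  all_goals simp

theorem rule_of_mem_oneRules {B l : Tableau OBJ FEAT AT}
    {s : Assertion (ObjName OBJ AT) (FeatName FEAT AT) AT} (hs : s ∈ B) (hl : l ∈ oneRules s) :
    Rule B l := by
  rcases s with t | t
  · cases t with
    | inc b y =>
      rcases mem_oneRules_inc.1 hl with ⟨z, rfl, rfl⟩ | ⟨z, rfl, rfl⟩ | ⟨z, rfl, rfl⟩ |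
        ⟨z, rfl, rfl⟩ | ⟨z, rfl, rfl⟩ | ⟨z, rfl, rfl⟩
      · exact .boxName hs
      · exact .bboxName hs
      · exact .diaName hs
      · exact .bdiaName hs
      · exact .appFeat hs
      · exact .appObj hs
    | boxR b y => rw [List.mem_singleton.1 hl]; exact .adjBox hs
    | diaR y b => rw [List.mem_singleton.1 hl]; exact .adjDia hs
    | objMem b C =>
      cases C with
      | and C D => rw [List.mem_singleton.1 hl]; exact .and hs
      | _ => simp [oneRules] at hl
    | featMem y C =>
      cases C with
      | or C D => rw [List.mem_singleton.1 hl]; exact .or hs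
      | _ => simp [oneRules] at hl
  · cases t with
    | objMem b C => rw [List.mem_singleton.1 hl]; exact .negObj hs
    | featMem y C => rw [List.mem_singleton.1 hl]; exact .negFeat hs
    | _ => simp [oneRules] at hl

variable [DecidableEq AT]

@[simp] theorem Con.eqT_val (C D : Con AT) : (C.eqT D).val = decide (C = D) := by
  induction C generalizing D <;> cases D <;> simp_all [Con.eqT]

theorem mem_twoRulesT_iff {b : ObjName OBJ AT} {y : FeatName FEAT AT} {C D : Con AT}
    {l : Tableau OBJ FEAT AT} :
    l ∈ (twoRulesT (.pos (.objMem b C)) (.pos (.featMem y D))).val ↔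
      (C = D ∧ l = [.pos (.inc b y)]) ∨ (C = .box D ∧ l = [.pos (.boxR b y)]) ∨
      (D = .dia C ∧ l = [.pos (.diaR y b)]) := by
  cases C <;> cases D <;> simp [twoRulesT, List.mem_ite_nil_right]

theorem rule_of_mem_twoRulesT {B l : Tableau OBJ FEAT AT}
    {s t : Assertion (ObjName OBJ AT) (FeatName FEAT AT) AT} (hs : s ∈ B) (ht : t ∈ B)
    (hl : l ∈ (twoRulesT s t).val) : Rule B l := by
  unfold twoRulesT at hl
  split at hl
  · rename_i b C y D
    rcases mem_twoRulesT_iff.1 hl with ⟨rfl, rfl⟩ | ⟨rfl, rfl⟩ | ⟨rfl, rfl⟩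
    · exact .basic hs ht
    · exact .box hs ht
    · exact .dia ht hs
  · simp at hl

variable [DecidableEq OBJ] [DecidableEq FEAT]

@[simp] theorem ObjName.eqT_val (a b : ObjName OBJ AT) : (a.eqT b).val = decide (a = b) := by
  induction a generalizing b <;> cases b <;> simp_all [ObjName.eqT]

@[simp] theorem FeatName.eqT_val (a b : FeatName FEAT AT) : (a.eqT b).val = decide (a = b) := by
  induction a generalizing b <;> cases b <;> simp_all [FeatName.eqT]

@[simp] theorem Term.eqT_val (s t : Term (ObjName OBJ AT) (FeatName FEAT AT) AT) :
    (s.eqT t).val = decide (s = t) := by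
  cases s <;> cases t <;> simp [Term.eqT]

@[simp] theorem Assertion.eqT_val (s t : Assertion (ObjName OBJ AT) (FeatName FEAT AT) AT) :
    (s.eqT t).val = decide (s = t) := by
  cases s <;> cases t <;> simp [Assertion.eqT]

@[simp] theorem memT_val (s : Assertion (ObjName OBJ AT) (FeatName FEAT AT) AT)
    (B : Tableau OBJ FEAT AT) : (memT s B).val = decide (s ∈ B) := by
  rw [Bool.eq_iff_iff]
  simp [memT]

theorem Con.eqT_cost_le (C D : Con AT) : (C.eqT D).cost ≤ D.size := by
  induction C generalizing D with
  | atom E => cases D <;> simp [Con.eqT, Con.size]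
  | and E F hE hF =>
    cases D with
    | and G H =>
      have := andT_cost_le (E.eqT G) (F.eqT H)
      have := hE G
      have := hF H
      simp only [Con.eqT, tick_cost, Con.size]; omega
    | _ => simp [Con.eqT, Con.size]
  | or E F hE hF =>
    cases D with
    | or G H =>
      have := andT_cost_le (E.eqT G) (F.eqT H)
      have := hE G
      have := hF H
      simp only [Con.eqT, tick_cost, Con.size]; omega
    | _ => simp [Con.eqT, Con.size]
  | dia E hE =>
    cases D with
    | dia G => simpa [Con.eqT, Con.size] using hE G
    | _ => simp [Con.eqT, Con.size]
  | box E hE =>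
    cases D with
    | box G => simpa [Con.eqT, Con.size] using hE G
    | _ => simp [Con.eqT, Con.size]

theorem ObjName.eqT_cost_le (a b : ObjName OBJ AT) : (a.eqT b).cost ≤ b.size := by
  induction a generalizing b with
  | cls C =>
    cases b with
    | cls D => simpa [ObjName.eqT, ObjName.size] using C.eqT_cost_le D
    | _ => simp [ObjName.eqT, ObjName.size]
  | _ => cases b <;> simp_all [ObjName.eqT, ObjName.size]

theorem FeatName.eqT_cost_le (a b : FeatName FEAT AT) : (a.eqT b).cost ≤ b.size := by
  induction a generalizing b with
  | cls C =>
    cases b with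
    | cls D => simpa [FeatName.eqT, FeatName.size] using C.eqT_cost_le D
    | _ => simp [FeatName.eqT, FeatName.size]
  | _ => cases b <;> simp_all [FeatName.eqT, FeatName.size]

theorem Term.eqT_cost_le (s t : Term (ObjName OBJ AT) (FeatName FEAT AT) AT) :
    (s.eqT t).cost ≤ t.size ObjName.size FeatName.size := by
  have hinc (a b : ObjName OBJ AT) (x y : FeatName FEAT AT) :
      (andT (a.eqT b) (x.eqT y)).cost ≤ b.size + y.size :=
    (andT_cost_le _ _).trans (Nat.add_le_add (a.eqT_cost_le b) (x.eqT_cost_le y))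
  have hdia (a b : ObjName OBJ AT) (x y : FeatName FEAT AT) :
      (andT (x.eqT y) (a.eqT b)).cost ≤ b.size + y.size := by
    rw [add_comm]
    exact (andT_cost_le _ _).trans (Nat.add_le_add (x.eqT_cost_le y) (a.eqT_cost_le b))
  have hobj (a b : ObjName OBJ AT) (C D : Con AT) :
      (andT (a.eqT b) (C.eqT D)).cost ≤ b.size + D.size :=
    (andT_cost_le _ _).trans (Nat.add_le_add (a.eqT_cost_le b) (C.eqT_cost_le D))
  have hfeat (x y : FeatName FEAT AT) (C D : Con AT) :
      (andT (x.eqT y) (C.eqT D)).cost ≤ y.size + D.size :=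
    (andT_cost_le _ _).trans (Nat.add_le_add (x.eqT_cost_le y) (C.eqT_cost_le D))
  cases s <;> cases t <;>
    simp only [Term.eqT, Term.size, tick_cost, Timed.pure_cost, add_le_add_iff_right,
      zero_le, hinc, hdia, hobj, hfeat]

theorem Assertion.eqT_cost_le (s t : Assertion (ObjName OBJ AT) (FeatName FEAT AT) AT) :
    (s.eqT t).cost ≤ t.size ObjName.size FeatName.size + 1 := by
  cases s <;> cases t <;> simp [Assertion.eqT, Assertion.size, Term.eqT_cost_le]
  exact (Term.eqT_cost_le _ _).trans (Nat.le_succ _)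

theorem rule_of_mem_invRulesT {B l : Tableau OBJ FEAT AT} {E : Con AT}
    {s t : Assertion (ObjName OBJ AT) (FeatName FEAT AT) AT} (hE : E ∈ consIn B) (hs : s ∈ B)
    (ht : t ∈ B) (hl : l ∈ (invRulesT E s t).val) : Rule B l := by
  unfold invRulesT at hl
  split at hl
  · simp only [tick_val, ifT_val, andT_val, ObjName.eqT_val, Con.eqT_val, Bool.and_eq_true,
      decide_eq_true_eq, Timed.pure_val, List.mem_ite_nil_right, List.mem_singleton] at hl
    obtain ⟨⟨rfl, rfl, rfl⟩, rfl⟩ := hl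
    exact .andInv hs ht hE
  · simp only [tick_val, ifT_val, andT_val, FeatName.eqT_val, Con.eqT_val, Bool.and_eq_true,
      decide_eq_true_eq, Timed.pure_val, List.mem_ite_nil_right, List.mem_singleton] at hl
    obtain ⟨⟨rfl, rfl, rfl⟩, rfl⟩ := hl
    exact .orInv hs ht hE
  · simp at hl

/-- One direction makes each iteration a legitimate step of a run; the other makes an unsuccessful
search a proof of saturation. -/
theorem mem_rulesT_iff {B l : Tableau OBJ FEAT AT} : l ∈ (rulesT B).val ↔ Rule B l := by
  simp only [rulesT, Timed.bind_val, appendT_val, List.mem_append, flatMapT_val, consInT_val,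
    List.mem_flatMap, tick_val, Timed.pure_val, List.mem_singleton]
  constructor
  · rintro (⟨C, hC, rfl⟩ | ⟨s, hs, hl⟩ | ⟨s, hs, t, ht, hl⟩ | ⟨E, hE, s, hs, t, ht, hl⟩)
    · exact .create hC
    · exact rule_of_mem_oneRules hs hl
    · exact rule_of_mem_twoRulesT hs ht hl
    · exact rule_of_mem_invRulesT hE hs ht hl
  · intro h
    cases h with
    | create h => exact .inl ⟨_, h, rfl⟩
    | basic h1 h2 =>
      exact .inr (.inr (.inl ⟨_, h1, _, h2, mem_twoRulesT_iff.2 (.inl ⟨rfl, rfl⟩)⟩))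
    | and h => exact .inr (.inl ⟨_, h, List.mem_singleton.2 rfl⟩)
    | or h => exact .inr (.inl ⟨_, h, List.mem_singleton.2 rfl⟩)
    | box h1 h2 =>
      exact .inr (.inr (.inl ⟨_, h1, _, h2, mem_twoRulesT_iff.2 (.inr (.inl ⟨rfl, rfl⟩))⟩))
    -- The premises are swapped because `twoRulesT` takes the membership of the object first.
    | dia h1 h2 =>
      exact .inr (.inr (.inl ⟨_, h2, _, h1, mem_twoRulesT_iff.2 (.inr (.inr ⟨rfl, rfl⟩))⟩))
    | boxName h => exact .inr (.inl ⟨_, h, mem_oneRules_inc.2 (.inl ⟨_, rfl, rfl⟩)⟩)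
    | bboxName h => exact .inr (.inl ⟨_, h, mem_oneRules_inc.2 (.inr (.inl ⟨_, rfl, rfl⟩))⟩)
    | diaName h =>
      exact .inr (.inl ⟨_, h, mem_oneRules_inc.2 (.inr (.inr (.inl ⟨_, rfl, rfl⟩)))⟩)
    | bdiaName h =>
      exact .inr (.inl ⟨_, h, mem_oneRules_inc.2 (.inr (.inr (.inr (.inl ⟨_, rfl, rfl⟩))))⟩)
    | andInv h1 h2 h3 =>
      exact .inr (.inr (.inr ⟨_, h3, _, h1, _, h2, by simp [invRulesT]⟩))
    | orInv h1 h2 h3 =>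
      exact .inr (.inr (.inr ⟨_, h3, _, h1, _, h2, by simp [invRulesT]⟩))
    | adjBox h => exact .inr (.inl ⟨_, h, List.mem_singleton.2 rfl⟩)
    | adjDia h => exact .inr (.inl ⟨_, h, List.mem_singleton.2 rfl⟩)
    | negObj h => exact .inr (.inl ⟨_, h, List.mem_singleton.2 rfl⟩)
    | negFeat h => exact .inr (.inl ⟨_, h, List.mem_singleton.2 rfl⟩)
    | appFeat h => exact .inr (.inl ⟨_, h,
        mem_oneRules_inc.2 (.inr (.inr (.inr (.inr (.inl ⟨_, rfl, rfl⟩)))))⟩)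
    | appObj h => exact .inr (.inl ⟨_, h,
        mem_oneRules_inc.2 (.inr (.inr (.inr (.inr (.inr ⟨_, rfl, rfl⟩)))))⟩)

theorem clashT_val_iff {B : Tableau OBJ FEAT AT} : (clashT B).val = true ↔ HasClash B := by
  simp only [clashT, anyT_val, List.any_eq_true, HasClash]
  constructor
  · rintro ⟨s, hs, h⟩
    rcases s with t | t
    · simp at h
    · cases hr : t.isRel
      · simp [hr] at h
      · exact ⟨t, hr, by simpa [hr] using h, hs⟩
  · rintro ⟨t, hr, h1, h2⟩
    exact ⟨_, h2, by simp [hr, h1]⟩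

@[simp] theorem unionT_val (l B : Tableau OBJ FEAT AT) : (unionT l B).val = l ∪ B := by
  induction l with
  | nil => simp [unionT]
  | cons s l ih =>
    rw [List.cons_union]
    by_cases h : s ∈ l ∪ B
    · simp only [unionT, tick_val, Timed.bind_val, ih, ifT_val, memT_val, h, decide_true, if_true,
        Timed.pure_val, List.insert_of_mem]
    · simp only [unionT, tick_val, Timed.bind_val, ih, ifT_val, memT_val, h, decide_false,
        Bool.false_eq_true, if_false, Timed.pure_val, List.insert_of_not_mem h]

end ProgramValues

/-! ## Costs of the programs, for tableaux of size at most `n` -/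

section CostBounds

variable {R : Type*} [CommSemiring R]

/-- The bounds live in an arbitrary commutative semiring, so that the same expression gives a number
and a polynomial. They are left unsimplified to match the shape of the general cost lemmas. -/
def memCost (n : R) : R := n * (n + 1 + 1) + 1

def consInCost (n : R) : R := n * (n * n + n + 1 + n + 2) + 1

def createCost (n : R) : R := n * n * (1 + 1 + 2) + 1

def oneRulesCost (n : R) : R := n * (1 + 6 + 2) + 1

def twoRulesCost (n : R) : R := n * (n * (3 * n + 10 + 3 + 2) + 1 + n * 3 + 2) + 1

def invRulesCost (n : R) : R :=
  n * n * (n * (n * (3 * n + 1 + 1 + 2) + 1 + n * 1 + 2) + 1 + n * (n * 1) + 2) + 1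

def rulesLength (n : R) : R := n * n * 1 + (n * 6 + (n * (n * 3) + n * n * (n * (n * 1))))

def rulesCost (n : R) : R :=
  consInCost n + createCost n + oneRulesCost n + twoRulesCost n + invRulesCost n +
    (n * (n * 3) + 1) + (n * 6 + 1) + (n * n * 1 + 1)

/-- The cost of at most two membership tests. -/
def pairCost (n : R) : R := 2 * (memCost n + 1) + 1

def iterCost (n : R) : R :=
  n * (memCost n + 1) + 1 + (rulesCost n + (rulesLength n * (pairCost n + 1) + 1) + pairCost n) + 1

end CostBounds

/-! ### Cost of one iteration -/

section ProgramCosts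

variable {OBJ FEAT AT : Type u}

theorem size_le_of_mem {B : Tableau OBJ FEAT AT} {n : ℕ} (hB : Tableau.size B ≤ n)
    {s : Assertion (ObjName OBJ AT) (FeatName FEAT AT) AT} (hs : s ∈ B) :
    s.size ObjName.size FeatName.size ≤ n :=
  (List.le_sum_of_mem (List.mem_map_of_mem hs)).trans hB

theorem Tableau.size_cons (s : Assertion (ObjName OBJ AT) (FeatName FEAT AT) AT)
    (B : Tableau OBJ FEAT AT) :
    Tableau.size (s :: B) = s.size ObjName.size FeatName.size + Tableau.size B := by
  simp [Tableau.size]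

theorem length_le_of_size_le {B : Tableau OBJ FEAT AT} {n : ℕ} (hB : Tableau.size B ≤ n) :
    B.length ≤ n := by
  refine le_trans ?_ hB
  clear hB
  induction B with
  | nil => simp
  | cons s B ih =>
    have : 1 ≤ s.size ObjName.size FeatName.size := by
      rcases s with t | t <;> cases t <;> simp [Assertion.size, Term.size]
    rw [Tableau.size_cons, List.length_cons]
    omega

theorem con_size_le_of_mem {B : Tableau OBJ FEAT AT} {n : ℕ} (hB : Tableau.size B ≤ n)
    {s : Assertion (ObjName OBJ AT) (FeatName FEAT AT) AT} (hs : s ∈ B) {C : Con AT}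
    (hC : s.term.con? = some C) : C.size ≤ n := by
  refine le_trans ?_ (size_le_of_mem hB hs)
  rcases s with t | t <;> cases t <;>
    simp_all [Assertion.size, Term.size, Assertion.term, Term.con?] <;> omega

theorem consInT_cost_le {B : Tableau OBJ FEAT AT} {n : ℕ} (hB : Tableau.size B ≤ n) :
    (consInT B).cost ≤ consInCost n := by
  refine flatMapT_cost_le _ _ (fun s hs => ?_) (fun s hs => ?_) (length_le_of_size_le hB)
  · cases h : s.term.con? with
    | none => simp
    | some C =>
      have h1 := con_size_le_of_mem hB hs h
      have h2 := C.subsT_cost_le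
      have h3 := Nat.mul_le_mul h1 h1
      dsimp only
      omega
  · cases h : s.term.con? with
    | none => simp
    | some C =>
      dsimp only
      rw [Con.subsT_val, Con.length_subs]
      exact con_size_le_of_mem hB hs h

theorem length_consIn_le_of_size_le {B : Tableau OBJ FEAT AT} {n : ℕ}
    (hB : Tableau.size B ≤ n) : (consIn B).length ≤ n * n := by
  refine (length_flatMap_le _ _ n fun s hs => ?_).trans
    (Nat.mul_le_mul_right _ (length_le_of_size_le hB))
  cases h : s.term.con? with
  | none => simp
  | some C =>
    simpa [Con.length_subs] using con_size_le_of_mem hB hs h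

theorem length_ifT_le {γ : Type u} (c : Timed Bool) (a : γ) :
    (ifT c (pure [a]) (pure [])).val.length ≤ 1 := by
  rw [ifT_val]
  split_ifs <;> simp

/-- An equality test costs at most the size of its second argument: two tests have the concept of
`t` there, one that of `s`. The additive constant covers the appends. -/
theorem length_twoRulesT_le [DecidableEq AT]
    (s t : Assertion (ObjName OBJ AT) (FeatName FEAT AT) AT) :
    (twoRulesT s t).val.length ≤ 3 ∧
      (twoRulesT s t).cost ≤ s.size ObjName.size FeatName.size +
        2 * t.size ObjName.size FeatName.size + 10 := by
  unfold twoRulesT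
  split
  · rename_i b C y D
    have h0 (E F : Con AT) (a : Tableau OBJ FEAT AT) :
        (ifT (E.eqT F) (pure [a]) (pure [])).cost ≤ F.size := by
      rw [ifT_cost]
      have := E.eqT_cost_le F
      split_ifs <;> simpa using this
    have hC := length_ifT_le (C.eqT D) ([.pos (.inc b y)] : Tableau OBJ FEAT AT)
    have hC' := h0 C D [.pos (.inc b y)]
    have hE (E : Con AT) := length_ifT_le (E.eqT D) ([.pos (.boxR b y)] : Tableau OBJ FEAT AT)
    have hE' (E : Con AT) := h0 E D [.pos (.boxR b y)]
    have hF (F : Con AT) := length_ifT_le (F.eqT C) ([.pos (.diaR y b)] : Tableau OBJ FEAT AT)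
    have hF' (F : Con AT) := h0 F C [.pos (.diaR y b)]
    cases C with
    | box E =>
      have hE := hE E
      have hE' := hE' E
      cases D with
      | dia F =>
        have hF := hF F
        have hF' := hF' F
        simp only [tick_val, tick_cost, Timed.bind_val, Timed.bind_cost, appendT_val,
          appendT_cost, List.length_append, Assertion.size, Term.size]
        omega
      | _ =>
        simp only [tick_val, tick_cost, Timed.bind_val, Timed.bind_cost, appendT_val,
          appendT_cost, List.length_append, Assertion.size, Term.size, Timed.pure_val,
          Timed.pure_cost, List.length_nil]
        omega
    | _ =>
      cases D with
      | dia F =>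
        have hF := hF F
        have hF' := hF' F
        simp only [tick_val, tick_cost, Timed.bind_val, Timed.bind_cost, appendT_val,
          appendT_cost, List.length_append, Assertion.size, Term.size, Timed.pure_val,
          Timed.pure_cost, List.length_nil]
        omega
      | _ =>
        simp only [tick_val, tick_cost, Timed.bind_val, Timed.bind_cost, appendT_val,
          appendT_cost, List.length_append, Assertion.size, Term.size, Timed.pure_val,
          Timed.pure_cost, List.length_nil]
        omega
  · simp

theorem length_rule_le {B l : Tableau OBJ FEAT AT} (h : Rule B l) : l.length ≤ 2 := by
  cases h <;> simp

variable [DecidableEq OBJ] [DecidableEq FEAT] [DecidableEq AT]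

theorem length_invRulesT_le (E : Con AT)
    (s t : Assertion (ObjName OBJ AT) (FeatName FEAT AT) AT) :
    (invRulesT E s t).val.length ≤ 1 ∧
      (invRulesT E s t).cost ≤ s.size ObjName.size FeatName.size +
        2 * t.size ObjName.size FeatName.size + 1 := by
  unfold invRulesT
  split
  · rename_i C D b E c F
    refine ⟨length_ifT_le _ _, ?_⟩
    have h1 := andT_cost_le (b.eqT c) (andT (C.eqT E) (D.eqT F))
    have h2 := andT_cost_le (C.eqT E) (D.eqT F)
    have h3 := b.eqT_cost_le c
    have h4 := C.eqT_cost_le E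
    have h5 := D.eqT_cost_le F
    simp only [tick_cost, ifT_cost, Timed.pure_cost, ite_self, Assertion.size, Term.size]
    omega
  · rename_i C D b E c F
    refine ⟨length_ifT_le _ _, ?_⟩
    have h1 := andT_cost_le (b.eqT c) (andT (C.eqT E) (D.eqT F))
    have h2 := andT_cost_le (C.eqT E) (D.eqT F)
    have h3 := b.eqT_cost_le c
    have h4 := C.eqT_cost_le E
    have h5 := D.eqT_cost_le F
    simp only [tick_cost, ifT_cost, Timed.pure_cost, ite_self, Assertion.size, Term.size]
    omega
  · simp

theorem memT_cost_le (s : Assertion (ObjName OBJ AT) (FeatName FEAT AT) AT)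
    {B : Tableau OBJ FEAT AT} {n : ℕ} (hB : Tableau.size B ≤ n) : (memT s B).cost ≤ memCost n :=
  anyT_cost_le _ _ (fun t ht => (s.eqT_cost_le t).trans
    (Nat.add_le_add_right (size_le_of_mem hB ht) 1)) (length_le_of_size_le hB)

theorem rulesT_cost_le {B : Tableau OBJ FEAT AT} {n : ℕ} (hB : Tableau.size B ≤ n) :
    (rulesT B).cost ≤ rulesCost n ∧ (rulesT B).val.length ≤ rulesLength n := by
  have hlen := length_le_of_size_le hB
  have hcs : (consInT B).val.length ≤ n * n := by
    rw [consInT_val]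
    exact length_consIn_le_of_size_le hB
  have c0 := consInT_cost_le hB
  have c1 := flatMapT_cost_le (fun C : Con AT =>
    tick (pure [([.pos (.objMem (.cls C) C), .pos (.featMem (.cls C) C)] : Tableau OBJ FEAT AT)]))
    (consInT B).val (c := 1) (d := 1) (by simp) (by simp) hcs
  have l1 := flatMapT_length_le (fun C : Con AT =>
    tick (pure [([.pos (.objMem (.cls C) C), .pos (.featMem (.cls C) C)] : Tableau OBJ FEAT AT)]))
    (consInT B).val (d := 1) (by simp) hcs
  have c2 := flatMapT_cost_le (fun s => tick (pure (oneRules s))) B (c := 1) (d := 6) (by simp)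
    (fun s _ => length_oneRules_le s) hlen
  have l2 := flatMapT_length_le (fun s => tick (pure (oneRules s))) B (d := 6)
    (fun s _ => length_oneRules_le s) hlen
  have l3' (s) := flatMapT_length_le (fun t => twoRulesT s t) B (d := 3)
    (fun t _ => (length_twoRulesT_le s t).1) hlen
  have c3' : ∀ s ∈ B, _ := fun s hs => flatMapT_cost_le (fun t => twoRulesT s t) B
    (c := 3 * n + 10) (d := 3) (fun t ht => by
      have h1 := (length_twoRulesT_le s t).2
      have h2 := size_le_of_mem hB hs
      have h3 := size_le_of_mem hB ht
      omega) (fun t _ => (length_twoRulesT_le s t).1) hlen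
  have c3 := flatMapT_cost_le (fun s => flatMapT (fun t => twoRulesT s t) B) B c3'
    (fun s _ => l3' s) hlen
  have l3 := flatMapT_length_le (fun s => flatMapT (fun t => twoRulesT s t) B) B
    (fun s _ => l3' s) hlen
  have l4' (E) (s) := flatMapT_length_le (fun t => invRulesT E s t) B (d := 1)
    (fun t _ => (length_invRulesT_le E s t).1) hlen
  have c4' (E) : ∀ s ∈ B, _ := fun s hs => flatMapT_cost_le (fun t => invRulesT E s t) B
    (c := 3 * n + 1) (d := 1) (fun t ht => by
      have h1 := (length_invRulesT_le E s t).2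
      have h2 := size_le_of_mem hB hs
      have h3 := size_le_of_mem hB ht
      omega) (fun t _ => (length_invRulesT_le E s t).1) hlen
  have l4'' (E) := flatMapT_length_le (fun s => flatMapT (fun t => invRulesT E s t) B) B
    (fun s _ => l4' E s) hlen
  have c4'' (E) := flatMapT_cost_le (fun s => flatMapT (fun t => invRulesT E s t) B) B (c4' E)
    (fun s _ => l4' E s) hlen
  have c4 := flatMapT_cost_le
    (fun E => flatMapT (fun s => flatMapT (fun t => invRulesT E s t) B) B) (consInT B).val
    (fun E _ => c4'' E) (fun E _ => l4'' E) hcs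
  have l4 := flatMapT_length_le
    (fun E => flatMapT (fun s => flatMapT (fun t => invRulesT E s t) B) B) (consInT B).val
    (fun E _ => l4'' E) hcs
  constructor
  · simp only [rulesT, Timed.bind_cost, appendT_cost, rulesCost]
    have c0 : (consInT B).cost ≤ consInCost n := c0
    have c1 : _ ≤ createCost n := c1
    have c2 : _ ≤ oneRulesCost n := c2
    have c3 : _ ≤ twoRulesCost n := c3
    have c4 : _ ≤ invRulesCost n := c4
    linarith
  · simp only [rulesT, Timed.bind_val, appendT_val, List.length_append]
    exact Nat.add_le_add l1 (Nat.add_le_add l2 (Nat.add_le_add l3 l4))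

theorem clashT_cost_le {B : Tableau OBJ FEAT AT} {n : ℕ} (hB : Tableau.size B ≤ n) :
    (clashT B).cost ≤ n * (memCost n + 1) + 1 := by
  refine anyT_cost_le _ _ (fun s _ => ?_) (length_le_of_size_le hB)
  have h1 : 1 ≤ memCost n := Nat.le_add_left _ _
  rcases s with t | t
  · exact h1
  · cases h : t.isRel
    · simpa [h] using h1
    · simpa [h] using memT_cost_le (.pos t) hB

theorem Tableau.size_union_le_cons (s : Assertion (ObjName OBJ AT) (FeatName FEAT AT) AT)
    (l B : Tableau OBJ FEAT AT) : Tableau.size (l ∪ B) ≤ Tableau.size ((s :: l) ∪ B) := by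
  rw [List.cons_union]
  by_cases h : s ∈ l ∪ B
  · rw [List.insert_of_mem h]
  · rw [List.insert_of_not_mem h, Tableau.size_cons]
    exact Nat.le_add_left _ _

theorem unionT_cost_le {l B : Tableau OBJ FEAT AT} {n : ℕ} (h : Tableau.size (l ∪ B) ≤ n) :
    (unionT l B).cost ≤ l.length * (memCost n + 1) + 1 := by
  induction l with
  | nil => simp [unionT]
  | cons s l ih =>
    have h1 := (Tableau.size_union_le_cons s l B).trans h
    have h2 := ih h1
    have h3 := memT_cost_le s h1
    simp only [unionT, tick_cost, Timed.bind_cost, unionT_val, ifT_cost, Timed.pure_cost, ite_self,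
      List.length_cons]
    linarith

/-- What one iteration of the implementation does, and its cost, for a bound `n` of the sizes of
the tableau and of the tableaux that can be reached from it by one rule application. -/
theorem iterT_spec {B : Tableau OBJ FEAT AT} {n : ℕ} (hB : Tableau.size B ≤ n)
    (hnext : ¬ HasClash B → ∀ l, Rule B l → (∃ s ∈ l, s ∉ B) → Tableau.size (l ∪ B) ≤ n) :
    (iterT B).cost ≤ iterCost n ∧
      (((iterT B).val = .inl .inconsistent ∧ HasClash B) ∨
      ((iterT B).val = .inl (.completion B) ∧ Saturated B ∧ ¬ HasClash B) ∨
      ∃ l, (iterT B).val = .inr (l ∪ B) ∧ ¬ HasClash B ∧ Rule B l ∧ ∃ s ∈ l, s ∉ B) := by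
  have hclash := clashT_cost_le hB
  have hrules := rulesT_cost_le hB
  -- A rule has at most two conclusions, so testing one instance costs at most `pairCost n`.
  have hfind := findFailT_cost_le (fun l => allT (fun s => memT s B) l) (rulesT B).val
    (c := pairCost n) (fun l hl => allT_cost_le _ _ (fun s _ => memT_cost_le s hB)
      (length_rule_le (mem_rulesT_iff.1 hl))) hrules.2
  by_cases hc : (clashT B).val = true
  · refine ⟨?_, .inl ⟨?_, clashT_val_iff.1 hc⟩⟩
    · simp only [iterT, tick_cost, ifT_cost, hc, if_true, Timed.pure_cost, iterCost]
      omega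
    · simp only [iterT, tick_val, ifT_val, hc, if_true, Timed.pure_val]
  · have hc' : ¬ HasClash B := clashT_val_iff.not.1 hc
    cases hr : (findFailT (fun l => allT (fun s => memT s B) l) (rulesT B).val).val with
    | none =>
      refine ⟨?_, .inr (.inl ⟨?_, ?_, hc'⟩)⟩
      · simp only [iterT, tick_cost, ifT_cost, hc, if_false, Timed.bind_cost, hr, Timed.pure_cost,
          iterCost, Bool.false_eq_true]
        omega
      · simp only [iterT, tick_val, ifT_val, hc, if_false, Timed.bind_val, hr, Timed.pure_val,
          Bool.false_eq_true]
      · intro l hl s hs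
        rw [findFailT_val, List.find?_eq_none] at hr
        have := hr l (mem_rulesT_iff.2 hl)
        simp only [allT_val, memT_val, Bool.not_eq_true, Bool.not_eq_false', List.all_eq_true,
          decide_eq_true_eq] at this
        exact this s hs
    | some l =>
      have hr' := hr
      rw [findFailT_val] at hr'
      have hl : Rule B l := mem_rulesT_iff.1 (List.mem_of_find?_eq_some hr')
      have hs : ∃ s ∈ l, s ∉ B := by
        have := List.find?_some hr'
        simpa using this
      have hu := unionT_cost_le (hnext hc' l hl hs)
      have hu' : (unionT l B).cost ≤ pairCost n :=
        hu.trans (Nat.add_le_add_right (Nat.mul_le_mul_right _ (length_rule_le hl)) 1)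
      refine ⟨?_, .inr (.inr ⟨l, ?_, hc', hl, hs⟩)⟩
      · simp only [iterT, tick_cost, ifT_cost, hc, if_false, Timed.bind_cost, hr, Timed.pure_cost,
          iterCost, Bool.false_eq_true]
        omega
      · simp only [iterT, tick_val, ifT_val, hc, if_false, Timed.bind_val, hr, Timed.pure_val,
          Bool.false_eq_true, unionT_val]

end ProgramCosts

/-! ## Execution of the implementation -/

section Execution

variable {OBJ FEAT AT : Type u} {A : ABox OBJ FEAT AT}

theorem initT_val : (initT A).val = A.map Assertion.embed := by
  simp only [initT, flatMapT_val, tick_val, Timed.pure_val]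
  induction A <;> simp_all

theorem initT_cost_le : (initT A).cost ≤ A.size * (1 + 1 + 2) + 1 :=
  flatMapT_cost_le _ _ (by simp) (by simp) length_le_size

theorem ObjQuery.inst_over {q : ObjQuery FEAT AT} (hq : q.Over A) {b : OBJ} (hb : b ∈ objsIn A) :
    (q.inst b).Over A := by
  cases q <;> simp_all [ObjQuery.Over, ObjQuery.inst, Query.Over, Term.objs, Term.feats, Term.con?]

theorem FeatQuery.inst_over {q : FeatQuery OBJ AT} (hq : q.Over A) {y : FEAT}
    (hy : y ∈ featsIn A) : (q.inst y).Over A := by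
  cases q <;>
    simp_all [FeatQuery.Over, FeatQuery.inst, Query.Over, Term.objs, Term.feats, Term.con?]

theorem length_objs_le {O X AT : Type u} (t : Term O X AT) : t.objs.length ≤ 1 := by
  cases t <;> simp [Term.objs]

theorem length_feats_le {O X AT : Type u} (t : Term O X AT) : t.feats.length ≤ 1 := by
  cases t <;> simp [Term.feats]

variable [DecidableEq OBJ] [DecidableEq FEAT] [DecidableEq AT]

/-- The outcome of the implementation is the outcome of a run. -/
def Outcome.IsOf (A : ABox OBJ FEAT AT) : Outcome OBJ FEAT AT → Prop
  | .inconsistent => ∃ n B, Run A n B ∧ HasClash B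
  | .completion B => (∃ n, Run A n B) ∧ Saturated B ∧ ¬ HasClash B

/-- The number k is fuel: n + k reaches the maximal length of a run. With no fuel left the iteration
must stop, as another rule application would give a run that is too long. Since `tableauBound` holds
along all runs, each iteration has the same cost bound. -/
theorem exists_loop (k : ℕ) {n : ℕ} {B : Tableau OBJ FEAT AT} (hr : Run A n B)
    (hk : assertionBound A.size ≤ n + k) :
    ∃ out m, Loop B out m ∧ m ≤ (k + 1) * iterCost (tableauBound A.size) ∧ out.IsOf A := by
  induction k generalizing n B with
  | zero =>
    obtain ⟨hcost, ⟨h1, h2⟩ | ⟨h1, h2⟩ | ⟨l, h1, h2, h3, h4⟩⟩ := iterT_spec hr.size_le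
      fun h1 l h2 h3 => (Run.step hr h1 h2 h3).size_le
    · exact ⟨_, _, .done h1, by simpa using hcost, n, B, hr, h2⟩
    · exact ⟨_, _, .done h1, by simpa using hcost, ⟨n, hr⟩, h2⟩
    · have := (Run.step hr h2 h3 h4).steps_le
      omega
  | succ k ih =>
    obtain ⟨hcost, ⟨h1, h2⟩ | ⟨h1, h2⟩ | ⟨l, h1, h2, h3, h4⟩⟩ := iterT_spec hr.size_le
      fun h1 l h2 h3 => (Run.step hr h1 h2 h3).size_le
    · exact ⟨_, _, .done h1, hcost.trans (Nat.le_mul_of_pos_left _ (Nat.succ_pos _)),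
        n, B, hr, h2⟩
    · exact ⟨_, _, .done h1, hcost.trans (Nat.le_mul_of_pos_left _ (Nat.succ_pos _)),
        ⟨n, hr⟩, h2⟩
    · obtain ⟨out, m, hl, hm, ho⟩ := ih (Run.step hr h2 h3 h4) (by omega)
      refine ⟨out, _, .next h1 hl, ?_, ho⟩
      linarith

theorem exists_executes (A : ABox OBJ FEAT AT) : ∃ out k, Executes A out k ∧
    k ≤ A.size * (1 + 1 + 2) + 1 +
      (assertionBound A.size + 1) * iterCost (tableauBound A.size) ∧ out.IsOf A := by
  obtain ⟨out, m, hl, hm, ho⟩ :=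
    exists_loop (assertionBound A.size) (Run.start (A := A)) (by omega)
  exact ⟨out, _, ⟨m, initT_val ▸ hl, rfl⟩, Nat.add_le_add initT_cost_le hm, ho⟩

/-! ## Answering queries -/

theorem answerT_val_iff {out : Outcome OBJ FEAT AT} (ho : out.IsOf A) {q : Query OBJ FEAT AT}
    (hq : q.Over A) : (answerT out q).val = true ↔ Entails A q := by
  cases out with
  | inconsistent =>
    obtain ⟨n, B, hr, hc⟩ := ho
    simp only [answerT, tick_val, Timed.pure_val, true_iff]
    exact fun M hM => (not_consistent_of_hasClash hr hc ⟨M, hM⟩).elim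
  | completion B =>
    obtain ⟨⟨n, hr⟩, hs, hc⟩ := ho
    rw [entails_iff_lookup_mem hr hs hc hq]
    simp [answerT]

theorem answerT_cost_le {out : Outcome OBJ FEAT AT} (ho : out.IsOf A) (q : Query OBJ FEAT AT) :
    (answerT out q).cost ≤ memCost (tableauBound A.size) + 1 := by
  cases out with
  | inconsistent => simp [answerT]
  | completion B =>
    obtain ⟨⟨n, hr⟩, -⟩ := ho
    exact Nat.add_le_add_right (memT_cost_le _ hr.size_le) 1

theorem mem_answerObjT_iff {out : Outcome OBJ FEAT AT} (ho : out.IsOf A) {q : ObjQuery FEAT AT}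
    (hq : q.Over A) (b : OBJ) :
    b ∈ (answerObjT A out q).val ↔ b ∈ objsIn A ∧ Entails A (q.inst b) := by
  simp only [answerObjT, Timed.bind_val, filterT_val, flatMapT_val, tick_val, Timed.pure_val,
    List.mem_filter]
  exact and_congr_right fun hb => answerT_val_iff ho (ObjQuery.inst_over hq hb)

theorem mem_answerFeatT_iff {out : Outcome OBJ FEAT AT} (ho : out.IsOf A)
    {q : FeatQuery OBJ AT} (hq : q.Over A) (y : FEAT) :
    y ∈ (answerFeatT A out q).val ↔ y ∈ featsIn A ∧ Entails A (q.inst y) := by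
  simp only [answerFeatT, Timed.bind_val, filterT_val, flatMapT_val, tick_val, Timed.pure_val,
    List.mem_filter]
  exact and_congr_right fun hy => answerT_val_iff ho (FeatQuery.inst_over hq hy)

theorem answerObjT_cost_le {out : Outcome OBJ FEAT AT} (ho : out.IsOf A)
    (q : ObjQuery FEAT AT) : (answerObjT A out q).cost ≤
      A.size * (1 + 1 + 2) + 1 + (A.size * (memCost (tableauBound A.size) + 1 + 1) + 1) := by
  refine Nat.add_le_add
    (flatMapT_cost_le _ _ (by simp) (fun s _ => length_objs_le s.term) length_le_size)
    (filterT_cost_le _ _ (fun b _ => answerT_cost_le ho _) ?_)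
  rw [flatMapT_val]
  exact length_objsIn_le

theorem answerFeatT_cost_le {out : Outcome OBJ FEAT AT} (ho : out.IsOf A)
    (q : FeatQuery OBJ AT) : (answerFeatT A out q).cost ≤
      A.size * (1 + 1 + 2) + 1 + (A.size * (memCost (tableauBound A.size) + 1 + 1) + 1) := by
  refine Nat.add_le_add
    (flatMapT_cost_le _ _ (by simp) (fun s _ => length_feats_le s.term) length_le_size)
    (filterT_cost_le _ _ (fun b _ => answerT_cost_le ho _) ?_)
  rw [flatMapT_val]
  exact length_featsIn_le

end Execution

/-! ## The polynomial -/

section PolynomialBound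

/-- A polynomial bounding all resources of the algorithm. -/
def totalBound {R : Type*} [CommSemiring R] (n : R) : R :=
  assertionBound n + tableauBound n +
    (n * (1 + 1 + 2) + 1 + (assertionBound n + 1) * iterCost (tableauBound n)) +
    (memCost (tableauBound n) + 1) +
    (n * (1 + 1 + 2) + 1 + (n * (memCost (tableauBound n) + 1 + 1) + 1))

open Polynomial

variable (q : ℕ[X]) (n : ℕ)

/-- The bounds use only sums, products and numerals, so they commute with evaluation. Allowing any
polynomial as argument covers nested bounds such as `iterCost` of `tableauBound`. -/
theorem eval_assertionBound : (assertionBound q).eval n = assertionBound (q.eval n) := by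
  simp [assertionBound, nameBound, conBound]

theorem eval_tableauBound : (tableauBound q).eval n = tableauBound (q.eval n) := by
  simp [tableauBound, eval_assertionBound]

theorem eval_memCost : (memCost q).eval n = memCost (q.eval n) := by
  simp [memCost]

theorem eval_iterCost : (iterCost q).eval n = iterCost (q.eval n) := by
  simp [iterCost, eval_memCost, pairCost, rulesLength, rulesCost, consInCost, createCost,
    oneRulesCost, twoRulesCost, invRulesCost]

theorem eval_totalBound : (totalBound (X : ℕ[X])).eval n = totalBound n := by
  simp [totalBound, eval_assertionBound, eval_tableauBound, eval_memCost, eval_iterCost]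

end PolynomialBound

end LEALC

theorem mainTheorem2 :
    ∃ p : Polynomial ℕ, ∀ (OBJ FEAT AT : Type u) [DecidableEq OBJ] [DecidableEq FEAT]
      [DecidableEq AT] (A : ABox OBJ FEAT AT),
      -- every run of the tableaux algorithm is polynomially bounded, in length and in space
      (∀ n B, Run A n B → n ≤ p.eval A.size ∧ Tableau.size B ≤ p.eval A.size) ∧
      -- a run that halts has found a clash iff the ABox is inconsistent
      (∀ n B, Run A n B → HasClash B ∨ Saturated B → (HasClash B ↔ ¬ Consistent A)) ∧
      -- otherwise the model read off its last tableau is universal for the queries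
      (∀ n B, Run A n B → ∀ hB : Saturated B, ¬ HasClash B →
        (universalModel B hB).IsModel A ∧
        ∀ q : Query OBJ FEAT AT, q.Over A → (Entails A q ↔ (universalModel B hB).Holds q)) ∧
      -- one run of the implementation halts in polynomial time, with the outcome of a run
      ∃ (out : Outcome OBJ FEAT AT) (k : ℕ), Executes A out k ∧ k ≤ p.eval A.size ∧
        (out = .inconsistent → ∃ n B, Run A n B ∧ HasClash B) ∧
        (∀ B, out = .completion B → (∃ n, Run A n B) ∧ Saturated B ∧ ¬ HasClash B) ∧
        -- and from this single outcome every query is answered correctly in polynomial time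
        (∀ q : Query OBJ FEAT AT, q.Over A →
          ((answerT out q).val = true ↔ Entails A q) ∧
          (answerT out q).cost ≤ p.eval A.size) ∧
        (∀ q : ObjQuery FEAT AT, q.Over A →
          (∀ b, b ∈ (answerObjT A out q).val ↔ b ∈ objsIn A ∧ Entails A (q.inst b)) ∧
          (answerObjT A out q).cost ≤ p.eval A.size) ∧
        (∀ q : FeatQuery OBJ AT, q.Over A →
          (∀ y, y ∈ (answerFeatT A out q).val ↔ y ∈ featsIn A ∧ Entails A (q.inst y)) ∧
          (answerFeatT A out q).cost ≤ p.eval A.size) := by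
  refine ⟨totalBound Polynomial.X, fun OBJ FEAT AT _ _ _ A => ?_⟩
  rw [eval_totalBound]
  -- Every bound needed below is a summand of this expansion, so the remaining inequalities are
  -- linear with the individual bounds as atoms.
  have hT : totalBound A.size = assertionBound A.size + tableauBound A.size +
    (A.size * (1 + 1 + 2) + 1 + (assertionBound A.size + 1) * iterCost (tableauBound A.size)) +
    (memCost (tableauBound A.size) + 1) +
    (A.size * (1 + 1 + 2) + 1 + (A.size * (memCost (tableauBound A.size) + 1 + 1) + 1)) := rfl
  refine ⟨fun n B hr => ?_, fun n B hr hB => ⟨not_consistent_of_hasClash hr, fun hA => ?_⟩,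
    fun n B hr hB hc => ⟨universalModel_isModel hB hr.subset hc, fun q hq => ?_⟩, ?_⟩
  · have h1 := hr.steps_le
    have h2 := hr.size_le
    omega
  -- Halting without a clash means saturation, and then the model read off the tableau witnesses
  -- consistency.
  · by_contra hc
    exact hA ⟨_, universalModel_isModel (hB.resolve_left hc) hr.subset hc⟩
  · rw [entails_iff_lookup_mem hr hB hc hq, universalModel_holds_iff hB hr.subset hq]
  · obtain ⟨out, k, he, hk, ho⟩ := exists_executes A
    refine ⟨out, k, he, by omega, ?_, ?_, fun q hq => ⟨answerT_val_iff ho hq, ?_⟩,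
      fun q hq => ⟨mem_answerObjT_iff ho hq, ?_⟩, fun q hq => ⟨mem_answerFeatT_iff ho hq, ?_⟩⟩
    · rintro rfl
      exact ho
    · rintro B rfl
      exact ho
    · have := answerT_cost_le ho q
      omega
    · have := answerObjT_cost_le ho q
      omega
    · have := answerFeatT_cost_le ho q
      omega
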